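/- Let $(\mathcal A,\varphi,\varphi_2)$ be a second order probability space: $\mathcal A$ is a unital complex $*$-algebra, $\varphi:\mathcal A\to\mathbb C$ is a tracial linear functional with $\varphi(1)=1$, and $\varphi_2:\mathcal A\times\mathcal A\to\mathbb C$ is a symmetric bilinear functional which is tracial in each variable and satisfies $\varphi_2(1,a)=0$ for all $a\in\mathcal A$. The first and second order free cumulants $\kappa_n$ and $\kappa_{m,n}$ ($m,n\ge1$) are defined recursively by $$\varphi(a_1\cdots a_n)=\sum_{\pi\in NC(n)}\kappa_\pi(a_1,\dots,a_n),$$ $$\varphi_2(a_1\cdots a_m,\,a_{m+1}\cdots a_{m+n})=\sum_{\pi\in S_{NC}(m,n)}\kappa_\pi(a_1,\dots,a_{m+n})+\sum_{(\mathcal U,\pi)\in\mathcal{PS}_{NC}(m,n)'}\kappa_{(\mathcal U,\pi)}(a_1,\dots,a_{m+n}).$$ Here $NC(n)$ is the set of non-crossing partitions of $[n]$, regarded as permutations whose cycles are the blocks in increasing order. $S_{NC}(m,n)$ is the set of non-crossing annular permutations, i.e. permutations $\pi$ of $[m+n]$ having a cycle that meets both cycles of $\gamma_{m,n}=(1,\dots,m)(m+1,\dots,m+n)$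 and satisfying $|\pi|+|\pi^{-1}\gamma_{m,n}|=|\gamma_{m,n}|+2$, where $|\sigma|$ is the number of points minus the number of cycles of $\sigma$. $\mathcal{PS}_{NC}(m,n)'$ is the set of pairs $(\mathcal U,\pi)$ with $\pi=\pi_1\times\pi_2\in NC(m)\times NC(n)$ and $\mathcal U$ obtained from the partition into the cycles of $\pi$ by joining one cycle of $\pi_1$ with one cycle of $\pi_2$. Finally, $\kappa_\pi$ is the product of the first order cumulants along the cycles of $\pi$, and $\kappa_{(\mathcal U,\pi)}$ is the product of the second order cumulant of the two joined cycles and the first order cumulants of the remaining cycles. For $a\in\mathcal A$ put $a^{(1)}=a$ and $a^{(-1)}=a^*$. * Elements $a,b\in\mathcal A$ are *second order $*$-free* if all mixed first and second order cumulants with entries from the unital $*$-subalgebras generated by $a$ and by $b$ vanish. * A unitary $u\in\mathcal A$ is a *second order Haar unitary* if $\varphi(u^k)=\varphi((u^*)^k)=0$ for all $k\ge1$ and $\varphi_2(u^k,(u^*)^l)=k\,\delta_{k,l}$ for all $k,l\ge1$. * $a$ is *second order $R$-diagonal* if all $\kappa_n(a^{(\epsilon_1)},\dots,a^{(\epsilon_n)})$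 vanish except possibly those with $n$ even and alternating $\epsilon_1,\dots,\epsilon_n$; all $\kappa_{m,n}(a^{(\epsilon_1)},\dots,a^{(\epsilon_{m+n})})$ vanish except possibly those with $m$ and $n$ even, $\epsilon_1,\dots,\epsilon_m$ alternating and $\epsilon_{m+1},\dots,\epsilon_{m+n}$ alternating; and $\kappa_{2p,2q}(a,a^*,\dots,a,a^*)=\kappa_{2p,2q}(a^*,a,\dots,a^*,a)$ for all $p,q\ge1$. * $a$ and $b$ have the *same second order $*$-distribution* if $$\varphi(a^{(\epsilon_1)}\cdots a^{(\epsilon_n)})=\varphi(b^{(\epsilon_1)}\cdots b^{(\epsilon_n)})$$ and $$\varphi_2(a^{(\epsilon_1)}\cdots a^{(\epsilon_m)},a^{(\epsilon_{m+1})}\cdots a^{(\epsilon_{m+n})})=\varphi_2(b^{(\epsilon_1)}\cdots b^{(\epsilon_m)},b^{(\epsilon_{m+1})}\cdots b^{(\epsilon_{m+n})})$$ for all $m,n\ge 0$ and all signs $\epsilon_i\in\{1,-1\}$. **Proposition.** Let $r,u\in\mathcal A$ be second order $*$-free and let $u$ be a second order Haar unitary. Then $r$ is second order $R$-diagonal if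 and only if $r$ and $ur$ have the same second order $*$-distribution. -/

import Mathlib

/-! ### Second order probability spaces -/

/-- A second order (noncommutative) probability space structure on a unital complex `*`-algebra:
a normalized tracial linear functional `φ` and a symmetric bilinear functional `φ₂` which is
tracial in each variable and vanishes when one argument is `1`. -/
structure SecondOrderSpace (A : Type*) [Ring A] [StarRing A] [Algebra ℂ A] [StarModule ℂ A] where
  φ : A →ₗ[ℂ] ℂ
  φ₂ : A →ₗ[ℂ] A →ₗ[ℂ] ℂ
  φ_one : φ 1 = 1
  φ_tracial : ∀ a b, φ (a * b) = φ (b * a)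
  φ₂_symm : ∀ a b, φ₂ a b = φ₂ b a
  φ₂_tracial_left : ∀ a b c, φ₂ (a * b) c = φ₂ (b * a) c
  φ₂_tracial_right : ∀ a b c, φ₂ a (b * c) = φ₂ a (c * b)
  φ₂_one_left : ∀ a, φ₂ 1 a = 0
  φ₂_one_right : ∀ a, φ₂ a 1 = 0

namespace SecondOrder

/-! ### Non-crossing permutations of the disc and of the annulus -/

/-- The smallest elements of the cycles of `π`; fixed points count as cycles. They serve as
canonical representatives of the cycles. -/
def cycleMins {n : ℕ} (π : Equiv.Perm (Fin n)) : Finset (Fin n) :=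
  Finset.univ.filter fun i => ∀ j, π.SameCycle i j → i ≤ j

/-- The length `|π| = n - #(π)`, where `#(π)` is the number of cycles of `π`. -/
def permLength {n : ℕ} (π : Equiv.Perm (Fin n)) : ℕ := n - (cycleMins π).card

/-- The set `NC(n)` of non-crossing partitions of `n` points on a circle. A partition is regarded
as the permutation whose cycles are its blocks, each written in increasing order; the
non-crossing ones are those for which the triangle inequality `|γ| ≤ |π| + |π⁻¹ γ|` is an
equality, where `γ` is the cyclic permutation `i ↦ i + 1`. -/
def discNC (n : ℕ) : Finset (Equiv.Perm (Fin n)) :=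
  Finset.univ.filter fun π =>
    permLength π + permLength (π⁻¹ * finRotate n) = permLength (finRotate n)

/-- The permutation `γ_{m,n}` with the two cycles `(1, …, m)` and `(m + 1, …, m + n)`. -/
def annularRotate (m n : ℕ) : Equiv.Perm (Fin (m + n)) :=
  finSumFinEquiv.permCongr ((finRotate m).sumCongr (finRotate n))

/-- The set `S_NC(m,n)` of non-crossing annular permutations: some cycle meets both circles, and
`|π| + |π⁻¹ γ_{m,n}| = |γ_{m,n}| + 2`. -/
def annularNC (m n : ℕ) : Finset (Equiv.Perm (Fin (m + n))) :=
  Finset.univ.filter fun π =>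
    (∃ (i : Fin m) (j : Fin n), π.SameCycle (Fin.castAdd n i) (Fin.natAdd m j)) ∧
    permLength π + permLength (π⁻¹ * annularRotate m n) = permLength (annularRotate m n) + 2

/-! ### Free cumulants of first and second order -/

/-- The number of elements of the cycle of `π` through `i`. -/
noncomputable def cycleLen {n : ℕ} (π : Equiv.Perm (Fin n)) (i : Fin n) : ℕ :=
  Function.minimalPeriod π i

/-- The entries of `a` along the cycle of `π` through `i`: `a i, a (π i), a (π (π i)), …`. -/
noncomputable def cycleWord {A : Type*} {n : ℕ} (π : Equiv.Perm (Fin n)) (a : Fin n → A)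
    (i : Fin n) : Fin (cycleLen π i) → A :=
  fun k => a ((π ^ (k : ℕ)) i)

section Cumulants

variable {A : Type*} [Ring A] [StarRing A] [Algebra ℂ A] [StarModule ℂ A]

/-- The first order free cumulants `κ_n`, obtained by solving the moment-cumulant formula
`φ(a₁ ⋯ a_n) = ∑_{π ∈ NC(n)} ∏_{cycles of π} κ` recursively for the term `π = γ` with one cycle.
In every other term all cycles have fewer than `n` elements, so that the `if` is always
satisfied there; see `moment_eq_sum_cumulant` for the resulting formula. -/
noncomputable def cumulant (S : SecondOrderSpace A) (n : ℕ) (a : Fin n → A) : ℂ :=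
  S.φ (List.ofFn a).prod -
    ∑ π ∈ (discNC n).erase (finRotate n), ∏ i ∈ cycleMins π,
      if _h : cycleLen π i < n then cumulant S (cycleLen π i) (cycleWord π a i) else 0
termination_by n

/-- The multiplicative extension `κ_π(a₁, …, a_n) = ∏_{cycles of π} κ`. -/
noncomputable def cumulantPerm (S : SecondOrderSpace A) {n : ℕ} (π : Equiv.Perm (Fin n))
    (a : Fin n → A) : ℂ :=
  ∏ i ∈ cycleMins π, cumulant S (cycleLen π i) (cycleWord π a i)

/-- The set `PS_NC(m,n)'` of partitioned permutations `(U, π)`, where `π = π₁ × π₂` with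
`π₁ ∈ NC(m)` and `π₂ ∈ NC(n)`, and `U` is obtained from the cycle partition of `π` by joining one
cycle of `π₁` with one cycle of `π₂`. Such a pair is recorded as `(π₁, π₂, i, j)`, where `i` and
`j` are the smallest elements of the two joined (marked) cycles. -/
def markedNC (m n : ℕ) :
    Finset (Equiv.Perm (Fin m) × Equiv.Perm (Fin n) × Fin m × Fin n) :=
  Finset.univ.filter fun x =>
    x.1 ∈ discNC m ∧ x.2.1 ∈ discNC n ∧ x.2.2.1 ∈ cycleMins x.1 ∧ x.2.2.2 ∈ cycleMins x.2.1

/-- The contribution to `κ_{(U,π)}` of the cycles that are not marked: the product of the first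
order cumulants along the cycles of `π` other than the one through `i`. -/
noncomputable def unmarkedCumulant (S : SecondOrderSpace A) {n : ℕ} (π : Equiv.Perm (Fin n))
    (i : Fin n) (a : Fin n → A) : ℂ :=
  ∏ k ∈ (cycleMins π).erase i, cumulant S (cycleLen π k) (cycleWord π a k)

/-- The second order free cumulants `κ_{m,n}(a₁, …, a_m ; b₁, …, b_n)`, obtained by solving the
moment-cumulant formula
`φ₂(a₁ ⋯ a_m, b₁ ⋯ b_n) = ∑_{π ∈ S_NC(m,n)} κ_π + ∑_{(U,π) ∈ PS_NC(m,n)'} κ_{(U,π)}`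
recursively for the term in which both `π₁` and `π₂` have one cycle only. In every other term
the two marked cycles have fewer than `m + n` elements together, so that the `if` is always
satisfied there; see `fluctuation_eq_sum_cumulant₂` for the resulting formula. -/
noncomputable def cumulant₂ (S : SecondOrderSpace A) (m n : ℕ) (a : Fin m → A) (b : Fin n → A) :
    ℂ :=
  S.φ₂ (List.ofFn a).prod (List.ofFn b).prod -
    ∑ π ∈ annularNC m n, cumulantPerm S π (Fin.append a b) -
    ∑ x ∈ (markedNC m n).filter fun x => ¬ (x.1 = finRotate m ∧ x.2.1 = finRotate n),
      if _h : cycleLen x.1 x.2.2.1 + cycleLen x.2.1 x.2.2.2 < m + n then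
        cumulant₂ S (cycleLen x.1 x.2.2.1) (cycleLen x.2.1 x.2.2.2)
            (cycleWord x.1 a x.2.2.1) (cycleWord x.2.1 b x.2.2.2) *
          unmarkedCumulant S x.1 x.2.2.1 a * unmarkedCumulant S x.2.1 x.2.2.2 b
      else 0
termination_by m + n

/-- The multiplicative extension `κ_{(U,π)}` for `(U, π) ∈ PS_NC(m,n)'`. -/
noncomputable def cumulantMarked (S : SecondOrderSpace A) {m n : ℕ} (a : Fin m → A)
    (b : Fin n → A) (x : Equiv.Perm (Fin m) × Equiv.Perm (Fin n) × Fin m × Fin n) : ℂ :=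
  cumulant₂ S (cycleLen x.1 x.2.2.1) (cycleLen x.2.1 x.2.2.2)
      (cycleWord x.1 a x.2.2.1) (cycleWord x.2.1 b x.2.2.2) *
    unmarkedCumulant S x.1 x.2.2.1 a * unmarkedCumulant S x.2.1 x.2.2.2 b

end Cumulants

/-! The recursive definitions satisfy the moment-cumulant formulas. -/

section MomentCumulant

theorem cycleMins_one (n : ℕ) : cycleMins (1 : Equiv.Perm (Fin n)) = Finset.univ := by
  ext i
  simp [cycleMins]

theorem sameCycle_iff_pow_lt {n : ℕ} {π : Equiv.Perm (Fin n)} {i j : Fin n} :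
    π.SameCycle i j ↔ ∃ k : Fin (cycleLen π i), (π ^ (k : ℕ)) i = j := by
  constructor
  · intro h
    obtain ⟨k, -, hk⟩ := h.exists_pow_eq''
    have hpos : 0 < Function.minimalPeriod π i :=
      Function.minimalPeriod_pos_of_mem_periodicPts
        (Function.Injective.mem_periodicPts π.injective i)
    refine ⟨⟨k % Function.minimalPeriod π i, Nat.mod_lt _ hpos⟩, ?_⟩
    rw [← hk.2]
    simp only [Equiv.Perm.coe_pow]
    exact Function.iterate_mod_minimalPeriod_eq
  · rintro ⟨k, hk⟩
    exact ⟨(k : ℕ), by simpa using hk⟩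

theorem cycleLen_eq_card {n : ℕ} (π : Equiv.Perm (Fin n)) (i : Fin n) :
    cycleLen π i = (Finset.univ.filter fun j => π.SameCycle i j).card := by
  classical
  have h : (Finset.univ.filter fun j => π.SameCycle i j) =
      Finset.univ.image fun k : Fin (cycleLen π i) => (π ^ (k : ℕ)) i := by
    ext j
    simp [sameCycle_iff_pow_lt]
  rw [h, Finset.card_image_of_injective, Finset.card_fin]
  intro k l hkl
  simp only [Equiv.Perm.coe_pow] at hkl
  exact Fin.ext (Function.iterate_injOn_Iio_minimalPeriod k.2 l.2 hkl)

theorem cycleLen_le {n : ℕ} (π : Equiv.Perm (Fin n)) (i : Fin n) : cycleLen π i ≤ n := by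
  rw [cycleLen_eq_card]
  simpa using Finset.card_le_univ (Finset.univ.filter fun j => π.SameCycle i j)

theorem sameCycle_of_cycleLen {n : ℕ} {π : Equiv.Perm (Fin n)} {i : Fin n}
    (h : cycleLen π i = n) (j : Fin n) : π.SameCycle i j := by
  rw [cycleLen_eq_card] at h
  have := Finset.eq_univ_of_card _ (h.trans (Fintype.card_fin n).symm)
  simpa using this.ge (Finset.mem_univ j)

theorem cycleMins_of_sameCycle {n : ℕ} [NeZero n] {π : Equiv.Perm (Fin n)}
    (h : ∀ i j, π.SameCycle i j) : cycleMins π = {0} := by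
  ext i
  simp only [cycleMins, Finset.mem_filter, Finset.mem_univ, true_and, Finset.mem_singleton]
  exact ⟨fun hi => le_antisymm (hi 0 (h _ _)) (Fin.zero_le _), fun hi j _ => hi ▸ Fin.zero_le _⟩

theorem finRotate_pow_zero {n : ℕ} (k : Fin (n + 1)) :
    ((finRotate (n + 1)) ^ (k : ℕ)) 0 = k := by
  obtain ⟨k, hk⟩ := k
  induction k with
  | zero => rfl
  | succ k ih =>
    rw [pow_succ', Equiv.Perm.mul_apply, ih (by omega), finRotate_of_lt (by omega)]

theorem finRotate_sameCycle {n : ℕ} (i j : Fin n) : (finRotate n).SameCycle i j := by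
  cases n with
  | zero => exact i.elim0
  | succ n =>
    have h : ∀ k, (finRotate (n + 1)).SameCycle 0 k := fun k =>
      ⟨((k : ℕ) : ℤ), by simpa using finRotate_pow_zero k⟩
    exact (h i).symm.trans (h j)

theorem cycleLen_finRotate {n : ℕ} (i : Fin n) : cycleLen (finRotate n) i = n := by
  simp [cycleLen_eq_card, finRotate_sameCycle]

theorem finRotate_mem_discNC (n : ℕ) : finRotate n ∈ discNC n := by
  rw [discNC, Finset.mem_filter, inv_mul_cancel]
  simp [permLength, cycleMins_one]

/-- A non-crossing partition other than the one with a single block has only blocks with fewer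
than `n` elements. -/
theorem cycleLen_lt {n : ℕ} {π : Equiv.Perm (Fin n)} (hπ : π ∈ discNC n)
    (hne : π ≠ finRotate n) (i : Fin n) : cycleLen π i < n := by
  refine lt_of_le_of_ne (cycleLen_le π i) fun h => hne ?_
  have : NeZero n := ⟨by have := i.2; omega⟩
  have h1 := cycleMins_of_sameCycle fun a b =>
    (sameCycle_of_cycleLen h a).symm.trans (sameCycle_of_cycleLen h b)
  have h2 := cycleMins_of_sameCycle (finRotate_sameCycle (n := n))
  simp only [discNC, permLength, h1, h2, Finset.mem_filter, Finset.mem_univ, true_and,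
    Finset.card_singleton] at hπ
  have h3 : (cycleMins (π⁻¹ * finRotate n)) = Finset.univ := by
    refine Finset.eq_univ_of_card _ (le_antisymm (Finset.card_le_univ _) ?_)
    rw [Fintype.card_fin]
    omega
  have h4 : π⁻¹ * finRotate n = 1 := by
    by_contra hcon
    obtain ⟨x, hx⟩ : ∃ x, (π⁻¹ * finRotate n) x ≠ x := by
      by_contra! hall
      exact hcon (Equiv.ext hall)
    have hm : ∀ y ∈ cycleMins (π⁻¹ * finRotate n), ∀ j,
        (π⁻¹ * finRotate n).SameCycle y j → y ≤ j := fun y hy => by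
      simpa [cycleMins] using hy
    have hs : (π⁻¹ * finRotate n).SameCycle x ((π⁻¹ * finRotate n) x) := ⟨1, by simp⟩
    exact hx (le_antisymm (hm _ (h3 ▸ Finset.mem_univ _) _ hs.symm)
      (hm x (h3 ▸ Finset.mem_univ _) _ hs))
  exact (inv_mul_eq_one.mp h4)

theorem cycleWord_finRotate {A : Type*} {n : ℕ} (a : Fin (n + 1) → A) :
    (⟨cycleLen (finRotate (n + 1)) 0, cycleWord (finRotate (n + 1)) a 0⟩ :
      Σ k, Fin k → A) = ⟨n + 1, a⟩ := by
  refine Fin.sigma_eq_of_eq_comp_cast (cycleLen_finRotate 0) ?_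
  funext k
  exact congrArg a (Fin.ext (by
    simpa using congrArg Fin.val (finRotate_pow_zero (Fin.cast (cycleLen_finRotate 0) k))))

variable {A : Type*} [Ring A] [StarRing A] [Algebra ℂ A] [StarModule ℂ A]

theorem cumulantPerm_finRotate (S : SecondOrderSpace A) {n : ℕ} (a : Fin (n + 1) → A) :
    cumulantPerm S (finRotate (n + 1)) a = cumulant S (n + 1) a := by
  rw [cumulantPerm, cycleMins_of_sameCycle finRotate_sameCycle, Finset.prod_singleton]
  exact congrArg (fun x : Σ k, Fin k → A => cumulant S x.1 x.2) (cycleWord_finRotate a)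

/-- The moment-cumulant formula of first order. -/
theorem moment_eq_sum_cumulant (S : SecondOrderSpace A) (n : ℕ) (a : Fin n → A) :
    S.φ (List.ofFn a).prod = ∑ π ∈ discNC n, cumulantPerm S π a := by
  cases n with
  | zero =>
    have h : discNC 0 = {1} := by decide
    simp [h, S.φ_one, cumulantPerm, cycleMins]
  | succ n =>
    rw [← Finset.add_sum_erase _ _ (finRotate_mem_discNC (n + 1)), cumulantPerm_finRotate,
      cumulant]
    rw [sub_add_eq_add_sub, eq_sub_iff_add_eq, add_right_inj]
    refine Finset.sum_congr rfl fun π hπ => Finset.prod_congr rfl fun i _ => ?_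
    rw [Finset.mem_erase] at hπ
    rw [dif_pos (cycleLen_lt hπ.2 hπ.1 i)]

/-- The moment-cumulant formula of second order. -/
theorem fluctuation_eq_sum_cumulant₂ (S : SecondOrderSpace A) {m n : ℕ} (hm : 0 < m) (hn : 0 < n)
    (a : Fin m → A) (b : Fin n → A) :
    S.φ₂ (List.ofFn a).prod (List.ofFn b).prod =
      ∑ π ∈ annularNC m n, cumulantPerm S π (Fin.append a b) +
        ∑ x ∈ markedNC m n, cumulantMarked S a b x := by
  obtain ⟨m, rfl⟩ := Nat.exists_eq_succ_of_ne_zero hm.ne'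
  obtain ⟨n, rfl⟩ := Nat.exists_eq_succ_of_ne_zero hn.ne'
  have h1 : (markedNC (m + 1) (n + 1)).filter
      (fun x => x.1 = finRotate (m + 1) ∧ x.2.1 = finRotate (n + 1)) =
      {(finRotate (m + 1), finRotate (n + 1), 0, 0)} := by
    ext ⟨π₁, π₂, i, j⟩
    simp only [markedNC, Finset.mem_filter, Finset.mem_univ, true_and, Finset.mem_singleton,
      Prod.mk.injEq]
    constructor
    · rintro ⟨⟨-, -, hi, hj⟩, rfl, rfl⟩
      rw [cycleMins_of_sameCycle finRotate_sameCycle, Finset.mem_singleton] at hi hj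
      exact ⟨rfl, rfl, hi, hj⟩
    · rintro ⟨rfl, rfl, rfl, rfl⟩
      simp [finRotate_mem_discNC, cycleMins_of_sameCycle finRotate_sameCycle]
  have h2 : cumulantMarked S a b (finRotate (m + 1), finRotate (n + 1), 0, 0) =
      cumulant₂ S (m + 1) (n + 1) a b := by
    simp only [cumulantMarked, unmarkedCumulant, cycleMins_of_sameCycle finRotate_sameCycle,
      Finset.erase_singleton, Finset.prod_empty, mul_one]
    exact congrArg₂ (fun (x y : Σ k, Fin k → A) => cumulant₂ S x.1 y.1 x.2 y.2)
      (cycleWord_finRotate a) (cycleWord_finRotate b)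
  rw [← Finset.sum_filter_add_sum_filter_not (markedNC (m + 1) (n + 1))
    (fun x => x.1 = finRotate (m + 1) ∧ x.2.1 = finRotate (n + 1)), h1, Finset.sum_singleton, h2,
    cumulant₂]
  have h3 : ∀ x ∈ (markedNC (m + 1) (n + 1)).filter
      (fun x => ¬ (x.1 = finRotate (m + 1) ∧ x.2.1 = finRotate (n + 1))),
      cycleLen x.1 x.2.2.1 + cycleLen x.2.1 x.2.2.2 < m + 1 + (n + 1) := by
    rintro ⟨π₁, π₂, i, j⟩ hx
    simp only [markedNC, Finset.mem_filter, Finset.mem_univ, true_and] at hx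
    obtain ⟨⟨h₁, h₂, -, -⟩, hne⟩ := hx
    have l1 := cycleLen_le π₁ i
    have l2 := cycleLen_le π₂ j
    by_cases h : π₁ = finRotate (m + 1)
    · have := cycleLen_lt h₂ (fun h' => hne ⟨h, h'⟩) j
      simp only
      omega
    · have := cycleLen_lt h₁ h i
      simp only
      omega
  rw [Finset.sum_congr rfl fun x hx => dif_pos (h3 x hx)]
  simp only [cumulantMarked]
  ring

end MomentCumulant

/-! ### Second order freeness, R-diagonality, Haar unitaries, `*`-distributions -/

section Notions

variable {A : Type*} [Ring A] [StarRing A] [Algebra ℂ A] [StarModule ℂ A]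

/-- Subalgebras are second order free if all mixed cumulants of first and of second order
vanish. -/
def SecondOrderFree (S : SecondOrderSpace A) {ι : Type*} (B : ι → Subalgebra ℂ A) : Prop :=
  (∀ (n : ℕ) (j : Fin n → ι) (a : Fin n → A), (∀ i, a i ∈ B (j i)) →
    (∃ i₁ i₂, j i₁ ≠ j i₂) → cumulant S n a = 0) ∧
  (∀ (m n : ℕ), 0 < m → 0 < n → ∀ (j : Fin m ⊕ Fin n → ι) (a : Fin m → A) (b : Fin n → A),
    (∀ i, a i ∈ B (j (Sum.inl i))) → (∀ i, b i ∈ B (j (Sum.inr i))) →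
    (∃ i₁ i₂, j i₁ ≠ j i₂) → cumulant₂ S m n a b = 0)

/-- Two elements are second order `*`-free if the unital `*`-subalgebras they generate are second
order free. -/
def SecondOrderStarFree (S : SecondOrderSpace A) (a b : A) : Prop :=
  SecondOrderFree S
    ![(StarAlgebra.adjoin ℂ {a}).toSubalgebra, (StarAlgebra.adjoin ℂ {b}).toSubalgebra]

/-- `a^(ε)`: this is `a` for `ε = true` and `a*` for `ε = false`. -/
def starPow (a : A) (ε : Bool) : A := if ε then a else star a

/-- Consecutive signs differ. -/
def Alternating {n : ℕ} (ε : Fin n → Bool) : Prop :=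
  ∀ i j : Fin n, (i : ℕ) + 1 = j → ε i ≠ ε j

/-- The `*`-word `a, a*, a, a*, …` of length `n`. -/
def altWord (a : A) (n : ℕ) : Fin n → A := fun i => starPow a (decide (Even (i : ℕ)))

/-- `a` is R-diagonal: all `*`-cumulants of `a` vanish except possibly
`κ_{2l}(a, a*, …, a, a*)` and `κ_{2l}(a*, a, …, a*, a)`. -/
def IsRDiagonal (S : SecondOrderSpace A) (a : A) : Prop :=
  ∀ (n : ℕ), 0 < n → ∀ ε : Fin n → Bool, ¬ (Even n ∧ Alternating ε) →
    cumulant S n (fun i => starPow a (ε i)) = 0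

/-- `a` is second order R-diagonal: it is R-diagonal, and all second order `*`-cumulants vanish
except possibly the `κ_{2p,2q}` whose entries alternate between `a` and `a*` on each of the two
circles; moreover
`κ_{2p,2q}(a, a*, …, a, a* ; a, a*, …, a, a*) = κ_{2p,2q}(a*, a, …, a*, a ; a*, a, …, a*, a)`. -/
def IsSecondOrderRDiagonal (S : SecondOrderSpace A) (a : A) : Prop :=
  IsRDiagonal S a ∧
  (∀ (m n : ℕ), 0 < m → 0 < n → ∀ (ε : Fin m → Bool) (δ : Fin n → Bool),
    ¬ (Even m ∧ Even n ∧ Alternating ε ∧ Alternating δ) →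
      cumulant₂ S m n (fun i => starPow a (ε i)) (fun i => starPow a (δ i)) = 0) ∧
  (∀ (p q : ℕ), 0 < p → 0 < q →
    cumulant₂ S (2 * p) (2 * q) (altWord a _) (altWord a _) =
      cumulant₂ S (2 * p) (2 * q) (altWord (star a) _) (altWord (star a) _))

/-- `u` is a second order Haar unitary: it is unitary, `φ(u^k) = φ(u*^k) = 0` for `k ≥ 1`, and
`φ₂(u^k, u*^l) = k δ_{k,l}` for `k, l ≥ 1`. -/
def IsSecondOrderHaarUnitary (S : SecondOrderSpace A) (u : A) : Prop :=
  u ∈ unitary A ∧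
  (∀ k : ℕ, 1 ≤ k → S.φ (u ^ k) = 0 ∧ S.φ (star u ^ k) = 0) ∧
  (∀ k l : ℕ, 1 ≤ k → 1 ≤ l → S.φ₂ (u ^ k) (star u ^ l) = if k = l then (k : ℂ) else 0)

/-- The `*`-monomial `a^(ε₁) ⋯ a^(ε_n)`. -/
def starMonomial (a : A) (w : List Bool) : A := (w.map (starPow a)).prod

/-- `a` and `b` have the same second order `*`-distribution: all their `*`-moments and all their
fluctuation `*`-moments agree. -/
def SameSecondOrderStarDistribution (S : SecondOrderSpace A) (a b : A) : Prop :=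
  (∀ w : List Bool, S.φ (starMonomial a w) = S.φ (starMonomial b w)) ∧
  (∀ w w' : List Bool, S.φ₂ (starMonomial a w) (starMonomial a w') =
    S.φ₂ (starMonomial b w) (starMonomial b w'))

end Notions

end SecondOrder

/-! A cyclic `*`-word in `u r` with signs `ε` is, up to conjugation by a unitary, a word `r^(ε x) v
x r^(ε (γ x)) v (γ x) ⋯`. By unitarity the separating letter `v x` (`between`) is `u` or `u*` if the
consecutive signs `ε x`, `ε (γ x)` agree, and `1` if they differ. Since `r` and `u` are free, its
moment is the sum over non-crossing `π` of the cumulants of `r` along `π` times the moments of `v`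
along the Kreweras complement `π⁻¹ γ` (`cprod_moment_dbl`). The fluctuation moment is a sum of three
such expansions (`pairTerm_moment_dbl`): annular `π` with moments of `v`; non-crossing `π` with two
marked cycles and moments of `v`; non-crossing `π` with a fluctuation moment of `v` along two cycles
of the complement.

The decisive remark is `pathProd_between`: if `ε` changes at every step of `π`, then `π` maps `(π⁻¹
γ) z` to `γ z`, so `ε (γ z)` is the opposite of `ε ((π⁻¹ γ) z)`, and the word `v` telescopes to `1`
along every cycle of the complement. Such a `π` therefore has weight `1`, and its terms with a
fluctuation moment of `v` vanish because `φ₂(1, ·) = 0`. If `r` is R-diagonal of second order, every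
other `π` has a vanishing cumulant, so the expansions for `u r` reduce to the moment-cumulant
formulas for `r`.

Conversely, let the distributions agree and argue by induction on the length of the words. Terms
with shorter cycles agree on both sides. In the top term `π = γ` the complement is the identity, and
its weight contains a factor `φ(u)` or `φ(u*)`, both zero, as soon as two cyclically adjacent signs
agree (`complementMoment_self_eq_zero`). Hence the top cumulant vanishes. The symmetry between the
words `a, a*, …` and `a*, a, …` follows from invariance of the cumulants under separate rotation of
each circle, which they inherit from traciality.

The combinatorial input is the genus inequality `ncyc_add_le`, obtained from ranks of operators on
functions. The alternating word is encoded by `dbl 1 γ` on two copies of the index set. Vanishing of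
mixed cumulants leaves only permutations `π ⊕ σ`, and the defects in the inequality for `π ⊕ σ` are
those of `π` in `γ` and of `σ` in `π⁻¹ γ` added together (`isNC_dbl`, `ind_isAnn_dbl`). Permutations
of arbitrary finite types are used because complements and sub-permutations have no preferred
numbering. -/

namespace SecondOrder

open Equiv (Perm)

/-! ### Cycles of a permutation -/

section Cycles

variable {X Y : Type}

/-- The cycles of a permutation, fixed points included. -/
def Cyc (π : Perm X) : Type := Quotient (Perm.SameCycle.setoid π)

/-- The cycle of `π` through `x`. -/
def Cyc.mk (π : Perm X) (x : X) : Cyc π := Quotient.mk (Perm.SameCycle.setoid π) x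

/-- An element of a cycle. -/
noncomputable def Cyc.rep {π : Perm X} (c : Cyc π) : X := Quotient.out c

theorem Cyc.mk_rep {π : Perm X} (c : Cyc π) : Cyc.mk π c.rep = c := Quotient.out_eq c

theorem Cyc.mk_eq_mk {π : Perm X} {x y : X} : Cyc.mk π x = Cyc.mk π y ↔ π.SameCycle x y :=
  Quotient.eq (r := Perm.SameCycle.setoid π)

theorem Cyc.rep_sameCycle (π : Perm X) (x : X) : π.SameCycle (Cyc.mk π x).rep x :=
  Cyc.mk_eq_mk.mp (Cyc.mk_rep _)

theorem Cyc.mk_surjective (π : Perm X) : Function.Surjective (Cyc.mk π) :=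
  fun c => ⟨c.rep, c.mk_rep⟩

instance [Finite X] (π : Perm X) : Finite (Cyc π) := Quotient.finite _

noncomputable instance [Finite X] (π : Perm X) : Fintype (Cyc π) := Fintype.ofFinite _

/-- The number of cycles. -/
noncomputable def ncyc (π : Perm X) : ℕ := Nat.card (Cyc π)

/-- A function that is constant on the cycles of `π`. -/
def Invar {β : Type*} (π : Perm X) (f : X → β) : Prop := ∀ x, f (π x) = f x

theorem Invar.inv {β : Type*} {π : Perm X} {f : X → β} (hf : Invar π f) : Invar π⁻¹ f := by
  intro x
  have := hf (π⁻¹ x)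
  rw [show π (π⁻¹ x) = x from π.apply_symm_apply x] at this
  exact this.symm

theorem Invar.mul {β : Type*} {π σ : Perm X} {f : X → β} (hf : Invar π f) (hg : Invar σ f) :
    Invar (π * σ) f := fun x => by rw [Perm.mul_apply, hf, hg]

/-- The standard tool for separating points below: two points lie in different cycles as soon as
some invariant function, often `Prop`-valued, distinguishes them. -/
theorem Invar.sameCycle {β : Type*} {π : Perm X} {f : X → β} (hf : Invar π f) {x y : X}
    (h : π.SameCycle x y) : f x = f y := by
  obtain ⟨k, rfl⟩ := h
  have h1 : ∀ (n : ℕ) (z : X), f ((π ^ n) z) = f z := by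
    intro n
    induction n with
    | zero => intro z; rfl
    | succ n ih => intro z; rw [pow_succ, Perm.mul_apply, ih, hf]
  cases k with
  | ofNat n => exact (h1 n x).symm
  | negSucc n =>
    rw [zpow_negSucc, ← h1 (n + 1) ((π ^ (n + 1))⁻¹ x)]
    exact congrArg f ((π ^ (n + 1)).apply_symm_apply x).symm

theorem invar_sameCycle (π : Perm X) (x : X) : Invar π (fun z => π.SameCycle x z) := fun z => by
  simp

theorem Invar.rep {β : Type*} {π : Perm X} {f : X → β} (hf : Invar π f) (x : X) :
    f (Cyc.mk π x).rep = f x := hf.sameCycle (Cyc.rep_sameCycle π x)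

/-- Invariant functions are functions of the cycle. -/
noncomputable def invarEquiv {β : Type*} (π : Perm X) :
    {f : X → β // Invar π f} ≃ (Cyc π → β) where
  toFun f := fun c => f.1 c.rep
  invFun g := ⟨fun x => g (Cyc.mk π x), fun x => by
    show g (Cyc.mk π (π x)) = g (Cyc.mk π x)
    rw [Cyc.mk_eq_mk.mpr (Perm.sameCycle_apply_left.mpr (Perm.SameCycle.refl π x))]⟩
  left_inv f := Subtype.ext (funext fun x => f.2.rep x)
  right_inv g := funext fun c => by simp [Cyc.mk_rep]

end Cycles

/-! ### The genus inequality -/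

section Genus

variable {X : Type}

/-- The space of functions that are invariant under `π`. -/
def fixSpace (π : Perm X) : Submodule ℚ (X → ℚ) :=
  LinearMap.ker (LinearMap.funLeft ℚ ℚ π - LinearMap.id)

theorem mem_fixSpace {π : Perm X} {f : X → ℚ} : f ∈ fixSpace π ↔ Invar π f := by
  simp only [fixSpace, LinearMap.mem_ker, LinearMap.sub_apply, LinearMap.id_apply, sub_eq_zero,
    funext_iff, LinearMap.funLeft_apply, Invar]

variable [Finite X]

/-- Turns the counting of cycles into linear algebra: an invariant function is a free choice of one
value per cycle. -/
theorem finrank_fixSpace (π : Perm X) : Module.finrank ℚ (fixSpace π) = ncyc π := by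
  have e : fixSpace π ≃ₗ[ℚ] (Cyc π → ℚ) :=
    { toFun := fun f => fun c => f.1 c.rep
      map_add' := fun f g => rfl
      map_smul' := fun c f => rfl
      invFun := fun g => ⟨_, mem_fixSpace.mpr ((invarEquiv π).symm g).2⟩
      left_inv := fun f => by
        have := (invarEquiv π).symm_apply_apply ⟨f.1, mem_fixSpace.mp f.2⟩
        exact Subtype.ext (congrArg (fun g => g.1) this)
      right_inv := fun g => (invarEquiv π).apply_symm_apply g }
  rw [e.finrank_eq, Module.finrank_pi, ncyc, Nat.card_eq_fintype_card]

/-- Rank-nullity; the length `|π|` becomes the rank of `f ↦ f ∘ π - f`. -/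
theorem finrank_range_funLeft_sub (π : Perm X) :
    Module.finrank ℚ (LinearMap.range (LinearMap.funLeft ℚ ℚ π - LinearMap.id)) + ncyc π =
      Nat.card X := by
  have := Fintype.ofFinite X
  rw [← finrank_fixSpace, fixSpace, LinearMap.finrank_range_add_finrank_ker, Module.finrank_pi,
    Nat.card_eq_fintype_card]

/-- A functional that annihilates both ranges takes equal values on the delta functions at `x` and
`π x`, and at `x` and `γ x`. Its values on delta functions thus form a common invariant function,
which bounds the codimension of the sum of the ranges. -/
theorem card_le_finrank_range_sup (π γ : Perm X) :
    Nat.card X ≤ Module.finrank ℚ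
      (LinearMap.range (LinearMap.funLeft ℚ ℚ π - LinearMap.id) ⊔
        LinearMap.range (LinearMap.funLeft ℚ ℚ γ - LinearMap.id) : Submodule ℚ (X → ℚ)) +
      Module.finrank ℚ (fixSpace π ⊓ fixSpace γ : Submodule ℚ (X → ℚ)) := by
  classical
  have := Fintype.ofFinite X
  set W : Submodule ℚ (X → ℚ) := LinearMap.range (LinearMap.funLeft ℚ ℚ π - LinearMap.id) ⊔
        LinearMap.range (LinearMap.funLeft ℚ ℚ γ - LinearMap.id) with hW
  have h1 := Subspace.finrank_add_finrank_dualAnnihilator_eq W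
  rw [Module.finrank_pi, ← Nat.card_eq_fintype_card] at h1
  have hsingle : ∀ (ρ : Perm X) (x : X), Pi.single (M := fun _ => ℚ) x 1 -
      Pi.single (M := fun _ => ℚ) (ρ x) 1 ∈
        LinearMap.range (LinearMap.funLeft ℚ ℚ ρ - LinearMap.id) := by
    intro ρ x
    refine ⟨Pi.single (ρ x) 1, ?_⟩
    ext y
    simp [LinearMap.funLeft_apply, Pi.single_apply]
  let T : Module.Dual ℚ (X → ℚ) →ₗ[ℚ] (X → ℚ) :=
    LinearMap.pi fun x => Module.Dual.eval ℚ (X → ℚ) (Pi.single x 1)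
  have hT : ∀ φ x, T φ x = φ (Pi.single x 1) := fun φ x => rfl
  have hinj : Function.Injective T := by
    intro φ ψ h
    refine LinearMap.pi_ext' fun x => LinearMap.ext_ring ?_
    exact congrFun h x
  have hmap : W.dualAnnihilator.map T ≤ fixSpace π ⊓ fixSpace γ := by
    rintro _ ⟨φ, hφ, rfl⟩
    rw [SetLike.mem_coe, Submodule.mem_dualAnnihilator] at hφ
    refine ⟨mem_fixSpace.mpr fun x => ?_, mem_fixSpace.mpr fun x => ?_⟩
    · have := hφ _ (Submodule.mem_sup_left (hsingle π x))
      rw [map_sub, sub_eq_zero] at this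
      rw [hT, hT, this]
    · have := hφ _ (Submodule.mem_sup_right (hsingle γ x))
      rw [map_sub, sub_eq_zero] at this
      rw [hT, hT, this]
  have h2 := Submodule.finrank_mono hmap
  rw [← (Submodule.equivMapOfInjective T hinj _).finrank_eq] at h2
  omega

/-- The genus inequality for the permutations `π`, `κ` and `π κ`. -/
theorem ncyc_add_le (π κ : Perm X) :
    ncyc π + ncyc κ + ncyc (π * κ) ≤
      Nat.card X + 2 * Module.finrank ℚ (fixSpace π ⊓ fixSpace (π * κ) : Submodule ℚ (X → ℚ)) := by
  set A := LinearMap.funLeft ℚ ℚ π - LinearMap.id with hA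
  set B := LinearMap.funLeft ℚ ℚ (π * κ) - LinearMap.id with hB
  set C := LinearMap.funLeft ℚ ℚ κ - LinearMap.id with hC
  -- With `T_π f = f ∘ π` this is the cocycle identity `T_{πκ} - 1 = (T_κ - 1) T_π + (T_π - 1)`. As
  -- `T_π` is invertible, `C` may be exchanged for `A` in the sum of ranges with `B`.
  have hcomp : ∀ f, C (LinearMap.funLeft ℚ ℚ π f) = B f - A f := by
    intro f
    ext x
    simp [hA, hB, hC, LinearMap.funLeft_apply]
  have hsup : LinearMap.range C ⊔ LinearMap.range B = LinearMap.range A ⊔ LinearMap.range B := by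
    apply le_antisymm
    · refine sup_le ?_ le_sup_right
      rintro _ ⟨f, rfl⟩
      have hf : f = LinearMap.funLeft ℚ ℚ π (f ∘ π.symm) := by
        ext x; simp [LinearMap.funLeft_apply]
      rw [hf, hcomp]
      exact sub_mem (Submodule.mem_sup_right ⟨_, rfl⟩) (Submodule.mem_sup_left ⟨_, rfl⟩)
    · refine sup_le ?_ le_sup_right
      rintro _ ⟨f, rfl⟩
      have : A f = B f - C (LinearMap.funLeft ℚ ℚ π f) := by rw [hcomp]; abel
      rw [this]
      exact sub_mem (Submodule.mem_sup_right ⟨_, rfl⟩) (Submodule.mem_sup_left ⟨_, rfl⟩)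
  have hCB : ∀ f ∈ fixSpace π, C f = B f := by
    intro f hf
    have h0 : A f = 0 := hf
    have h1 : LinearMap.funLeft ℚ ℚ π f = f := by
      rw [hA, LinearMap.sub_apply, sub_eq_zero] at h0
      exact h0
    have := hcomp f
    rwa [h0, h1, sub_zero] at this
  have hinf : (fixSpace π).map C ≤ LinearMap.range C ⊓ LinearMap.range B := by
    rintro _ ⟨f, hf, rfl⟩
    exact ⟨⟨f, rfl⟩, ⟨f, (hCB f hf).symm⟩⟩
  -- Rank-nullity for `C` on the invariants of `π`: there `C` agrees with `B`, so its kernel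
  -- consists of the common invariants.
  have hrank : Module.finrank ℚ ((fixSpace π).map C) +
      Module.finrank ℚ (fixSpace π ⊓ fixSpace (π * κ) : Submodule ℚ (X → ℚ)) = ncyc π := by
    have h := LinearMap.finrank_range_add_finrank_ker (C.domRestrict (fixSpace π))
    rw [LinearMap.range_domRestrict, finrank_fixSpace] at h
    rw [← h]
    congr 1
    have hker : (LinearMap.ker (C.domRestrict (fixSpace π))).map (fixSpace π).subtype =
        fixSpace π ⊓ fixSpace (π * κ) := by
      ext f
      constructor
      · rintro ⟨⟨g, hg⟩, hgk, rfl⟩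
        refine ⟨hg, ?_⟩
        have hgk' : C g = 0 := hgk
        rw [hCB g hg] at hgk'
        exact hgk'
      · rintro ⟨hf1, hf2⟩
        refine ⟨⟨f, hf1⟩, ?_, rfl⟩
        have : C f = 0 := by rw [hCB f hf1]; exact hf2
        exact this
    rw [← hker]
    exact (Submodule.equivMapOfInjective _ (Submodule.subtype_injective (fixSpace π))
      (LinearMap.ker (C.domRestrict (fixSpace π)))).finrank_eq.symm
  -- Let `j` be the dimension of the common invariants. The sum of the ranges of `C` and `B` has
  -- dimension at least `Nat.card X - j` and their intersection at least `ncyc π - j`, while their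
  -- ranks are `Nat.card X - ncyc κ` and `Nat.card X - ncyc (π * κ)`.
  have h1 := Submodule.finrank_sup_add_finrank_inf_eq (LinearMap.range C) (LinearMap.range B)
  rw [hsup] at h1
  have h2 := Submodule.finrank_mono hinf
  have h3 := card_le_finrank_range_sup π (π * κ)
  have h4 := finrank_range_funLeft_sub κ
  have h5 := finrank_range_funLeft_sub (π * κ)
  rw [← hA, ← hB] at h3
  rw [← hC] at h4
  rw [← hB] at h5
  omega

theorem ncyc_add_ncyc_inv_mul_le (σ γ : Perm X) :
    ncyc σ + ncyc (σ⁻¹ * γ) + ncyc γ ≤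
      Nat.card X + 2 * Module.finrank ℚ (fixSpace σ ⊓ fixSpace γ : Submodule ℚ (X → ℚ)) := by
  have := ncyc_add_le σ (σ⁻¹ * γ)
  rwa [mul_inv_cancel_left] at this

theorem finrank_fixSpace_inf_le (σ γ : Perm X) :
    Module.finrank ℚ (fixSpace σ ⊓ fixSpace γ : Submodule ℚ (X → ℚ)) ≤ ncyc γ := by
  rw [← finrank_fixSpace]
  exact Submodule.finrank_mono inf_le_right

/-- The triangle inequality `|γ| ≤ |σ| + |σ⁻¹ γ|`, since the common invariants have dimension at
most `ncyc γ`. -/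
theorem ncyc_add_le_card (σ γ : Perm X) :
    ncyc σ + ncyc (σ⁻¹ * γ) ≤ Nat.card X + ncyc γ := by
  have h1 := ncyc_add_ncyc_inv_mul_le σ γ
  have h2 := finrank_fixSpace_inf_le σ γ
  omega

/-- `σ` is non-crossing in the cycles of `γ`. -/
def IsNC (γ σ : Perm X) : Prop := ncyc σ + ncyc (σ⁻¹ * γ) = Nat.card X + ncyc γ

/-- The points `x` and `y` are in the same orbit of the group generated by `σ` and `γ`. -/
def Joined (σ γ : Perm X) (x y : X) : Prop :=
  ∀ f : X → ℚ, Invar σ f → Invar γ f → f x = f y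

/-- `σ` is an annular non-crossing permutation between the cycles of `γ` through `x` and `y` and
non-crossing in the other cycles of `γ`. -/
def IsAnn (γ σ : Perm X) (x y : X) : Prop :=
  ncyc σ + ncyc (σ⁻¹ * γ) + 2 = Nat.card X + ncyc γ ∧ Joined σ γ x y

/-- Equality in the triangle inequality leaves no room: the common invariants must fill the whole
space of `γ`-invariants. -/
theorem IsNC.invar_rat {γ σ : Perm X} (h : IsNC γ σ) {f : X → ℚ} (hf : Invar γ f) :
    Invar σ f := by
  have h1 := ncyc_add_ncyc_inv_mul_le σ γ
  have h2 := finrank_fixSpace_inf_le σ γ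
  have h3 : (fixSpace σ ⊓ fixSpace γ : Submodule ℚ (X → ℚ)) = fixSpace γ := by
    refine Submodule.eq_of_le_of_finrank_eq inf_le_right ?_
    rw [finrank_fixSpace]
    unfold IsNC at h
    omega
  have h4 : f ∈ fixSpace γ := mem_fixSpace.mpr hf
  rw [← h3] at h4
  exact mem_fixSpace.mp h4.1

/-- Arbitrary values reduce to rational ones through the indicators of level sets. -/
theorem IsNC.invar {γ σ : Perm X} (h : IsNC γ σ) {β : Type*} {f : X → β} (hf : Invar γ f) :
    Invar σ f := by
  classical
  intro x
  have h1 : Invar γ (fun z => if f z = f x then (1 : ℚ) else 0) := fun z => by simp only [hf z]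
  have h2 := h.invar_rat h1 x
  by_contra hne
  simp [hne] at h2

/-- The invariant functions that agree at two given points of different cycles form a proper
subspace. -/
theorem finrank_inf_add_two_le {γ σ : Perm X} {x y : X} (hxy : ¬ γ.SameCycle x y)
    (h : Joined σ γ x y) :
    Module.finrank ℚ (fixSpace σ ⊓ fixSpace γ : Submodule ℚ (X → ℚ)) + 1 ≤ ncyc γ := by
  classical
  rw [← finrank_fixSpace]
  refine Submodule.finrank_lt_finrank_of_lt (lt_of_le_of_ne inf_le_right fun heq => hxy ?_)
  have h1 : (fun z => if γ.SameCycle x z then (1 : ℚ) else 0) ∈ fixSpace γ :=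
    mem_fixSpace.mpr fun z => by simp
  have h2 := h1
  rw [← heq] at h2
  have := h _ (mem_fixSpace.mp h2.1) (mem_fixSpace.mp h1)
  by_contra hne
  simp [hne, Perm.SameCycle.refl] at this

/-- Joining two cycles of `γ` costs one dimension of common invariants, and the genus inequality
counts this dimension twice. This is the origin of the `+ 2` in the definition of annular
permutations. -/
theorem ncyc_add_two_le_of_joined {γ σ : Perm X} {x y : X} (hxy : ¬ γ.SameCycle x y)
    (h : Joined σ γ x y) : ncyc σ + ncyc (σ⁻¹ * γ) + 2 ≤ Nat.card X + ncyc γ := by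
  have h1 := ncyc_add_ncyc_inv_mul_le σ γ
  have h2 := finrank_inf_add_two_le hxy h
  omega

/-- The common invariants lie in the hyperplane `W` of `γ`-invariants with equal values at `x` and
`y`. Equality in the annular bound forces them to fill it. -/
theorem IsAnn.invar_rat {γ σ : Perm X} {x y : X} (hxy : ¬ γ.SameCycle x y) (h : IsAnn γ σ x y)
    {f : X → ℚ} (hf : Invar γ f) (hfxy : f x = f y) : Invar σ f := by
  classical
  obtain ⟨h0, hj⟩ := h
  have h1 := ncyc_add_ncyc_inv_mul_le σ γ
  have h2 := finrank_inf_add_two_le hxy hj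
  let W : Submodule ℚ (X → ℚ) := fixSpace γ ⊓
    LinearMap.ker (LinearMap.proj (R := ℚ) (φ := fun _ : X => ℚ) x - LinearMap.proj y)
  have hle : fixSpace σ ⊓ fixSpace γ ≤ W := by
    rintro g ⟨hg1, hg2⟩
    refine ⟨hg2, LinearMap.mem_ker.mpr ?_⟩
    simpa [sub_eq_zero] using hj g (mem_fixSpace.mp hg1) (mem_fixSpace.mp hg2)
  have hlt : W < fixSpace γ := by
    refine lt_of_le_of_ne inf_le_left fun heq => hxy ?_
    have h1 : (fun z => if γ.SameCycle x z then (1 : ℚ) else 0) ∈ fixSpace γ :=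
      mem_fixSpace.mpr fun z => by simp
    rw [← heq] at h1
    have := LinearMap.mem_ker.mp h1.2
    by_contra hne
    simp [hne, Perm.SameCycle.refl] at this
  have h3 := Submodule.finrank_lt_finrank_of_lt hlt
  rw [finrank_fixSpace] at h3
  have h4 : (fixSpace σ ⊓ fixSpace γ : Submodule ℚ (X → ℚ)) = W := by
    refine Submodule.eq_of_le_of_finrank_le hle ?_
    omega
  have h5 : f ∈ W := by
    refine ⟨mem_fixSpace.mpr hf, LinearMap.mem_ker.mpr ?_⟩
    simp [hfxy]
  rw [← h4] at h5
  exact mem_fixSpace.mp h5.1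

theorem IsAnn.invar {γ σ : Perm X} {x y : X} (hxy : ¬ γ.SameCycle x y) (h : IsAnn γ σ x y)
    {β : Type*} {f : X → β} (hf : Invar γ f) (hfxy : f x = f y) : Invar σ f := by
  classical
  intro z
  have h1 : Invar γ (fun w => if f w = f z then (1 : ℚ) else 0) := fun w => by simp only [hf w]
  have h2 := h.invar_rat hxy h1 (by simp only [hfxy]) z
  by_contra hne
  simp [hne] at h2

end Genus

/-! ### Cycles of conjugates, direct sums and doublings -/

section CycleMaps

variable {X Y Z : Type}

theorem sameCycle_map {π : Perm X} {ρ : Perm Y} {e : X → Y} (he : ∀ x, e (π x) = ρ (e x))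
    {x y : X} (h : π.SameCycle x y) : ρ.SameCycle (e x) (e y) := by
  have h1 : Invar π (fun z => ρ.SameCycle (e x) (e z)) := fun z => by simp [he]
  exact (h1.sameCycle h).mp (Perm.SameCycle.refl _ _)

theorem semiconj_symm {π : Perm X} {ρ : Perm Y} {e : X ≃ Y} (he : ∀ x, e (π x) = ρ (e x))
    (y : Y) : e.symm (ρ y) = π (e.symm y) := by
  rw [Equiv.symm_apply_eq, he, Equiv.apply_symm_apply]

theorem Invar.comp_map {β : Type*} {π : Perm X} {ρ : Perm Y} {e : X → Y} {f : Y → β}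
    (hf : Invar ρ f) (he : ∀ x, e (π x) = ρ (e x)) : Invar π (fun x => f (e x)) := fun x => by
  show f (e (π x)) = f (e x)
  rw [he, hf]

theorem sameCycle_map_iff {π : Perm X} {ρ : Perm Y} {e : X ≃ Y} (he : ∀ x, e (π x) = ρ (e x))
    {x y : X} : ρ.SameCycle (e x) (e y) ↔ π.SameCycle x y := by
  refine ⟨fun h => ?_, sameCycle_map he⟩
  have := sameCycle_map (e := e.symm) (semiconj_symm he) h
  simpa using this

/-- The cycles of conjugate permutations correspond to each other. -/
noncomputable def cycEquiv (e : X ≃ Y) {π : Perm X} {ρ : Perm Y}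
    (he : ∀ x, e (π x) = ρ (e x)) : Cyc π ≃ Cyc ρ :=
  Equiv.ofBijective (fun c => Cyc.mk ρ (e c.rep)) <| by
    constructor
    · intro c d h
      rw [Cyc.mk_eq_mk, sameCycle_map_iff he, ← Cyc.mk_eq_mk, Cyc.mk_rep, Cyc.mk_rep] at h
      exact h
    · intro d
      refine ⟨Cyc.mk π (e.symm d.rep), ?_⟩
      rw [← d.mk_rep, Cyc.mk_eq_mk]
      have := sameCycle_map he (Cyc.rep_sameCycle π (e.symm d.rep))
      rw [Equiv.apply_symm_apply] at this
      rw [Cyc.mk_rep]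
      exact this

theorem ncyc_map (e : X ≃ Y) {π : Perm X} {ρ : Perm Y} (he : ∀ x, e (π x) = ρ (e x)) :
    ncyc ρ = ncyc π := (Nat.card_congr (cycEquiv e he)).symm

theorem sameCycle_sumCongr_inl {σ : Perm Y} {τ : Perm Z} {x y : Y} :
    (Perm.sumCongr σ τ).SameCycle (Sum.inl x) (Sum.inl y) ↔ σ.SameCycle x y := by
  refine ⟨fun h => ?_, sameCycle_map (e := Sum.inl) fun x => rfl⟩
  have h1 : Invar (Perm.sumCongr σ τ)
      (Sum.elim (fun z => σ.SameCycle x z) fun _ => False) := by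
    rintro (z | z) <;> simp
  exact (h1.sameCycle h).mp (Perm.SameCycle.refl _ _)

theorem sameCycle_sumCongr_inr {σ : Perm Y} {τ : Perm Z} {x y : Z} :
    (Perm.sumCongr σ τ).SameCycle (Sum.inr x) (Sum.inr y) ↔ τ.SameCycle x y := by
  refine ⟨fun h => ?_, sameCycle_map (e := Sum.inr) fun x => rfl⟩
  have h1 : Invar (Perm.sumCongr σ τ)
      (Sum.elim (fun _ => False) fun z => τ.SameCycle x z) := by
    rintro (z | z) <;> simp
  exact (h1.sameCycle h).mp (Perm.SameCycle.refl _ _)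

theorem not_sameCycle_sumCongr {σ : Perm Y} {τ : Perm Z} {x : Y} {y : Z} :
    ¬ (Perm.sumCongr σ τ).SameCycle (Sum.inl x) (Sum.inr y) := by
  intro h
  have h1 : Invar (Perm.sumCongr σ τ) (Sum.elim (fun _ => True) fun _ => False) := by
    rintro (z | z) <;> simp
  exact (h1.sameCycle h).mp trivial

theorem not_sameCycle_sumCongr' {σ : Perm Y} {τ : Perm Z} {x : Y} {y : Z} :
    ¬ (Perm.sumCongr σ τ).SameCycle (Sum.inr y) (Sum.inl x) :=
  fun h => not_sameCycle_sumCongr h.symm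

/-- The cycles of a direct sum of permutations. -/
noncomputable def cycSum (σ : Perm Y) (τ : Perm Z) :
    Cyc σ ⊕ Cyc τ ≃ Cyc (Perm.sumCongr σ τ) :=
  Equiv.ofBijective (Sum.elim (fun c => Cyc.mk _ (Sum.inl c.rep)) fun c => Cyc.mk _ (Sum.inr c.rep))
    <| by
    constructor
    · rintro (c | c) (d | d) h
      · simp only [Sum.elim_inl] at h
        rw [Cyc.mk_eq_mk, sameCycle_sumCongr_inl, ← Cyc.mk_eq_mk, Cyc.mk_rep, Cyc.mk_rep] at h
        rw [h]
      · simp only [Sum.elim_inl, Sum.elim_inr] at h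
        rw [Cyc.mk_eq_mk] at h
        exact absurd h not_sameCycle_sumCongr
      · simp only [Sum.elim_inl, Sum.elim_inr] at h
        rw [Cyc.mk_eq_mk] at h
        exact absurd h not_sameCycle_sumCongr'
      · simp only [Sum.elim_inr] at h
        rw [Cyc.mk_eq_mk, sameCycle_sumCongr_inr, ← Cyc.mk_eq_mk, Cyc.mk_rep, Cyc.mk_rep] at h
        rw [h]
    · intro d
      obtain ⟨x | x, rfl⟩ := Cyc.mk_surjective _ d
      · exact ⟨Sum.inl (Cyc.mk σ x),
          Cyc.mk_eq_mk.mpr (sameCycle_sumCongr_inl.mpr (Cyc.rep_sameCycle σ x))⟩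
      · exact ⟨Sum.inr (Cyc.mk τ x),
          Cyc.mk_eq_mk.mpr (sameCycle_sumCongr_inr.mpr (Cyc.rep_sameCycle τ x))⟩

theorem ncyc_sumCongr [Finite Y] [Finite Z] (σ : Perm Y) (τ : Perm Z) :
    ncyc (Perm.sumCongr σ τ) = ncyc σ + ncyc τ := by
  rw [ncyc, ← Nat.card_congr (cycSum σ τ), Nat.card_sum]
  rfl

/-- The permutation of two copies of `X` that maps the first copy to the second one by `α` and
the second copy to the first one by `β`. -/
def dbl (α β : Perm X) : Perm (X ⊕ X) := (Equiv.sumCongr α β).trans (Equiv.sumComm X X)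

@[simp] theorem dbl_inl (α β : Perm X) (x : X) : dbl α β (Sum.inl x) = Sum.inr (α x) := rfl

@[simp] theorem dbl_inr (α β : Perm X) (x : X) : dbl α β (Sum.inr x) = Sum.inl (β x) := rfl

theorem sameCycle_dbl_inl {α β : Perm X} {x y : X} :
    (dbl α β).SameCycle (Sum.inl x) (Sum.inl y) ↔ (β * α).SameCycle x y := by
  constructor
  · intro h
    -- A point of the second copy is classified by its successor `β z` in the first copy.
    have h1 : Invar (dbl α β) (Sum.elim (fun z => (β * α).SameCycle x z)
        fun z => (β * α).SameCycle x (β z)) := by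
      rintro (z | z)
      · have := Perm.sameCycle_apply_right (f := β * α) (x := x) (y := z)
        simpa using this
      · simp
    exact (h1.sameCycle h).mp (Perm.SameCycle.refl _ _)
  · intro h
    have h1 : Invar (β * α) fun z => (dbl α β).SameCycle (Sum.inl x) (Sum.inl z) := by
      intro z
      have : (Sum.inl ((β * α) z) : X ⊕ X) = dbl α β (dbl α β (Sum.inl z)) := rfl
      simp only [this, Perm.sameCycle_apply_right]
    exact (h1.sameCycle h).mp (Perm.SameCycle.refl _ _)

/-- The cycles of a doubled permutation. -/
noncomputable def cycDbl (α β : Perm X) : Cyc (β * α) ≃ Cyc (dbl α β) :=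
  Equiv.ofBijective (fun c => Cyc.mk _ (Sum.inl c.rep)) <| by
    constructor
    · intro c d h
      simp only at h
      rw [Cyc.mk_eq_mk, sameCycle_dbl_inl, ← Cyc.mk_eq_mk, Cyc.mk_rep, Cyc.mk_rep] at h
      exact h
    · intro d
      obtain ⟨x | x, rfl⟩ := Cyc.mk_surjective _ d
      · exact ⟨Cyc.mk _ x,
          Cyc.mk_eq_mk.mpr (sameCycle_dbl_inl.mpr (Cyc.rep_sameCycle _ x))⟩
      · refine ⟨Cyc.mk _ (β x),
          Cyc.mk_eq_mk.mpr ((sameCycle_dbl_inl.mpr (Cyc.rep_sameCycle _ (β x))).trans ?_)⟩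
        rw [← dbl_inr α β x, Perm.sameCycle_apply_left]

theorem ncyc_dbl (α β : Perm X) : ncyc (dbl α β) = ncyc (β * α) :=
  (Nat.card_congr (cycDbl α β)).symm

/-! ### Products over cycles -/

/-- The product of the values of a function over the cycles of a permutation. -/
noncomputable def cprod [Finite X] (π : Perm X) (f : X → ℂ) : ℂ := ∏ c : Cyc π, f c.rep

theorem cprod_map [Finite X] [Finite Y] (e : X ≃ Y) {π : Perm X} {ρ : Perm Y}
    (he : ∀ x, e (π x) = ρ (e x)) {f : Y → ℂ} (hf : Invar ρ f) :
    cprod ρ f = cprod π (fun x => f (e x)) :=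
  (Fintype.prod_equiv (cycEquiv e he) _ _ fun _ => (hf.rep _).symm).symm

theorem csum_map [Finite X] [Finite Y] (e : X ≃ Y) {π : Perm X} {ρ : Perm Y}
    (he : ∀ x, e (π x) = ρ (e x)) {f : Y → ℂ} (hf : Invar ρ f) :
    ∑ c : Cyc ρ, f c.rep = ∑ c : Cyc π, f (e c.rep) :=
  (Fintype.sum_equiv (cycEquiv e he) _ _ fun _ => (hf.rep _).symm).symm

theorem cprod_sumCongr [Finite Y] [Finite Z] (σ : Perm Y) (τ : Perm Z) {f : Y ⊕ Z → ℂ}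
    (hf : Invar (Perm.sumCongr σ τ) f) : cprod (Perm.sumCongr σ τ) f =
      cprod σ (fun x => f (Sum.inl x)) * cprod τ (fun x => f (Sum.inr x)) := by
  rw [cprod, ← Fintype.prod_equiv (cycSum σ τ) (fun c => f (Sum.elim
    (fun c => Sum.inl c.rep) (fun c => Sum.inr c.rep) c)) _ ?_, Fintype.prod_sum_type]
  · rfl
  · rintro (c | c)
    · exact (hf.rep _).symm
    · exact (hf.rep _).symm

theorem csum_sumCongr [Finite Y] [Finite Z] (σ : Perm Y) (τ : Perm Z) {f : Y ⊕ Z → ℂ}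
    (hf : Invar (Perm.sumCongr σ τ) f) : ∑ c : Cyc (Perm.sumCongr σ τ), f c.rep =
      ∑ c : Cyc σ, f (Sum.inl c.rep) + ∑ c : Cyc τ, f (Sum.inr c.rep) := by
  rw [← Fintype.sum_equiv (cycSum σ τ) (fun c => f (Sum.elim
    (fun c => Sum.inl c.rep) (fun c => Sum.inr c.rep) c)) _ ?_, Fintype.sum_sum_type]
  · rfl
  · rintro (c | c)
    · exact (hf.rep _).symm
    · exact (hf.rep _).symm

theorem cprod_congr [Finite X] {π : Perm X} {f g : X → ℂ} (h : ∀ x, f x = g x) :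
    cprod π f = cprod π g := by rw [funext h]

theorem cprod_eq_zero [Finite X] {π : Perm X} {f : X → ℂ} (hf : Invar π f) {x : X}
    (h : f x = 0) : cprod π f = 0 :=
  Finset.prod_eq_zero (Finset.mem_univ (Cyc.mk π x)) (by rw [hf.rep, h])

theorem cprod_one [Finite X] (π : Perm X) : cprod π (fun _ => 1) = 1 := Finset.prod_const_one

/-! ### Non-crossing permutations under conjugation and direct sums -/

theorem isNC_map [Finite X] [Finite Y] (e : X ≃ Y) {γ σ : Perm X} {γ' σ' : Perm Y}
    (hγ : ∀ x, e (γ x) = γ' (e x)) (hσ : ∀ x, e (σ x) = σ' (e x)) :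
    IsNC γ' σ' ↔ IsNC γ σ := by
  have h : ∀ x, e ((σ⁻¹ * γ) x) = (σ'⁻¹ * γ') (e x) := fun x => by
    rw [Perm.mul_apply, Perm.mul_apply, Perm.eq_inv_iff_eq, ← hσ, ← hγ]
    exact congrArg e (σ.apply_symm_apply _)
  rw [IsNC, IsNC, ncyc_map e hγ, ncyc_map e hσ, ncyc_map e h, Nat.card_congr e]

theorem joined_map (e : X ≃ Y) {γ σ : Perm X} {γ' σ' : Perm Y}
    (hγ : ∀ x, e (γ x) = γ' (e x)) (hσ : ∀ x, e (σ x) = σ' (e x)) {x y : X} :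
    Joined σ' γ' (e x) (e y) ↔ Joined σ γ x y := by
  constructor
  · intro h f hf1 hf2
    have := h (fun z => f (e.symm z)) (hf1.comp_map (semiconj_symm hσ))
      (hf2.comp_map (semiconj_symm hγ))
    simpa using this
  · intro h f hf1 hf2
    exact h (fun z => f (e z)) (hf1.comp_map hσ) (hf2.comp_map hγ)

theorem isAnn_map [Finite X] [Finite Y] (e : X ≃ Y) {γ σ : Perm X} {γ' σ' : Perm Y}
    (hγ : ∀ x, e (γ x) = γ' (e x)) (hσ : ∀ x, e (σ x) = σ' (e x)) {x y : X} :
    IsAnn γ' σ' (e x) (e y) ↔ IsAnn γ σ x y := by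
  have h : ∀ x, e ((σ⁻¹ * γ) x) = (σ'⁻¹ * γ') (e x) := fun x => by
    rw [Perm.mul_apply, Perm.mul_apply, Perm.eq_inv_iff_eq, ← hσ, ← hγ]
    exact congrArg e (σ.apply_symm_apply _)
  rw [IsAnn, IsAnn, ncyc_map e hγ, ncyc_map e hσ, ncyc_map e h, Nat.card_congr e,
    joined_map e hγ hσ]

theorem Joined.congr {γ σ : Perm X} {x y x' y' : X} (hx : γ.SameCycle x x')
    (hy : γ.SameCycle y y') (h : Joined σ γ x y) : Joined σ γ x' y' := fun f hf1 hf2 => by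
  rw [← hf2.sameCycle hx, ← hf2.sameCycle hy]
  exact h f hf1 hf2

theorem isAnn_congr [Finite X] {γ σ : Perm X} {x y x' y' : X} (hx : γ.SameCycle x x')
    (hy : γ.SameCycle y y') : IsAnn γ σ x y ↔ IsAnn γ σ x' y' :=
  and_congr_right fun _ => ⟨fun h => h.congr hx hy, fun h => h.congr hx.symm hy.symm⟩

/-- The defects of the triangle inequality add up and neither is negative, so the total vanishes
only if both do. -/
theorem isNC_sumCongr [Finite Y] [Finite Z] {α σ : Perm Y} {β τ : Perm Z} :
    IsNC (Perm.sumCongr α β) (Perm.sumCongr σ τ) ↔ IsNC α σ ∧ IsNC β τ := by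
  have h1 := ncyc_add_le_card σ α
  have h2 := ncyc_add_le_card τ β
  rw [IsNC, IsNC, IsNC, Perm.sumCongr_inv, Perm.sumCongr_mul, ncyc_sumCongr, ncyc_sumCongr,
    ncyc_sumCongr, Nat.card_sum]
  omega

theorem joined_sumCongr_inl {α σ : Perm Y} {β τ : Perm Z} {x y : Y} :
    Joined (Perm.sumCongr σ τ) (Perm.sumCongr α β) (Sum.inl x) (Sum.inl y) ↔ Joined σ α x y := by
  constructor
  · intro h f hf1 hf2
    refine h (Sum.elim f fun _ => 0) ?_ ?_
    · rintro (z | z)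
      · exact hf1 z
      · rfl
    · rintro (z | z)
      · exact hf2 z
      · rfl
  · intro h f hf1 hf2
    exact h (fun z => f (Sum.inl z)) (fun z => hf1 (Sum.inl z)) (fun z => hf2 (Sum.inl z))

/-- The join takes place in the first summand and already costs the full defect of two there, so
nothing is left for the second. -/
theorem isAnn_sumCongr [Finite Y] [Finite Z] {α σ : Perm Y} {β τ : Perm Z} {x y : Y}
    (hxy : ¬ α.SameCycle x y) :
    IsAnn (Perm.sumCongr α β) (Perm.sumCongr σ τ) (Sum.inl x) (Sum.inl y) ↔
      IsAnn α σ x y ∧ IsNC β τ := by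
  have h2 := ncyc_add_le_card τ β
  rw [IsAnn, IsAnn, joined_sumCongr_inl]
  have h3 : Joined σ α x y → _ := ncyc_add_two_le_of_joined hxy
  rw [IsNC, Perm.sumCongr_inv, Perm.sumCongr_mul, ncyc_sumCongr, ncyc_sumCongr,
    ncyc_sumCongr, Nat.card_sum]
  constructor
  · rintro ⟨h4, h5⟩
    have := h3 h5
    refine ⟨⟨?_, h5⟩, ?_⟩ <;> omega
  · rintro ⟨⟨h4, h5⟩, h6⟩
    refine ⟨?_, h5⟩
    omega

/-- A permutation that preserves both summands is a direct sum. -/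
theorem exists_eq_sumCongr [Finite Y] [Finite Z] {ρ : Perm (Y ⊕ Z)}
    (h : Invar ρ (Sum.elim (fun _ => True) fun _ => False : Y ⊕ Z → Prop)) :
    ∃ σ τ, ρ = Perm.sumCongr σ τ := by
  have h1 : Set.MapsTo ρ (Set.range Sum.inl) (Set.range Sum.inl) := by
    rintro _ ⟨y, rfl⟩
    have := h (Sum.inl y)
    rcases hy : ρ (Sum.inl y) with z | z
    · exact ⟨z, rfl⟩
    · rw [hy] at this
      simp at this
  obtain ⟨⟨σ, τ⟩, hs⟩ := Perm.mem_sumCongrHom_range_of_perm_mapsTo_inl h1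
  exact ⟨σ, τ, hs.symm⟩

theorem sumCongr_inj {σ σ' : Perm Y} {τ τ' : Perm Z}
    (h : Perm.sumCongr σ τ = Perm.sumCongr σ' τ') : σ = σ' ∧ τ = τ' := by
  have := Perm.sumCongrHom_injective (α := Y) (β := Z) (a₁ := (σ, τ)) (a₂ := (σ', τ')) h
  simpa using this

theorem invar_sumCongr_isLeft (σ : Perm Y) (τ : Perm Z) :
    Invar (Perm.sumCongr σ τ) (Sum.elim (fun _ => True) fun _ => False : Y ⊕ Z → Prop) := by
  rintro (z | z) <;> simp

end CycleMaps

/-! ### Functionals evaluated along cycles -/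

section Evaluation

variable {A : Type*} {X Y Z : Type}

/-- The value of a family of functions of words at the word along the cycle of `π` through `x`. -/
noncomputable def ev (F : ∀ n, (Fin n → A) → ℂ) (π : Perm X) (a : X → A) (x : X) : ℂ :=
  F (Function.minimalPeriod π x) fun k => a ((π ^ (k : ℕ)) x)

/-- The value of a family of functions of two words at the words along two cycles. -/
noncomputable def ev₂ (F : ∀ m n, (Fin m → A) → (Fin n → A) → ℂ) (π : Perm X) (a : X → A) (x : X)
    (ρ : Perm Y) (b : Y → A) (y : Y) : ℂ :=
  F (Function.minimalPeriod π x) (Function.minimalPeriod ρ y) (fun k => a ((π ^ (k : ℕ)) x))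
    fun k => b ((ρ ^ (k : ℕ)) y)

/-- Invariance under cyclic rotations of words. -/
def CyclicInv (F : ∀ n, (Fin n → A) → ℂ) : Prop :=
  ∀ n (a : Fin n → A), F n (fun i => a (finRotate n i)) = F n a

/-- Invariance under cyclic rotations of both words. -/
def CyclicInv₂ (F : ∀ m n, (Fin m → A) → (Fin n → A) → ℂ) : Prop :=
  (∀ m n (a : Fin m → A) (b : Fin n → A), F m n (fun i => a (finRotate m i)) b = F m n a b) ∧
    ∀ m n (a : Fin m → A) (b : Fin n → A), F m n a (fun i => b (finRotate n i)) = F m n a b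

theorem map_pow {π : Perm X} {ρ : Perm Y} {e : X → Y} (he : ∀ x, e (π x) = ρ (e x)) (n : ℕ)
    (x : X) : e ((π ^ n) x) = (ρ ^ n) (e x) := by
  induction n generalizing x with
  | zero => rfl
  | succ n ih => rw [pow_succ, Perm.mul_apply, ih, he, pow_succ, Perm.mul_apply]

theorem minimalPeriod_map {π : Perm X} {ρ : Perm Y} {e : X → Y} (hinj : Function.Injective e)
    (he : ∀ x, e (π x) = ρ (e x)) (x : X) :
    Function.minimalPeriod ρ (e x) = Function.minimalPeriod π x := by
  rw [Function.minimalPeriod_eq_minimalPeriod_iff]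
  intro n
  rw [Function.IsPeriodicPt, Function.IsPeriodicPt, Function.IsFixedPt, Function.IsFixedPt,
    ← Perm.coe_pow, ← Perm.coe_pow, ← map_pow he, hinj.eq_iff]

/-- Words along cycles are written as initial segments of sequences on `ℕ`, so that their lengths
can be rewritten without casts. -/
theorem functional_congr (F : ∀ n, (Fin n → A) → ℂ) {m n : ℕ} (h : m = n) {w : ℕ → A} :
    F m (fun k => w k) = F n fun k => w k := by
  subst h; rfl

theorem functional₂_congr (F : ∀ m n, (Fin m → A) → (Fin n → A) → ℂ) {m n m' n' : ℕ}
    (h : m = m') (h' : n = n') {w v : ℕ → A} :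
    F m n (fun k => w k) (fun k => v k) = F m' n' (fun k => w k) fun k => v k := by
  subst h h'; rfl

theorem ev_map (F : ∀ n, (Fin n → A) → ℂ) {π : Perm X} {ρ : Perm Y} {e : X → Y}
    (hinj : Function.Injective e) (he : ∀ x, e (π x) = ρ (e x)) (a : Y → A) (x : X) :
    ev F ρ a (e x) = ev F π (fun z => a (e z)) x := by
  rw [ev, ev, functional_congr F (minimalPeriod_map hinj he x)
    (w := fun k => a ((ρ ^ k) (e x)))]
  simp only [map_pow he]

theorem ev₂_map (F : ∀ m n, (Fin m → A) → (Fin n → A) → ℂ) {π : Perm X} {ρ : Perm Y} {e : X → Y}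
    (hinj : Function.Injective e) (he : ∀ x, e (π x) = ρ (e x)) (a : Y → A) (x : X)
    {X' Y' : Type} {π' : Perm X'} {ρ' : Perm Y'} {e' : X' → Y'}
    (hinj' : Function.Injective e') (he' : ∀ x, e' (π' x) = ρ' (e' x)) (b : Y' → A) (x' : X') :
    ev₂ F ρ a (e x) ρ' b (e' x') = ev₂ F π (fun z => a (e z)) x π' (fun z => b (e' z)) x' := by
  rw [ev₂, ev₂, functional₂_congr F (minimalPeriod_map hinj he x) (minimalPeriod_map hinj' he' x')
    (w := fun k => a ((ρ ^ k) (e x))) (v := fun k => b ((ρ' ^ k) (e' x')))]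
  simp only [map_pow he, map_pow he']

/-- The condition `w n = w 0` takes care of the last index, where the rotation returns to `0`. -/
theorem apply_finRotate {β : Type*} {n : ℕ} (w : ℕ → β) (hw : w n = w 0) (k : Fin n) :
    w (finRotate n k) = w (k + 1) := by
  cases n with
  | zero => exact k.elim0
  | succ n =>
    rcases eq_or_ne k (Fin.last n) with rfl | hk
    · rw [finRotate_last]
      exact hw.symm
    · rw [coe_finRotate_of_ne_last hk]

theorem pow_minimalPeriod_apply (π : Perm X) (x : X) :
    (π ^ Function.minimalPeriod π x) x = x := by
  rw [Perm.coe_pow]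
  exact Function.isPeriodicPt_minimalPeriod π x

theorem word_perm_apply (π : Perm X) (a : X → A) (x : X)
    (k : Fin (Function.minimalPeriod π x)) :
    a (π ((π ^ (k : ℕ)) x)) =
      a ((π ^ (finRotate (Function.minimalPeriod π x) k : ℕ)) x) := by
  have := apply_finRotate (fun k => a ((π ^ k) x)) (by simp [pow_minimalPeriod_apply]) k
  rw [← Perm.mul_apply, ← pow_succ']
  exact this.symm

/-- Starting a cycle one step later rotates its word. This is why products over cycles do not depend
on the chosen representatives. -/
theorem CyclicInv.ev_invar {F : ∀ n, (Fin n → A) → ℂ} (hF : CyclicInv F) (π : Perm X)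
    (a : X → A) : Invar π (ev F π a) := by
  intro x
  rw [ev_map F (e := π) π.injective (fun _ => rfl)]
  refine Eq.trans ?_ (hF _ _)
  exact congrArg _ (funext fun k => word_perm_apply π a x k)

theorem CyclicInv₂.ev₂_invar_left {F : ∀ m n, (Fin m → A) → (Fin n → A) → ℂ} (hF : CyclicInv₂ F)
    (π : Perm X) (a : X → A) (ρ : Perm Y) (b : Y → A) (y : Y) :
    Invar π (fun x => ev₂ F π a x ρ b y) := by
  intro x
  refine (ev₂_map F (e := π) π.injective (fun _ => rfl) a x (e' := id) Function.injective_id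
    (fun _ => rfl) b y).trans (Eq.trans ?_ (hF.1 _ _ _ _))
  exact congrArg (fun w => F _ _ w _) (funext fun k => word_perm_apply π a x k)

theorem CyclicInv₂.ev₂_invar_right {F : ∀ m n, (Fin m → A) → (Fin n → A) → ℂ} (hF : CyclicInv₂ F)
    (π : Perm X) (a : X → A) (x : X) (ρ : Perm Y) (b : Y → A) :
    Invar ρ (fun y => ev₂ F π a x ρ b y) := by
  intro y
  refine (ev₂_map F (e := id) Function.injective_id (fun _ => rfl) a x (e' := ρ) ρ.injective
    (fun _ => rfl) b y).trans (Eq.trans ?_ (hF.2 _ _ _ _))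
  exact congrArg (fun w => F _ _ _ w) (funext fun k => word_perm_apply ρ b y k)

/-- The function `f`, replaced by `1` on the cycle through `x`. -/
noncomputable def off (π : Perm X) (x : X) (f : X → ℂ) : X → ℂ :=
  open Classical in fun z => if π.SameCycle x z then 1 else f z

theorem Invar.off {π : Perm X} {f : X → ℂ} (hf : Invar π f) (x : X) :
    Invar π (off π x f) := fun z => by
  by_cases h : π.SameCycle x z <;> simp [SecondOrder.off, h, hf z]

theorem off_congr (π : Perm X) {x y : X} (h : π.SameCycle x y) (f : X → ℂ) :
    off π x f = off π y f := by
  funext z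
  have : π.SameCycle x z ↔ π.SameCycle y z := ⟨h.symm.trans, h.trans⟩
  by_cases h' : π.SameCycle y z <;> simp [off, this, h']

theorem off_map {π : Perm X} {ρ : Perm Y} {e : X ≃ Y} (he : ∀ x, e (π x) = ρ (e x)) (x : X)
    (f : Y → ℂ) (z : X) : off ρ (e x) f (e z) = off π x (fun w => f (e w)) z := by
  by_cases h : π.SameCycle x z <;> simp [off, sameCycle_map_iff he, h]

end Evaluation

/-! ### Cycle representatives on `Fin n` -/

section Fin

theorem exists_mem_cycleMins {n : ℕ} (π : Perm (Fin n)) (i : Fin n) :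
    ∃ j ∈ cycleMins π, π.SameCycle i j := by
  classical
  let s := Finset.univ.filter fun j => π.SameCycle i j
  have hs : s.Nonempty := ⟨i, by simp [s, Perm.SameCycle.refl]⟩
  have h1 : π.SameCycle i (s.min' hs) := by simpa [s] using s.min'_mem hs
  refine ⟨s.min' hs, ?_, h1⟩
  simp only [cycleMins, Finset.mem_filter, Finset.mem_univ, true_and]
  exact fun j hj => s.min'_le j (by simpa [s] using h1.trans hj)

theorem eq_of_mem_cycleMins {n : ℕ} {π : Perm (Fin n)} {i j : Fin n} (hi : i ∈ cycleMins π)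
    (hj : j ∈ cycleMins π) (h : π.SameCycle i j) : i = j := by
  simp only [cycleMins, Finset.mem_filter, Finset.mem_univ, true_and] at hi hj
  exact le_antisymm (hi j h) (hj i h.symm)

/-- The smallest elements of the cycles correspond to the cycles. -/
noncomputable def cycleMinsEquiv {n : ℕ} (π : Perm (Fin n)) :
    {i // i ∈ cycleMins π} ≃ Cyc π :=
  Equiv.ofBijective (fun i => Cyc.mk π i.1) <| by
    constructor
    · intro i j h
      exact Subtype.ext (eq_of_mem_cycleMins i.2 j.2 (Cyc.mk_eq_mk.mp h))
    · intro c
      obtain ⟨j, hj, h⟩ := exists_mem_cycleMins π c.rep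
      exact ⟨⟨j, hj⟩, (Cyc.mk_eq_mk.mpr h.symm).trans c.mk_rep⟩

theorem card_cycleMins {n : ℕ} (π : Perm (Fin n)) : (cycleMins π).card = ncyc π := by
  rw [ncyc, ← Nat.card_congr (cycleMinsEquiv π), Nat.card_eq_fintype_card, Fintype.card_coe]

theorem prod_cycleMins {n : ℕ} (π : Perm (Fin n)) {f : Fin n → ℂ} (hf : Invar π f) :
    ∏ i ∈ cycleMins π, f i = cprod π f := by
  rw [← Finset.prod_coe_sort]
  exact Fintype.prod_equiv (cycleMinsEquiv π) _ _ fun i => (hf.rep _).symm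

theorem sum_cycleMins {n : ℕ} (π : Perm (Fin n)) {f : Fin n → ℂ} (hf : Invar π f) :
    ∑ i ∈ cycleMins π, f i = ∑ c : Cyc π, f c.rep := by
  rw [← Finset.sum_coe_sort]
  exact Fintype.sum_equiv (cycleMinsEquiv π) _ _ fun i => (hf.rep _).symm

theorem prod_erase_cycleMins {n : ℕ} (π : Perm (Fin n)) {f : Fin n → ℂ} (hf : Invar π f)
    {i : Fin n} (hi : i ∈ cycleMins π) :
    ∏ k ∈ (cycleMins π).erase i, f k = cprod π (off π i f) := by
  rw [← prod_cycleMins π (hf.off i), ← Finset.mul_prod_erase _ _ hi]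
  have h1 : off π i f i = 1 := by simp [off, Perm.SameCycle.refl]
  rw [h1, one_mul]
  refine Finset.prod_congr rfl fun k hk => ?_
  rw [Finset.mem_erase] at hk
  have h2 : ¬ π.SameCycle i k := fun h => hk.1 (eq_of_mem_cycleMins hi hk.2 h).symm
  simp [off, h2]

theorem ncyc_le {X : Type} [Finite X] (π : Perm X) : ncyc π ≤ Nat.card X :=
  Nat.card_le_card_of_surjective _ (Cyc.mk_surjective π)

/-- The truncated subtractions in `permLength` are harmless because there are at most `n` cycles. -/
theorem mem_discNC {n : ℕ} {π : Perm (Fin n)} : π ∈ discNC n ↔ IsNC (finRotate n) π := by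
  have h1 := ncyc_le π
  have h2 := ncyc_le (π⁻¹ * finRotate n)
  have h3 := ncyc_le (finRotate n)
  simp only [discNC, Finset.mem_filter, Finset.mem_univ, true_and, permLength, card_cycleMins,
    IsNC, Nat.card_eq_fintype_card, Fintype.card_fin] at *
  omega

/-- The permutation with the two cycles of `m` and `n` points. -/
abbrev twoCircles (m n : ℕ) : Perm (Fin m ⊕ Fin n) :=
  Perm.sumCongr (finRotate m) (finRotate n)

theorem finSumFinEquiv_twoCircles (m n : ℕ) (x : Fin m ⊕ Fin n) :
    finSumFinEquiv (twoCircles m n x) = annularRotate m n (finSumFinEquiv x) := by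
  simp [annularRotate, twoCircles, Equiv.permCongr_apply]

/-- Links the requirement that some cycle meets both circles to `Joined`: a cycle meeting both
circles identifies the values of any common invariant function on them, and if there is none, the
indicator of one circle is invariant. -/
theorem mem_annularNC {m n : ℕ} {σ : Perm (Fin (m + 1) ⊕ Fin (n + 1))}
    {π : Perm (Fin (m + 1 + (n + 1)))} (hσ : ∀ x, finSumFinEquiv (σ x) = π (finSumFinEquiv x)) :
    π ∈ annularNC (m + 1) (n + 1) ↔
      IsAnn (twoCircles (m + 1) (n + 1)) σ (Sum.inl 0) (Sum.inr 0) := by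
  rw [← isAnn_map finSumFinEquiv (finSumFinEquiv_twoCircles _ _) hσ]
  have h1 := ncyc_le π
  have h2 := ncyc_le (π⁻¹ * annularRotate (m + 1) (n + 1))
  have h3 := ncyc_le (annularRotate (m + 1) (n + 1))
  simp only [annularNC, Finset.mem_filter, Finset.mem_univ, true_and, permLength, card_cycleMins,
    IsAnn, Nat.card_eq_fintype_card, Fintype.card_fin] at *
  rw [and_comm]
  have h4 : (∃ (i : Fin (m + 1)) (j : Fin (n + 1)),
      π.SameCycle (Fin.castAdd (n + 1) i) (Fin.natAdd (m + 1) j)) ↔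
      Joined π (annularRotate (m + 1) (n + 1)) (finSumFinEquiv (Sum.inl 0))
        (finSumFinEquiv (Sum.inr 0)) := by
    constructor
    · rintro ⟨i, j, hij⟩ f hf1 hf2
      have hi : (twoCircles (m + 1) (n + 1)).SameCycle (Sum.inl 0) (Sum.inl i) :=
        sameCycle_sumCongr_inl.mpr (finRotate_sameCycle _ _)
      have hj : (twoCircles (m + 1) (n + 1)).SameCycle (Sum.inr 0) (Sum.inr j) :=
        sameCycle_sumCongr_inr.mpr (finRotate_sameCycle _ _)
      rw [hf2.sameCycle (sameCycle_map (finSumFinEquiv_twoCircles _ _) hi),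
        hf2.sameCycle (sameCycle_map (finSumFinEquiv_twoCircles _ _) hj)]
      exact hf1.sameCycle hij
    · rw [joined_map finSumFinEquiv (finSumFinEquiv_twoCircles _ _) hσ]
      intro h
      by_contra! hne
      -- If no cycle meets both circles, `σ` maps each circle to itself, and the indicator of the
      -- first circle contradicts `h`.
      have hinv : Invar σ (Sum.elim (fun _ => True) fun _ => False : _ → Prop) := by
        rintro (z | z)
        · rcases hz : σ (Sum.inl z) with w | w
          · simp
          · refine absurd ?_ (hne z w)
            have := hσ (Sum.inl z)
            rw [hz, finSumFinEquiv_apply_left, finSumFinEquiv_apply_right] at this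
            rw [this, Perm.sameCycle_apply_right]
        · rcases hz : σ (Sum.inr z) with w | w
          · refine absurd ?_ (hne w z)
            have := hσ (Sum.inr z)
            rw [hz, finSumFinEquiv_apply_left, finSumFinEquiv_apply_right] at this
            rw [this, Perm.sameCycle_apply_left]
          · simp
      have := h (Sum.elim (fun _ => 1) fun _ => 0) ?_ ?_
      · simp at this
      · intro z
        have hz := hinv z
        rcases z with z | z <;> rcases hw : σ _ with w | w <;> simp_all
      · rintro (z | z) <;> simp
  rw [h4]
  refine and_congr_left fun h5 => ?_
  have h6 : ¬ (annularRotate (m + 1) (n + 1)).SameCycle (finSumFinEquiv (Sum.inl 0))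
      (finSumFinEquiv (Sum.inr 0)) := by
    rw [sameCycle_map_iff (finSumFinEquiv_twoCircles _ _)]
    exact not_sameCycle_sumCongr
  have h7 := ncyc_add_two_le_of_joined h6 h5
  rw [Nat.card_eq_fintype_card, Fintype.card_fin] at h7
  omega

end Fin

/-! ### Sums over non-crossing permutations -/

section Sums

noncomputable instance {X : Type} [Finite X] : Fintype (Perm X) := Fintype.ofFinite _

/-- The indicator of a proposition. -/
noncomputable def ind (P : Prop) : ℂ := open Classical in if P then 1 else 0

theorem ind_of {P : Prop} (h : P) : ind P = 1 := by simp [ind, h]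

theorem ind_of_not {P : Prop} (h : ¬ P) : ind P = 0 := by simp [ind, h]

theorem ind_congr {P Q : Prop} (h : P ↔ Q) : ind P = ind Q := by rw [propext h]

theorem ind_and (P Q : Prop) : ind (P ∧ Q) = ind P * ind Q := by
  by_cases hP : P <;> by_cases hQ : Q <;> simp [ind, hP, hQ]

variable {A : Type*} {X Y Z X' Y' : Type} [Finite X] [Finite Y] [Finite Z] [Finite X'] [Finite Y']

/-- The sum of the multiplicative extension of `F` over the permutations that are non-crossing in
the cycles of `γ`. -/
noncomputable def ncSum (γ : Perm X) (F : ∀ n, (Fin n → A) → ℂ) (a : X → A) : ℂ :=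
  ∑ σ : Perm X, ind (IsNC γ σ) * cprod σ (ev F σ a)

/-- The sum of the multiplicative extension of `F` over the permutations that are annular
non-crossing between the cycles of `γ` through `x` and `y`. -/
noncomputable def annSum (γ : Perm X) (x y : X) (F : ∀ n, (Fin n → A) → ℂ) (a : X → A) : ℂ :=
  ∑ σ : Perm X, ind (IsAnn γ σ x y) * cprod σ (ev F σ a)

/-- The multiplicative extension for permutations of two sets with one marked cycle each. -/
noncomputable def markTerm (F : ∀ n, (Fin n → A) → ℂ)
    (F₂ : ∀ m n, (Fin m → A) → (Fin n → A) → ℂ) (σ : Perm X) (a : X → A) (x : X)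
    (τ : Perm Y) (b : Y → A) (y : Y) : ℂ :=
  ev₂ F₂ σ a x τ b y * cprod σ (off σ x (ev F σ a)) * cprod τ (off τ y (ev F τ b))

/-- The sum of the multiplicative extension over pairs of non-crossing permutations with one
marked cycle each. -/
noncomputable def markSum (F : ∀ n, (Fin n → A) → ℂ)
    (F₂ : ∀ m n, (Fin m → A) → (Fin n → A) → ℂ) (α : Perm X) (a : X → A)
    (β : Perm Y) (b : Y → A) : ℂ :=
  ∑ σ : Perm X, ∑ τ : Perm Y, ind (IsNC α σ) * ind (IsNC β τ) *
    ∑ c : Cyc σ, ∑ d : Cyc τ, markTerm F F₂ σ a c.rep τ b d.rep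

theorem permCongr_semiconj {X Y : Type} (e : X ≃ Y) (σ : Perm X) (x : X) :
    e (σ x) = e.permCongr σ (e x) := by simp [Equiv.permCongr_apply]

theorem cprod_ev_map {F : ∀ n, (Fin n → A) → ℂ} (hF : CyclicInv F) (e : X ≃ Y) {σ : Perm X}
    {τ : Perm Y} (he : ∀ x, e (σ x) = τ (e x)) (a : Y → A) :
    cprod τ (ev F τ a) = cprod σ (ev F σ fun x => a (e x)) := by
  rw [cprod_map e he (hF.ev_invar _ _)]
  exact cprod_congr fun x => ev_map F e.injective he a x

theorem ncSum_map {F : ∀ n, (Fin n → A) → ℂ} (hF : CyclicInv F) (e : X ≃ Y) {γ : Perm X}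
    {γ' : Perm Y} (he : ∀ x, e (γ x) = γ' (e x)) (a : Y → A) :
    ncSum γ' F a = ncSum γ F fun x => a (e x) := by
  refine (Fintype.sum_equiv e.permCongr _ _ fun σ => ?_).symm
  rw [isNC_map e he (permCongr_semiconj e σ), cprod_ev_map hF e (permCongr_semiconj e σ)]

theorem annSum_map {F : ∀ n, (Fin n → A) → ℂ} (hF : CyclicInv F) (e : X ≃ Y) {γ : Perm X}
    {γ' : Perm Y} (he : ∀ x, e (γ x) = γ' (e x)) (x y : X) (a : Y → A) :
    annSum γ' (e x) (e y) F a = annSum γ x y F fun x => a (e x) := by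
  refine (Fintype.sum_equiv e.permCongr _ _ fun σ => ?_).symm
  rw [isAnn_map e he (permCongr_semiconj e σ), cprod_ev_map hF e (permCongr_semiconj e σ)]

theorem annSum_congr {F : ∀ n, (Fin n → A) → ℂ} {γ : Perm X} {x y x' y' : X}
    (hx : γ.SameCycle x x') (hy : γ.SameCycle y y') (a : X → A) :
    annSum γ x y F a = annSum γ x' y' F a :=
  Finset.sum_congr rfl fun σ _ => by rw [isAnn_congr hx hy]

theorem cprod_off_map {F : ∀ n, (Fin n → A) → ℂ} (hF : CyclicInv F) (e : X ≃ Y) {σ : Perm X}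
    {τ : Perm Y} (he : ∀ x, e (σ x) = τ (e x)) (a : Y → A) (x : X) :
    cprod τ (off τ (e x) (ev F τ a)) = cprod σ (off σ x (ev F σ fun x => a (e x))) := by
  rw [cprod_map e he ((hF.ev_invar _ _).off _)]
  refine cprod_congr fun z => ?_
  rw [off_map he]
  congr 1
  exact funext fun z => ev_map F e.injective he a z

theorem cprod_off_invar (f : X → ℂ) (σ : Perm X) :
    Invar σ (fun x => cprod σ (off σ x f)) := fun x => by
  simp only
  rw [off_congr σ (Perm.sameCycle_apply_left.mpr (Perm.SameCycle.refl σ x))]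

theorem markTerm_invar_left {F : ∀ n, (Fin n → A) → ℂ}
    {F₂ : ∀ m n, (Fin m → A) → (Fin n → A) → ℂ} (hF₂ : CyclicInv₂ F₂) (σ : Perm X) (a : X → A)
    (τ : Perm Y) (b : Y → A) (y : Y) : Invar σ (fun x => markTerm F F₂ σ a x τ b y) := fun x => by
  have h1 := hF₂.ev₂_invar_left σ a τ b y x
  have h2 := cprod_off_invar (ev F σ a) σ x
  simp only [markTerm] at *
  rw [h1, h2]

theorem markTerm_invar_right {F : ∀ n, (Fin n → A) → ℂ}
    {F₂ : ∀ m n, (Fin m → A) → (Fin n → A) → ℂ} (hF₂ : CyclicInv₂ F₂) (σ : Perm X) (a : X → A)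
    (x : X) (τ : Perm Y) (b : Y → A) : Invar τ (fun y => markTerm F F₂ σ a x τ b y) := fun y => by
  have h1 := hF₂.ev₂_invar_right σ a x τ b y
  have h2 := cprod_off_invar (ev F τ b) τ y
  simp only [markTerm] at *
  rw [h1, h2]

theorem markTerm_map {F : ∀ n, (Fin n → A) → ℂ} (hF : CyclicInv F)
    {F₂ : ∀ m n, (Fin m → A) → (Fin n → A) → ℂ} (e : X ≃ Y) {σ : Perm X} {τ : Perm Y}
    (he : ∀ x, e (σ x) = τ (e x)) (a : Y → A) (x : X) (e' : X' ≃ Y') {σ' : Perm X'} {τ' : Perm Y'}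
    (he' : ∀ x, e' (σ' x) = τ' (e' x)) (b : Y' → A) (x' : X') :
    markTerm F F₂ τ a (e x) τ' b (e' x') =
      markTerm F F₂ σ (fun x => a (e x)) x σ' (fun x => b (e' x)) x' := by
  rw [markTerm, markTerm, ev₂_map F₂ e.injective he a x e'.injective he' b x',
    cprod_off_map hF e he, cprod_off_map hF e' he']

theorem csum_csum_map {σ : Perm X} {τ : Perm Y} (e : X ≃ Y) (he : ∀ x, e (σ x) = τ (e x))
    {σ' : Perm X'} {τ' : Perm Y'} (e' : X' ≃ Y') (he' : ∀ x, e' (σ' x) = τ' (e' x))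
    {f : Y → Y' → ℂ} (hf : ∀ y', Invar τ fun y => f y y') (hf' : ∀ y, Invar τ' (f y)) :
    ∑ c : Cyc τ, ∑ d : Cyc τ', f c.rep d.rep =
      ∑ c : Cyc σ, ∑ d : Cyc σ', f (e c.rep) (e' d.rep) := by
  rw [csum_map e he (f := fun y => ∑ d : Cyc τ', f y d.rep)
    fun x => Finset.sum_congr rfl fun d _ => hf d.rep x]
  exact Finset.sum_congr rfl fun c _ => csum_map e' he' (hf' _)

theorem markSum_map {F : ∀ n, (Fin n → A) → ℂ} (hF : CyclicInv F)
    {F₂ : ∀ m n, (Fin m → A) → (Fin n → A) → ℂ} (hF₂ : CyclicInv₂ F₂) (e : X ≃ Y) {α : Perm X}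
    {α' : Perm Y} (he : ∀ x, e (α x) = α' (e x)) (a : Y → A) (e' : X' ≃ Y') {β : Perm X'}
    {β' : Perm Y'} (he' : ∀ x, e' (β x) = β' (e' x)) (b : Y' → A) :
    markSum F F₂ α' a β' b =
      markSum F F₂ α (fun x => a (e x)) β fun x => b (e' x) := by
  refine (Fintype.sum_equiv e.permCongr _ _ fun σ => ?_).symm
  refine (Fintype.sum_equiv e'.permCongr _ _ fun τ => ?_)
  have h1 := permCongr_semiconj e σ
  have h2 := permCongr_semiconj e' τ
  rw [isNC_map e he h1, isNC_map e' he' h2, csum_csum_map e h1 e' h2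
    (f := fun y y' => markTerm F F₂ (e.permCongr σ) a y (e'.permCongr τ) b y')
    (fun y => markTerm_invar_left hF₂ _ _ _ _ _) (fun y => markTerm_invar_right hF₂ _ _ _ _ _)]
  simp only [markTerm_map hF e h1 a _ e' h2 b]

end Sums

/-! ### Cyclic invariance of the cumulants -/

section CyclicInvariance

theorem sum_discNC {n : ℕ} (f : Perm (Fin n) → ℂ) :
    ∑ π ∈ discNC n, f π = ∑ π : Perm (Fin n), ind (IsNC (finRotate n) π) * f π := by
  classical
  simp only [ind, ite_mul, one_mul, zero_mul]
  rw [← Finset.sum_filter]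
  refine Finset.sum_congr ?_ fun _ _ => rfl
  ext π
  simp [mem_discNC]

variable {A : Type*}

theorem sum_discNC_prod {F : ∀ n, (Fin n → A) → ℂ} (hF : CyclicInv F) {n : ℕ} (a : Fin n → A) :
    ∑ π ∈ discNC n, ∏ i ∈ cycleMins π, ev F π a i = ncSum (finRotate n) F a := by
  rw [sum_discNC]
  exact Finset.sum_congr rfl fun π _ => by rw [prod_cycleMins π (hF.ev_invar π a)]

theorem sum_annularNC_prod {F : ∀ n, (Fin n → A) → ℂ} (hF : CyclicInv F) {m n : ℕ}
    (a : Fin (m + 1) → A) (b : Fin (n + 1) → A) :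
    ∑ π ∈ annularNC (m + 1) (n + 1), ∏ i ∈ cycleMins π, ev F π (Fin.append a b) i =
      annSum (twoCircles (m + 1) (n + 1)) (Sum.inl 0) (Sum.inr 0) F (Sum.elim a b) := by
  classical
  have h1 : ∑ π ∈ annularNC (m + 1) (n + 1), ∏ i ∈ cycleMins π, ev F π (Fin.append a b) i =
      ∑ π : Perm (Fin (m + 1 + (n + 1))), ind (π ∈ annularNC (m + 1) (n + 1)) *
        cprod π (ev F π (Fin.append a b)) := by
    simp only [ind, ite_mul, one_mul, zero_mul]
    rw [← Finset.sum_filter]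
    refine Finset.sum_congr ?_ fun π _ => prod_cycleMins π (hF.ev_invar π _)
    ext π
    simp
  rw [h1]
  refine (Fintype.sum_equiv finSumFinEquiv.permCongr _ _ fun σ => ?_).symm
  have h2 := permCongr_semiconj finSumFinEquiv σ
  rw [mem_annularNC h2, cprod_ev_map hF finSumFinEquiv h2]
  congr 3
  funext x
  rcases x with x | x <;> simp

theorem sum_markedNC {m n : ℕ}
    (G : Perm (Fin m) → Perm (Fin n) → Fin m → Fin n → ℂ) :
    ∑ x ∈ markedNC m n, G x.1 x.2.1 x.2.2.1 x.2.2.2 =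
      ∑ π₁ ∈ discNC m, ∑ π₂ ∈ discNC n, ∑ i ∈ cycleMins π₁, ∑ j ∈ cycleMins π₂, G π₁ π₂ i j := by
  have h : markedNC m n = (discNC m ×ˢ discNC n ×ˢ Finset.univ ×ˢ Finset.univ).filter fun x =>
      x.2.2.1 ∈ cycleMins x.1 ∧ x.2.2.2 ∈ cycleMins x.2.1 := by
    ext x
    simp only [markedNC, Finset.mem_filter, Finset.mem_univ, true_and, Finset.mem_product,
      and_true, and_assoc]
  rw [h, Finset.sum_filter, Finset.sum_product]
  refine Finset.sum_congr rfl fun π₁ _ => ?_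
  rw [Finset.sum_product]
  refine Finset.sum_congr rfl fun π₂ _ => ?_
  rw [Finset.sum_product, ← Finset.sum_subset (Finset.subset_univ (cycleMins π₁))]
  · refine Finset.sum_congr rfl fun i hi => ?_
    simp only [hi, true_and]
    rw [← Finset.sum_filter]
    exact Finset.sum_congr (by ext; simp) fun _ _ => rfl
  · intro i _ hi
    simp [hi]

theorem sum_markedNC_prod {F : ∀ n, (Fin n → A) → ℂ} (hF : CyclicInv F)
    {F₂ : ∀ m n, (Fin m → A) → (Fin n → A) → ℂ} (hF₂ : CyclicInv₂ F₂) {m n : ℕ}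
    (a : Fin m → A) (b : Fin n → A) :
    ∑ x ∈ markedNC m n, ev₂ F₂ x.1 a x.2.2.1 x.2.1 b x.2.2.2 *
        (∏ k ∈ (cycleMins x.1).erase x.2.2.1, ev F x.1 a k) *
        (∏ k ∈ (cycleMins x.2.1).erase x.2.2.2, ev F x.2.1 b k) =
      markSum F F₂ (finRotate m) a (finRotate n) b := by
  rw [sum_markedNC fun π₁ π₂ i j => ev₂ F₂ π₁ a i π₂ b j *
        (∏ k ∈ (cycleMins π₁).erase i, ev F π₁ a k) *
        (∏ k ∈ (cycleMins π₂).erase j, ev F π₂ b k), sum_discNC]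
  refine Finset.sum_congr rfl fun π₁ _ => ?_
  rw [sum_discNC, Finset.mul_sum]
  refine Finset.sum_congr rfl fun π₂ _ => ?_
  rw [← mul_assoc]
  congr 1
  have h1 : ∀ i ∈ cycleMins π₁, ∀ j ∈ cycleMins π₂, ev₂ F₂ π₁ a i π₂ b j *
        (∏ k ∈ (cycleMins π₁).erase i, ev F π₁ a k) *
        (∏ k ∈ (cycleMins π₂).erase j, ev F π₂ b k) = markTerm F F₂ π₁ a i π₂ b j := by
    intro i hi j hj
    rw [prod_erase_cycleMins _ (hF.ev_invar _ _) hi, prod_erase_cycleMins _ (hF.ev_invar _ _) hj,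
      markTerm]
  rw [Finset.sum_congr rfl fun i hi => Finset.sum_congr rfl fun j hj => h1 i hi j hj]
  rw [sum_cycleMins π₁ (f := fun i => ∑ j ∈ cycleMins π₂, markTerm F F₂ π₁ a i π₂ b j)
    fun x => Finset.sum_congr rfl fun j _ => markTerm_invar_left hF₂ π₁ a π₂ b j x]
  exact Finset.sum_congr rfl fun c _ => sum_cycleMins π₂ (markTerm_invar_right hF₂ _ _ _ _ _)

/-- Rotating one circle is a relabelling that commutes with `twoCircles`. It moves the base point
along its own circle only, which `annSum_congr` allows. -/
theorem annSum_finRotate_left {F : ∀ n, (Fin n → A) → ℂ} (hF : CyclicInv F) {m n : ℕ}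
    (a : Fin (m + 1) → A) (b : Fin (n + 1) → A) :
    annSum (twoCircles (m + 1) (n + 1)) (Sum.inl 0) (Sum.inr 0) F
        (Sum.elim (fun i => a (finRotate (m + 1) i)) b) =
      annSum (twoCircles (m + 1) (n + 1)) (Sum.inl 0) (Sum.inr 0) F (Sum.elim a b) := by
  have h := annSum_map hF (Perm.sumCongr (finRotate (m + 1)) 1)
    (γ := twoCircles (m + 1) (n + 1)) (γ' := twoCircles (m + 1) (n + 1))
    (by rintro (x | x) <;> rfl) (Sum.inl 0) (Sum.inr 0) (Sum.elim a b)
  refine Eq.trans ?_ (h.symm.trans (annSum_congr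
    (sameCycle_sumCongr_inl.mpr (finRotate_sameCycle _ 0)) (Perm.SameCycle.refl _ _) _))
  congr 1
  funext x
  rcases x with x | x <;> rfl

theorem annSum_finRotate_right {F : ∀ n, (Fin n → A) → ℂ} (hF : CyclicInv F) {m n : ℕ}
    (a : Fin (m + 1) → A) (b : Fin (n + 1) → A) :
    annSum (twoCircles (m + 1) (n + 1)) (Sum.inl 0) (Sum.inr 0) F
        (Sum.elim a fun i => b (finRotate (n + 1) i)) =
      annSum (twoCircles (m + 1) (n + 1)) (Sum.inl 0) (Sum.inr 0) F (Sum.elim a b) := by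
  have h := annSum_map hF (Perm.sumCongr 1 (finRotate (n + 1)))
    (γ := twoCircles (m + 1) (n + 1)) (γ' := twoCircles (m + 1) (n + 1))
    (by rintro (x | x) <;> rfl) (Sum.inl 0) (Sum.inr 0) (Sum.elim a b)
  refine Eq.trans ?_ (h.symm.trans (annSum_congr (Perm.SameCycle.refl _ _)
    (sameCycle_sumCongr_inr.mpr (finRotate_sameCycle _ 0)) _))
  congr 1
  funext x
  rcases x with x | x <;> rfl

/-- The restriction of a family of functions of words to words with fewer than `N` letters. -/
noncomputable def cut (N : ℕ) (F : ∀ n, (Fin n → A) → ℂ) : ∀ n, (Fin n → A) → ℂ :=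
  fun n a => if n < N then F n a else 0

/-- The restriction of a family of functions of two words to words with fewer than `N` letters
together. -/
noncomputable def cut₂ (N : ℕ) (F : ∀ m n, (Fin m → A) → (Fin n → A) → ℂ) :
    ∀ m n, (Fin m → A) → (Fin n → A) → ℂ :=
  fun m n a b => if m + n < N then F m n a b else 0

variable [Ring A] [StarRing A] [Algebra ℂ A] [StarModule ℂ A]

/-- The moments as functions of words. -/
def moment (S : SecondOrderSpace A) : ∀ n, (Fin n → A) → ℂ := fun _ a => S.φ (List.ofFn a).prod

/-- The fluctuation moments as functions of two words. -/
def moment₂ (S : SecondOrderSpace A) : ∀ m n, (Fin m → A) → (Fin n → A) → ℂ :=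
  fun _ _ a b => S.φ₂ (List.ofFn a).prod (List.ofFn b).prod

theorem prod_ofFn_finRotate {M : Type*} [Monoid M] {n : ℕ} (a : Fin (n + 1) → M) :
    (List.ofFn fun i => a (finRotate (n + 1) i)).prod =
      (List.ofFn fun i : Fin n => a i.succ).prod * a 0 := by
  rw [List.ofFn_succ', List.concat_eq_append, List.prod_append, List.prod_singleton,
    finRotate_last]
  simp only [finRotate_apply, Fin.coeSucc_eq_succ]

theorem moment_cyclicInv (S : SecondOrderSpace A) : CyclicInv (moment S) := by
  intro n a
  cases n with
  | zero => exact congrArg _ (Subsingleton.elim _ _)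
  | succ n =>
    rw [moment, moment, prod_ofFn_finRotate, S.φ_tracial, List.ofFn_succ, List.prod_cons]

theorem moment₂_cyclicInv (S : SecondOrderSpace A) : CyclicInv₂ (moment₂ S) := by
  constructor
  · intro m n a b
    cases m with
    | zero => exact congrArg (fun w => moment₂ S _ _ w b) (Subsingleton.elim _ _)
    | succ n =>
      rw [moment₂, moment₂, prod_ofFn_finRotate, S.φ₂_tracial_left,
        List.ofFn_succ (f := a), List.prod_cons]
  · intro m n a b
    cases n with
    | zero => exact congrArg (fun w => moment₂ S _ _ a w) (Subsingleton.elim _ _)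
    | succ n =>
      rw [moment₂, moment₂, prod_ofFn_finRotate, S.φ₂_tracial_right,
        List.ofFn_succ (f := b), List.prod_cons]

/-- Cutting off words of full length makes the top term zero. The sum may then run over all of
`discNC`, a form to which the relabelling lemma `ncSum_map` applies. -/
theorem cumulant_eq_sub (S : SecondOrderSpace A) {n : ℕ} (a : Fin (n + 1) → A) :
    cumulant S (n + 1) a = moment S (n + 1) a -
      ∑ π ∈ discNC (n + 1), ∏ i ∈ cycleMins π, ev (cut (n + 1) (cumulant S)) π a i := by
  rw [cumulant, ← Finset.add_sum_erase _ _ (finRotate_mem_discNC (n + 1)),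
    cycleMins_of_sameCycle finRotate_sameCycle, Finset.prod_singleton]
  have h1 : ev (cut (n + 1) (cumulant S)) (finRotate (n + 1)) a 0 = 0 := by
    have := cycleLen_finRotate (0 : Fin (n + 1))
    rw [cycleLen] at this
    rw [ev, cut, if_neg (by omega)]
  rw [h1, zero_add]
  rfl

/-- Induction on length: the moment is invariant by traciality, and the sum of lower terms is
invariant because the rotation conjugates `finRotate` to itself. -/
theorem cumulant_cyclicInv (S : SecondOrderSpace A) : CyclicInv (cumulant S) := by
  intro n
  induction n using Nat.strong_induction_on with
  | _ n ih =>
    cases n with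
    | zero => exact fun a => congrArg _ (Subsingleton.elim _ _)
    | succ n =>
      intro a
      have hF : CyclicInv (cut (n + 1) (cumulant S)) := by
        intro k b
        by_cases hk : k < n + 1
        · simp only [cut, if_pos hk, ih k hk]
        · simp only [cut, if_neg hk]
      rw [cumulant_eq_sub, cumulant_eq_sub, moment_cyclicInv, sum_discNC_prod hF,
        sum_discNC_prod hF]
      rw [ncSum_map hF (finRotate (n + 1)) (γ := finRotate (n + 1)) (fun _ => rfl) a]

theorem moment_eq_ncSum (S : SecondOrderSpace A) {n : ℕ} (a : Fin n → A) :
    moment S n a = ncSum (finRotate n) (cumulant S) a := by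
  rw [← sum_discNC_prod (cumulant_cyclicInv S)]
  exact moment_eq_sum_cumulant S n a

/-- A circle without points admits neither annular permutations nor marked cycles, so only `φ₂(1, ·)
= 0` is left. Cyclic invariance is asserted for all lengths, hence this boundary case. -/
theorem cumulant₂_zero_left (S : SecondOrderSpace A) {n : ℕ} (a : Fin 0 → A) (b : Fin n → A) :
    cumulant₂ S 0 n a b = 0 := by
  have h1 : annularNC 0 n = ∅ := by
    rw [annularNC, Finset.filter_eq_empty_iff]
    rintro π - ⟨⟨i, -⟩, -⟩
    exact i.elim0
  rw [cumulant₂, h1, Finset.sum_empty, List.ofFn_zero, List.prod_nil, S.φ₂_one_left, sub_zero,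
    zero_sub, neg_eq_zero]
  exact Finset.sum_eq_zero fun x _ => x.2.2.1.elim0

theorem cumulant₂_zero_right (S : SecondOrderSpace A) {m : ℕ} (a : Fin m → A) (b : Fin 0 → A) :
    cumulant₂ S m 0 a b = 0 := by
  have h1 : annularNC m 0 = ∅ := by
    rw [annularNC, Finset.filter_eq_empty_iff]
    rintro π - ⟨⟨-, i, -⟩, -⟩
    exact i.elim0
  rw [cumulant₂, h1, Finset.sum_empty, List.ofFn_zero, List.prod_nil, S.φ₂_one_right, sub_zero,
    zero_sub, neg_eq_zero]
  exact Finset.sum_eq_zero fun x _ => x.2.2.2.elim0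

theorem cumulant₂_eq_sub (S : SecondOrderSpace A) {m n : ℕ} (a : Fin (m + 1) → A)
    (b : Fin (n + 1) → A) (hF₂ : CyclicInv₂ (cut₂ (m + 1 + (n + 1)) (cumulant₂ S))) :
    cumulant₂ S (m + 1) (n + 1) a b = moment₂ S (m + 1) (n + 1) a b -
      annSum (twoCircles (m + 1) (n + 1)) (Sum.inl 0) (Sum.inr 0) (cumulant S) (Sum.elim a b) -
      markSum (cumulant S) (cut₂ (m + 1 + (n + 1)) (cumulant₂ S)) (finRotate (m + 1)) a
        (finRotate (n + 1)) b := by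
  rw [← sum_markedNC_prod (cumulant_cyclicInv S) hF₂, ← sum_annularNC_prod (cumulant_cyclicInv S),
    cumulant₂, Finset.sum_filter]
  congr 1
  refine Finset.sum_congr rfl fun x _ => ?_
  by_cases h : x.1 = finRotate (m + 1) ∧ x.2.1 = finRotate (n + 1)
  · rw [if_neg (not_not.mpr h)]
    have h1 := cycleLen_finRotate x.2.2.1
    have h2 := cycleLen_finRotate x.2.2.2
    rw [← h.1, cycleLen] at h1
    rw [← h.2, cycleLen] at h2
    rw [ev₂, cut₂, if_neg (by omega), zero_mul, zero_mul]
  · rw [if_pos h, ev₂, cut₂]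
    by_cases h1 : cycleLen x.1 x.2.2.1 + cycleLen x.2.1 x.2.2.2 < m + 1 + (n + 1)
    · rw [dif_pos h1]
      rw [cycleLen, cycleLen] at h1
      rw [if_pos h1]
      rfl
    · rw [dif_neg h1]
      rw [cycleLen, cycleLen] at h1
      rw [if_neg h1, zero_mul, zero_mul]

/-- Both slots are handled in one induction on the total length, since the relabelling of `markSum`
needs the shorter cumulants to be invariant in both. -/
theorem cumulant₂_cyclicInv_aux (S : SecondOrderSpace A) (N : ℕ) :
    (∀ m n (a : Fin m → A) (b : Fin n → A), m + n = N →
      cumulant₂ S m n (fun i => a (finRotate m i)) b = cumulant₂ S m n a b) ∧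
    ∀ m n (a : Fin m → A) (b : Fin n → A), m + n = N →
      cumulant₂ S m n a (fun i => b (finRotate n i)) = cumulant₂ S m n a b := by
  induction N using Nat.strong_induction_on with
  | _ N ih =>
    have hF₂ : CyclicInv₂ (cut₂ N (cumulant₂ S)) := by
      constructor
      · intro k l a b
        by_cases hk : k + l < N
        · simp only [cut₂, if_pos hk, (ih _ hk).1 k l a b rfl]
        · simp only [cut₂, if_neg hk]
      · intro k l a b
        by_cases hk : k + l < N
        · simp only [cut₂, if_pos hk, (ih _ hk).2 k l a b rfl]
        · simp only [cut₂, if_neg hk]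
    have hF := cumulant_cyclicInv S
    constructor
    · rintro (_ | m) (_ | n) a b rfl
      · rw [cumulant₂_zero_left, cumulant₂_zero_left]
      · rw [cumulant₂_zero_left, cumulant₂_zero_left]
      · rw [cumulant₂_zero_right, cumulant₂_zero_right]
      · rw [cumulant₂_eq_sub S _ _ hF₂, cumulant₂_eq_sub S _ _ hF₂, (moment₂_cyclicInv S).1]
        rw [annSum_finRotate_left hF, markSum_map hF hF₂ (finRotate (m + 1))
          (α := finRotate (m + 1)) (fun _ => rfl) a (Equiv.refl _) (β := finRotate (n + 1))
          (fun _ => rfl) b]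
        simp only [Equiv.refl_apply]
    · rintro (_ | m) (_ | n) a b rfl
      · rw [cumulant₂_zero_left, cumulant₂_zero_left]
      · rw [cumulant₂_zero_left, cumulant₂_zero_left]
      · rw [cumulant₂_zero_right, cumulant₂_zero_right]
      · rw [cumulant₂_eq_sub S _ _ hF₂, cumulant₂_eq_sub S _ _ hF₂, (moment₂_cyclicInv S).2]
        rw [annSum_finRotate_right hF, markSum_map hF hF₂ (Equiv.refl _)
          (α := finRotate (m + 1)) (fun _ => rfl) a (finRotate (n + 1)) (β := finRotate (n + 1))
          (fun _ => rfl) b]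
        simp only [Equiv.refl_apply]

theorem cumulant₂_cyclicInv (S : SecondOrderSpace A) : CyclicInv₂ (cumulant₂ S) :=
  ⟨fun m n a b => (cumulant₂_cyclicInv_aux S (m + n)).1 m n a b rfl,
    fun m n a b => (cumulant₂_cyclicInv_aux S (m + n)).2 m n a b rfl⟩

theorem moment₂_eq_annSum_add_markSum (S : SecondOrderSpace A) {m n : ℕ} (a : Fin (m + 1) → A)
    (b : Fin (n + 1) → A) :
    moment₂ S (m + 1) (n + 1) a b =
      annSum (twoCircles (m + 1) (n + 1)) (Sum.inl 0) (Sum.inr 0) (cumulant S) (Sum.elim a b) +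
      markSum (cumulant S) (cumulant₂ S) (finRotate (m + 1)) a (finRotate (n + 1)) b := by
  rw [← sum_markedNC_prod (cumulant_cyclicInv S) (cumulant₂_cyclicInv S),
    ← sum_annularNC_prod (cumulant_cyclicInv S)]
  exact fluctuation_eq_sum_cumulant₂ S m.succ_pos n.succ_pos a b

end CyclicInvariance

/-! ### Moment-cumulant formulas along the cycles of a permutation -/

section Decomposition

/-- A permutation is the direct sum of the cycle through a given point and of a permutation of
the remaining points. -/
theorem exists_cycle_decomposition {X : Type} [Finite X] (γ : Perm X) (x : X) :
    ∃ (n : ℕ) (Z : Type) (_ : Finite Z) (β : Perm Z) (e : Fin (n + 1) ⊕ Z ≃ X),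
      (∀ y, e (Perm.sumCongr (finRotate (n + 1)) β y) = γ (e y)) ∧ e (Sum.inl 0) = x := by
  have hpos : 0 < Function.minimalPeriod γ x := Function.minimalPeriod_pos_of_mem_periodicPts
    (Function.Injective.mem_periodicPts γ.injective x)
  obtain ⟨n, hn⟩ := Nat.exists_eq_succ_of_ne_zero hpos.ne'
  rw [Nat.succ_eq_add_one] at hn
  let f : Fin (n + 1) ⊕ {z // ¬ γ.SameCycle x z} → X :=
    Sum.elim (fun k => (γ ^ (k : ℕ)) x) Subtype.val
  have hf : Function.Bijective f := by
    constructor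
    · rintro (k | z) (l | w) h
      · have hk : (k : ℕ) ∈ Set.Iio (Function.minimalPeriod γ x) := by
          rw [hn]; exact k.2
        have hl : (l : ℕ) ∈ Set.Iio (Function.minimalPeriod γ x) := by
          rw [hn]; exact l.2
        simp only [f, Sum.elim_inl, Perm.coe_pow] at h
        exact congrArg _ (Fin.ext (Function.iterate_injOn_Iio_minimalPeriod hk hl h))
      · refine absurd ?_ w.2
        exact ⟨(k : ℕ), by simpa [f] using h⟩
      · refine absurd ?_ z.2
        exact ⟨(l : ℕ), by simpa [f] using h.symm⟩
      · exact congrArg _ (Subtype.ext h)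
    · intro z
      by_cases hz : γ.SameCycle x z
      · obtain ⟨i, rfl⟩ := hz.exists_nat_pow_eq
        refine ⟨Sum.inl ⟨i % Function.minimalPeriod γ x, ?_⟩, ?_⟩
        · rw [← hn]; exact Nat.mod_lt _ hpos
        · simp only [f, Sum.elim_inl, Perm.coe_pow]
          exact Function.iterate_mod_minimalPeriod_eq
      · exact ⟨Sum.inr ⟨z, hz⟩, rfl⟩
  refine ⟨n, {z // ¬ γ.SameCycle x z}, inferInstance,
    γ.subtypePerm (fun z => by rw [Perm.sameCycle_apply_right]), Equiv.ofBijective f hf, ?_, rfl⟩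
  rintro (k | z)
  · have := apply_finRotate (n := n + 1) (fun k => (γ ^ k) x)
      (by simp [← hn, pow_minimalPeriod_apply]) k
    simp only [pow_succ', Perm.mul_apply] at this
    exact this
  · rfl

/-- Serves two purposes: permutations mixing the summands are excluded either geometrically, when
`γ` preserves the summands, or by freeness, when the summands carry letters from different
subalgebras. -/
theorem sum_perm_sum {Y Z : Type} [Finite Y] [Finite Z] {f : Perm (Y ⊕ Z) → ℂ}
    (hf : ∀ ρ, ¬ Invar ρ (Sum.elim (fun _ => True) fun _ => False : Y ⊕ Z → Prop) → f ρ = 0) :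
    ∑ ρ, f ρ = ∑ σ : Perm Y, ∑ τ : Perm Z, f (Perm.sumCongr σ τ) := by
  classical
  rw [← Fintype.sum_prod_type' (f := fun (σ : Perm Y) (τ : Perm Z) => f (Perm.sumCongr σ τ))]
  refine (Finset.sum_of_injOn (fun p : Perm Y × Perm Z => Perm.sumCongr p.1 p.2) ?_ ?_ ?_ ?_).symm
  · rintro ⟨σ, τ⟩ _ ⟨σ', τ'⟩ _ h
    obtain ⟨rfl, rfl⟩ := sumCongr_inj h
    rfl
  · simp
  · intro ρ _ hρ
    refine hf ρ fun h => hρ ?_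
    obtain ⟨σ, τ, rfl⟩ := exists_eq_sumCongr h
    exact ⟨(σ, τ), by simp, rfl⟩
  · intros; rfl

end Decomposition

/-! ### Evaluation along the cycles of a direct sum -/

section DirectSum

variable {A : Type*} {Y Z : Type}

theorem ev_sumCongr_inl (F : ∀ n, (Fin n → A) → ℂ) (σ : Perm Y) (τ : Perm Z) (a : Y ⊕ Z → A)
    (y : Y) : ev F (Perm.sumCongr σ τ) a (Sum.inl y) = ev F σ (fun y => a (Sum.inl y)) y :=
  ev_map F Sum.inl_injective (fun _ => rfl) a y

theorem ev_sumCongr_inr (F : ∀ n, (Fin n → A) → ℂ) (σ : Perm Y) (τ : Perm Z) (a : Y ⊕ Z → A)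
    (z : Z) : ev F (Perm.sumCongr σ τ) a (Sum.inr z) = ev F τ (fun z => a (Sum.inr z)) z :=
  ev_map F Sum.inr_injective (fun _ => rfl) a z

theorem off_sumCongr_inl_inl (σ : Perm Y) (τ : Perm Z) (x : Y) (f : Y ⊕ Z → ℂ) (z : Y) :
    off (Perm.sumCongr σ τ) (Sum.inl x) f (Sum.inl z) = off σ x (fun y => f (Sum.inl y)) z := by
  by_cases h : σ.SameCycle x z
  · rw [off, off, if_pos (sameCycle_sumCongr_inl.mpr h), if_pos h]
  · rw [off, off, if_neg (fun h' => h (sameCycle_sumCongr_inl.mp h')), if_neg h]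

theorem off_sumCongr_inr_inr (σ : Perm Y) (τ : Perm Z) (x : Z) (f : Y ⊕ Z → ℂ) (z : Z) :
    off (Perm.sumCongr σ τ) (Sum.inr x) f (Sum.inr z) = off τ x (fun y => f (Sum.inr y)) z := by
  by_cases h : τ.SameCycle x z
  · rw [off, off, if_pos (sameCycle_sumCongr_inr.mpr h), if_pos h]
  · rw [off, off, if_neg (fun h' => h (sameCycle_sumCongr_inr.mp h')), if_neg h]

theorem off_sumCongr_inl_inr (σ : Perm Y) (τ : Perm Z) (x : Y) (f : Y ⊕ Z → ℂ) (z : Z) :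
    off (Perm.sumCongr σ τ) (Sum.inl x) f (Sum.inr z) = f (Sum.inr z) := by
  rw [off, if_neg not_sameCycle_sumCongr]

theorem off_sumCongr_inr_inl (σ : Perm Y) (τ : Perm Z) (x : Z) (f : Y ⊕ Z → ℂ) (z : Y) :
    off (Perm.sumCongr σ τ) (Sum.inr x) f (Sum.inl z) = f (Sum.inl z) := by
  rw [off, if_neg not_sameCycle_sumCongr']

theorem off_sumCongr_inl_comp_inl (σ : Perm Y) (τ : Perm Z) (x : Y) (f : Y ⊕ Z → ℂ) :
    (fun z => off (Perm.sumCongr σ τ) (Sum.inl x) f (Sum.inl z)) =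
      off σ x (fun y => f (Sum.inl y)) := funext fun _ => off_sumCongr_inl_inl _ _ _ _ _

theorem off_sumCongr_inr_comp_inr (σ : Perm Y) (τ : Perm Z) (x : Z) (f : Y ⊕ Z → ℂ) :
    (fun z => off (Perm.sumCongr σ τ) (Sum.inr x) f (Sum.inr z)) =
      off τ x (fun y => f (Sum.inr y)) := funext fun _ => off_sumCongr_inr_inr _ _ _ _ _

theorem off_of_forall_sameCycle {π : Perm Y} (h : ∀ x y, π.SameCycle x y) (x : Y) (f : Y → ℂ) :
    off π x f = fun _ => 1 := funext fun z => by rw [off, if_pos (h x z)]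

end DirectSum

/-! ### First order moment-cumulant formula for an arbitrary permutation -/

section FirstOrder

variable {A : Type*} {X Y Z : Type} [Finite X] [Finite Y] [Finite Z]

theorem cprod_ev_sumCongr {F : ∀ n, (Fin n → A) → ℂ} (hF : CyclicInv F) (σ : Perm Y) (τ : Perm Z)
    (a : Y ⊕ Z → A) :
    cprod (Perm.sumCongr σ τ) (ev F (Perm.sumCongr σ τ) a) =
      cprod σ (ev F σ fun y => a (Sum.inl y)) * cprod τ (ev F τ fun z => a (Sum.inr z)) := by
  rw [cprod_sumCongr σ τ (hF.ev_invar _ _)]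
  simp only [ev_sumCongr_inl, ev_sumCongr_inr]

theorem ncSum_sumCongr {F : ∀ n, (Fin n → A) → ℂ} (hF : CyclicInv F) (α : Perm Y) (β : Perm Z)
    (a : Y ⊕ Z → A) :
    ncSum (Perm.sumCongr α β) F a =
      ncSum α F (fun y => a (Sum.inl y)) * ncSum β F fun z => a (Sum.inr z) := by
  rw [ncSum, sum_perm_sum]
  · rw [ncSum, ncSum, Finset.sum_mul_sum]
    refine Finset.sum_congr rfl fun σ _ => Finset.sum_congr rfl fun τ _ => ?_
    rw [isNC_sumCongr, ind_and, cprod_ev_sumCongr hF]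
    ring
  · intro ρ hρ
    rw [ind_of_not fun h : IsNC (Perm.sumCongr α β) ρ =>
      hρ (h.invar (invar_sumCongr_isLeft α β)), zero_mul]

/-- Both joined cycles lie in the first summand, so its indicator agrees at the two base points and
is preserved by every annular permutation. -/
theorem annSum_sumCongr {F : ∀ n, (Fin n → A) → ℂ} (hF : CyclicInv F) {α : Perm Y} (β : Perm Z)
    {x y : Y} (hxy : ¬ α.SameCycle x y) (a : Y ⊕ Z → A) :
    annSum (Perm.sumCongr α β) (Sum.inl x) (Sum.inl y) F a =
      annSum α x y F (fun y => a (Sum.inl y)) * ncSum β F fun z => a (Sum.inr z) := by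
  rw [annSum, sum_perm_sum]
  · rw [annSum, ncSum, Finset.sum_mul_sum]
    refine Finset.sum_congr rfl fun σ _ => Finset.sum_congr rfl fun τ _ => ?_
    rw [isAnn_sumCongr hxy, ind_and, cprod_ev_sumCongr hF]
    ring
  · intro ρ hρ
    have hxy' : ¬ (Perm.sumCongr α β).SameCycle (Sum.inl x) (Sum.inl y) := by
      rwa [sameCycle_sumCongr_inl]
    rw [ind_of_not fun h : IsAnn (Perm.sumCongr α β) ρ (Sum.inl x) (Sum.inl y) =>
      hρ (h.invar hxy' (invar_sumCongr_isLeft α β) rfl), zero_mul]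

theorem cprod_of_sameCycle {π : Perm X} (h : ∀ x y, π.SameCycle x y) {f : X → ℂ} (hf : Invar π f)
    (x : X) : cprod π f = f x := by
  have : Subsingleton (Cyc π) := ⟨fun c d => by
    rw [← c.mk_rep, ← d.mk_rep, Cyc.mk_eq_mk]
    exact h _ _⟩
  rw [cprod, Fintype.prod_subsingleton _ (Cyc.mk π x), hf.rep]

theorem minimalPeriod_finRotate {n : ℕ} (i : Fin n) :
    Function.minimalPeriod (finRotate n) i = n := cycleLen_finRotate i

theorem sigma_word_finRotate {n : ℕ} (a : Fin (n + 1) → A) :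
    (⟨Function.minimalPeriod (finRotate (n + 1)) 0,
      fun k => a ((finRotate (n + 1) ^ (k : ℕ)) 0)⟩ : Σ k, Fin k → A) = ⟨n + 1, a⟩ :=
  cycleWord_finRotate a

theorem ev_finRotate (F : ∀ n, (Fin n → A) → ℂ) {n : ℕ} (a : Fin (n + 1) → A) :
    ev F (finRotate (n + 1)) a 0 = F (n + 1) a :=
  congrArg (fun x : Σ k, Fin k → A => F x.1 x.2) (sigma_word_finRotate a)

theorem ev₂_finRotate (F : ∀ m n, (Fin m → A) → (Fin n → A) → ℂ) {m n : ℕ}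
    (a : Fin (m + 1) → A) (b : Fin (n + 1) → A) :
    ev₂ F (finRotate (m + 1)) a 0 (finRotate (n + 1)) b 0 = F (m + 1) (n + 1) a b :=
  congrArg₂ (fun x y : Σ k, Fin k → A => F x.1 y.1 x.2 y.2) (sigma_word_finRotate a)
    (sigma_word_finRotate b)

theorem ncSum_of_isEmpty [IsEmpty X] (γ : Perm X) (F : ∀ n, (Fin n → A) → ℂ) (a : X → A) :
    ncSum γ F a = 1 := by
  have h : ∀ ρ : Perm X, ncyc ρ = 0 := fun ρ => by
    have := ncyc_le ρ
    simpa using this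
  rw [ncSum, Fintype.sum_subsingleton _ γ, ind_of (by simp [IsNC, h]), one_mul, cprod]
  have : IsEmpty (Cyc γ) := ⟨fun c => isEmptyElim c.rep⟩
  exact Finset.prod_of_isEmpty _

variable [Ring A] [StarRing A] [Algebra ℂ A] [StarModule ℂ A]

/-- The moment-cumulant formula of first order along the cycles of a permutation. -/
theorem cprod_moment (S : SecondOrderSpace A) (γ : Perm X) (a : X → A) :
    cprod γ (ev (moment S) γ a) = ncSum γ (cumulant S) a := by
  obtain ⟨N, hN⟩ : ∃ N, N = Nat.card X := ⟨_, rfl⟩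
  induction N using Nat.strong_induction_on generalizing X with
  | _ N ih =>
    rcases isEmpty_or_nonempty X with hX | ⟨⟨x⟩⟩
    · rw [ncSum_of_isEmpty, cprod]
      have : IsEmpty (Cyc γ) := ⟨fun c => isEmptyElim c.rep⟩
      exact Finset.prod_of_isEmpty _
    -- One cycle is split off: both sides factor, the cycle contributes the ordinary moment-cumulant
    -- formula, and the remainder has fewer points.
    · obtain ⟨n, Z, hZ, β, e, he, -⟩ := exists_cycle_decomposition γ x
      have hlt : Nat.card Z < N := by
        rw [hN, ← Nat.card_congr e, Nat.card_sum]
        simp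
      rw [cprod_ev_map (moment_cyclicInv S) e he, ncSum_map (cumulant_cyclicInv S) e he,
        cprod_ev_sumCongr (moment_cyclicInv S), ncSum_sumCongr (cumulant_cyclicInv S),
        ih _ hlt β _ rfl, cprod_of_sameCycle finRotate_sameCycle
          ((moment_cyclicInv S).ev_invar _ _) 0, ev_finRotate, moment_eq_ncSum]

end FirstOrder

/-! ### Second order moment-cumulant formula for two marked cycles of a permutation -/

section SecondOrderFormula

variable {A : Type*} {X Y Z : Type} [Finite X] [Finite Y] [Finite Z]

/-- The multiplicative extension for a permutation with two marked cycles. -/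
noncomputable def pairTerm (F : ∀ n, (Fin n → A) → ℂ)
    (F₂ : ∀ m n, (Fin m → A) → (Fin n → A) → ℂ) (σ : Perm X) (a : X → A) (x y : X) : ℂ :=
  ev₂ F₂ σ a x σ a y * cprod σ (off σ x (off σ y (ev F σ a)))

/-- The sum of the multiplicative extension over permutations that are non-crossing in the cycles
of `γ`, with a marked cycle in each of the cycles of `γ` through `x` and `y`. -/
noncomputable def pairSum (γ : Perm X) (x y : X) (F : ∀ n, (Fin n → A) → ℂ)
    (F₂ : ∀ m n, (Fin m → A) → (Fin n → A) → ℂ) (a : X → A) : ℂ :=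
  ∑ σ : Perm X, ind (IsNC γ σ) * ∑ c : Cyc σ, ∑ d : Cyc σ,
    ind (γ.SameCycle x c.rep) * ind (γ.SameCycle y d.rep) * pairTerm F F₂ σ a c.rep d.rep

theorem pairTerm_invar_left {F : ∀ n, (Fin n → A) → ℂ}
    {F₂ : ∀ m n, (Fin m → A) → (Fin n → A) → ℂ} (hF₂ : CyclicInv₂ F₂) (σ : Perm X) (a : X → A)
    (y : X) : Invar σ (fun x => pairTerm F F₂ σ a x y) := fun x => by
  have h1 := hF₂.ev₂_invar_left σ a σ a y x
  have h2 := cprod_off_invar (off σ y (ev F σ a)) σ x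
  simp only [pairTerm] at *
  rw [h1, h2]

theorem pairTerm_invar_right {F : ∀ n, (Fin n → A) → ℂ}
    {F₂ : ∀ m n, (Fin m → A) → (Fin n → A) → ℂ} (hF₂ : CyclicInv₂ F₂) (σ : Perm X) (a : X → A)
    (x : X) : Invar σ (fun y => pairTerm F F₂ σ a x y) := fun y => by
  have h1 := hF₂.ev₂_invar_right σ a x σ a y
  simp only [pairTerm] at *
  rw [h1, off_congr σ (Perm.sameCycle_apply_left.mpr (Perm.SameCycle.refl σ y))]

theorem pairTerm_map {F : ∀ n, (Fin n → A) → ℂ} (hF : CyclicInv F)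
    {F₂ : ∀ m n, (Fin m → A) → (Fin n → A) → ℂ} (e : X ≃ Y) {σ : Perm X} {τ : Perm Y}
    (he : ∀ x, e (σ x) = τ (e x)) (a : Y → A) (x y : X) :
    pairTerm F F₂ τ a (e x) (e y) = pairTerm F F₂ σ (fun x => a (e x)) x y := by
  rw [pairTerm, pairTerm, ev₂_map F₂ e.injective he a x e.injective he a y,
    cprod_map e he (((hF.ev_invar _ _).off _).off _)]
  congr 1
  refine cprod_congr fun z => ?_
  rw [off_map he]
  congr 1
  funext z
  rw [off_map he]
  congr 1
  exact funext fun z => ev_map F e.injective he a z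

/-- The summands of `pairSum` depend on the cycles only. -/
theorem IsNC.pairTerm_invar_left {F : ∀ n, (Fin n → A) → ℂ}
    {F₂ : ∀ m n, (Fin m → A) → (Fin n → A) → ℂ} (hF₂ : CyclicInv₂ F₂) {γ σ : Perm X}
    (h : IsNC γ σ) (a : X → A) (x : X) (k : ℂ) (w : X) : Invar σ (fun z =>
      ind (γ.SameCycle x z) * k * pairTerm F F₂ σ a z w) := fun z => by
  have h1 := h.invar (invar_sameCycle γ x) z
  have h2 := SecondOrder.pairTerm_invar_left hF₂ (F := F) σ a w z
  simp only at *
  rw [h1, h2]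

theorem IsNC.pairTerm_invar_right {F : ∀ n, (Fin n → A) → ℂ}
    {F₂ : ∀ m n, (Fin m → A) → (Fin n → A) → ℂ} (hF₂ : CyclicInv₂ F₂) {γ σ : Perm X}
    (h : IsNC γ σ) (a : X → A) (y w : X) (k : ℂ) : Invar σ (fun z =>
      k * ind (γ.SameCycle y z) * pairTerm F F₂ σ a w z) := fun z => by
  have h1 := h.invar (invar_sameCycle γ y) z
  have h2 := SecondOrder.pairTerm_invar_right hF₂ (F := F) σ a w z
  simp only at *
  rw [h1, h2]

theorem pairSum_map {F : ∀ n, (Fin n → A) → ℂ} (hF : CyclicInv F)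
    {F₂ : ∀ m n, (Fin m → A) → (Fin n → A) → ℂ} (hF₂ : CyclicInv₂ F₂) (e : X ≃ Y) {γ : Perm X}
    {γ' : Perm Y} (he : ∀ x, e (γ x) = γ' (e x)) (a : Y → A) (x y : X) :
    pairSum γ' (e x) (e y) F F₂ a = pairSum γ x y F F₂ fun x => a (e x) := by
  refine (Fintype.sum_equiv e.permCongr _ _ fun σ => ?_).symm
  have h1 := permCongr_semiconj e σ
  rw [isNC_map e he h1]
  by_cases h : IsNC γ σ
  · have h' := (isNC_map e he h1).mpr h
    rw [csum_csum_map e h1 e h1 (f := fun z w => ind (γ'.SameCycle (e x) z) *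
      ind (γ'.SameCycle (e y) w) * pairTerm F F₂ (e.permCongr σ) a z w)
      (fun w => h'.pairTerm_invar_left hF₂ a _ _ w)
      (fun z => h'.pairTerm_invar_right hF₂ a _ _ _)]
    simp only [pairTerm_map hF e h1 a, sameCycle_map_iff he]
  · rw [ind_of_not h, zero_mul, zero_mul]

/-- Double sums over the cycles of a direct sum. -/
theorem csum_csum_sumCongr (σ : Perm Y) (τ : Perm Z) {f : Y ⊕ Z → Y ⊕ Z → ℂ}
    (hf : ∀ y, Invar (Perm.sumCongr σ τ) fun x => f x y)
    (hf' : ∀ x, Invar (Perm.sumCongr σ τ) (f x)) :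
    ∑ c : Cyc (Perm.sumCongr σ τ), ∑ d : Cyc (Perm.sumCongr σ τ), f c.rep d.rep =
      ∑ c : Cyc σ, ∑ d : Cyc σ, f (Sum.inl c.rep) (Sum.inl d.rep) +
      ∑ c : Cyc σ, ∑ d : Cyc τ, f (Sum.inl c.rep) (Sum.inr d.rep) +
      ∑ c : Cyc τ, ∑ d : Cyc σ, f (Sum.inr c.rep) (Sum.inl d.rep) +
      ∑ c : Cyc τ, ∑ d : Cyc τ, f (Sum.inr c.rep) (Sum.inr d.rep) := by
  rw [csum_sumCongr σ τ (f := fun x => ∑ d : Cyc (Perm.sumCongr σ τ), f x d.rep)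
    fun x => Finset.sum_congr rfl fun d _ => hf d.rep x]
  simp only [csum_sumCongr σ τ (hf' _), Finset.sum_add_distrib]
  ring

theorem pairTerm_sumCongr_inl_inl {F : ∀ n, (Fin n → A) → ℂ} (hF : CyclicInv F)
    {F₂ : ∀ m n, (Fin m → A) → (Fin n → A) → ℂ} (σ : Perm Y) (τ : Perm Z) (a : Y ⊕ Z → A)
    (x y : Y) : pairTerm F F₂ (Perm.sumCongr σ τ) a (Sum.inl x) (Sum.inl y) =
      pairTerm F F₂ σ (fun y => a (Sum.inl y)) x y *
        cprod τ (ev F τ fun z => a (Sum.inr z)) := by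
  rw [pairTerm, pairTerm, ev₂_map F₂ (π := σ) (e := Sum.inl) Sum.inl_injective (fun _ => rfl) a x
    (π' := σ) (e' := Sum.inl) Sum.inl_injective (fun _ => rfl) a y,
    cprod_sumCongr σ τ (((hF.ev_invar _ _).off _).off _), ← mul_assoc]
  simp only [off_sumCongr_inl_comp_inl, off_sumCongr_inl_inr, ev_sumCongr_inr, ev_sumCongr_inl]

theorem pairTerm_sumCongr_inr_inr {F : ∀ n, (Fin n → A) → ℂ} (hF : CyclicInv F)
    {F₂ : ∀ m n, (Fin m → A) → (Fin n → A) → ℂ} (σ : Perm Y) (τ : Perm Z) (a : Y ⊕ Z → A)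
    (x y : Z) : pairTerm F F₂ (Perm.sumCongr σ τ) a (Sum.inr x) (Sum.inr y) =
      cprod σ (ev F σ fun z => a (Sum.inl z)) *
        pairTerm F F₂ τ (fun y => a (Sum.inr y)) x y := by
  rw [pairTerm, pairTerm, ev₂_map F₂ (π := τ) (e := Sum.inr) Sum.inr_injective (fun _ => rfl) a x
    (π' := τ) (e' := Sum.inr) Sum.inr_injective (fun _ => rfl) a y,
    cprod_sumCongr σ τ (((hF.ev_invar _ _).off _).off _), ← mul_assoc]
  simp only [off_sumCongr_inr_comp_inr, off_sumCongr_inr_inl, ev_sumCongr_inr, ev_sumCongr_inl]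
  ring

theorem pairTerm_sumCongr_inl_inr {F : ∀ n, (Fin n → A) → ℂ} (hF : CyclicInv F)
    {F₂ : ∀ m n, (Fin m → A) → (Fin n → A) → ℂ} (σ : Perm Y) (τ : Perm Z) (a : Y ⊕ Z → A)
    (x : Y) (y : Z) : pairTerm F F₂ (Perm.sumCongr σ τ) a (Sum.inl x) (Sum.inr y) =
      markTerm F F₂ σ (fun y => a (Sum.inl y)) x τ (fun y => a (Sum.inr y)) y := by
  rw [pairTerm, markTerm, ev₂_map F₂ (π := σ) (e := Sum.inl) Sum.inl_injective (fun _ => rfl) a x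
    (π' := τ) (e' := Sum.inr) Sum.inr_injective (fun _ => rfl) a y,
    cprod_sumCongr σ τ (((hF.ev_invar _ _).off _).off _), ← mul_assoc]
  simp only [off_sumCongr_inl_comp_inl, off_sumCongr_inl_inr, off_sumCongr_inr_inl,
    off_sumCongr_inr_comp_inr, ev_sumCongr_inr, ev_sumCongr_inl]

theorem pairSum_sumCongr_inl_inl {F : ∀ n, (Fin n → A) → ℂ} (hF : CyclicInv F)
    {F₂ : ∀ m n, (Fin m → A) → (Fin n → A) → ℂ} (hF₂ : CyclicInv₂ F₂) (α : Perm Y) (β : Perm Z)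
    (a : Y ⊕ Z → A) (x y : Y) :
    pairSum (Perm.sumCongr α β) (Sum.inl x) (Sum.inl y) F F₂ a =
      pairSum α x y F F₂ (fun y => a (Sum.inl y)) * ncSum β F fun z => a (Sum.inr z) := by
  rw [pairSum, sum_perm_sum]
  · rw [pairSum, ncSum, Finset.sum_mul_sum]
    refine Finset.sum_congr rfl fun σ _ => Finset.sum_congr rfl fun τ _ => ?_
    by_cases h : IsNC (Perm.sumCongr α β) (Perm.sumCongr σ τ)
    · rw [csum_csum_sumCongr σ τ (f := fun z w =>
        ind ((Perm.sumCongr α β).SameCycle (Sum.inl x) z) *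
          ind ((Perm.sumCongr α β).SameCycle (Sum.inl y) w) *
          pairTerm F F₂ (Perm.sumCongr σ τ) a z w)
        (fun w => h.pairTerm_invar_left hF₂ a _ _ w)
        (fun z => h.pairTerm_invar_right hF₂ a _ _ _)]
      simp only [ind_of_not (not_sameCycle_sumCongr), mul_zero, zero_mul,
        Finset.sum_const_zero, add_zero, sameCycle_sumCongr_inl, pairTerm_sumCongr_inl_inl hF]
      rw [isNC_sumCongr, ind_and]
      simp only [← mul_assoc, ← Finset.sum_mul]
      ring
    · rw [ind_of_not h]
      rw [isNC_sumCongr] at h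
      rw [zero_mul, mul_mul_mul_comm, ← ind_and, ind_of_not h, zero_mul]
  · intro ρ hρ
    rw [ind_of_not fun h : IsNC (Perm.sumCongr α β) ρ =>
      hρ (h.invar (invar_sumCongr_isLeft α β)), zero_mul]

theorem pairSum_sumCongr_inl_inr {F : ∀ n, (Fin n → A) → ℂ} (hF : CyclicInv F)
    {F₂ : ∀ m n, (Fin m → A) → (Fin n → A) → ℂ} (hF₂ : CyclicInv₂ F₂) {α : Perm Y} {β : Perm Z}
    (hα : ∀ x y, α.SameCycle x y) (hβ : ∀ x y, β.SameCycle x y)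
    (a : Y ⊕ Z → A) (x : Y) (y : Z) :
    pairSum (Perm.sumCongr α β) (Sum.inl x) (Sum.inr y) F F₂ a =
      markSum F F₂ α (fun y => a (Sum.inl y)) β fun z => a (Sum.inr z) := by
  rw [pairSum, sum_perm_sum]
  · rw [markSum]
    refine Finset.sum_congr rfl fun σ _ => Finset.sum_congr rfl fun τ _ => ?_
    by_cases h : IsNC (Perm.sumCongr α β) (Perm.sumCongr σ τ)
    · rw [csum_csum_sumCongr σ τ (f := fun z w =>
        ind ((Perm.sumCongr α β).SameCycle (Sum.inl x) z) *
          ind ((Perm.sumCongr α β).SameCycle (Sum.inr y) w) *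
          pairTerm F F₂ (Perm.sumCongr σ τ) a z w)
        (fun w => h.pairTerm_invar_left hF₂ a _ _ w)
        (fun z => h.pairTerm_invar_right hF₂ a _ _ _)]
      simp only [ind_of_not (not_sameCycle_sumCongr), ind_of_not (not_sameCycle_sumCongr'),
        mul_zero, zero_mul, Finset.sum_const_zero, add_zero, zero_add, sameCycle_sumCongr_inl,
        sameCycle_sumCongr_inr, pairTerm_sumCongr_inl_inr hF, ind_of (hα _ _), ind_of (hβ _ _),
        one_mul]
      rw [isNC_sumCongr, ind_and]
    · rw [ind_of_not h]
      rw [isNC_sumCongr] at h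
      rw [zero_mul, ← ind_and, ind_of_not h, zero_mul]
  · intro ρ hρ
    rw [ind_of_not fun h : IsNC (Perm.sumCongr α β) ρ =>
      hρ (h.invar (invar_sumCongr_isLeft α β)), zero_mul]

variable [Ring A] [StarRing A] [Algebra ℂ A] [StarModule ℂ A]

/-- The moment-cumulant formula of second order along the cycles of a permutation. -/
theorem pairTerm_moment (S : SecondOrderSpace A) (γ : Perm X) {x y : X}
    (hxy : ¬ γ.SameCycle x y) (a : X → A) :
    pairTerm (moment S) (moment₂ S) γ a x y =
      annSum γ x y (cumulant S) a + pairSum γ x y (cumulant S) (cumulant₂ S) a := by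
  have hF := cumulant_cyclicInv S
  have hF₂ := cumulant₂_cyclicInv S
  -- Splitting off the cycle through `x` and then the one through `y` turns `γ` into two circles and
  -- a remainder. The remainder contributes the same first order factor to every term.
  obtain ⟨m, Z, hZ, β, e, he, rfl⟩ := exists_cycle_decomposition γ x
  obtain ⟨y | z, rfl⟩ := e.surjective y
  · refine absurd (sameCycle_map he ?_) hxy
    exact sameCycle_sumCongr_inl.mpr (finRotate_sameCycle _ _)
  obtain ⟨n, W, hW, β', e', he', rfl⟩ := exists_cycle_decomposition β z
  let f : (Fin (m + 1) ⊕ Fin (n + 1)) ⊕ W ≃ X :=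
    (Equiv.sumAssoc _ _ _).trans ((Equiv.sumCongr (Equiv.refl _) e').trans e)
  have hf : ∀ w, f (Perm.sumCongr (twoCircles (m + 1) (n + 1)) β' w) = γ (f w) := by
    rintro ((w | w) | w)
    · exact he (Sum.inl w)
    · refine Eq.trans ?_ (he (Sum.inr (e' (Sum.inl w))))
      exact congrArg (fun z => e (Sum.inr z)) (he' (Sum.inl w))
    · refine Eq.trans ?_ (he (Sum.inr (e' (Sum.inr w))))
      exact congrArg (fun z => e (Sum.inr z)) (he' (Sum.inr w))
  have h1 : e (Sum.inl 0) = f (Sum.inl (Sum.inl 0)) := rfl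
  have h2 : e (Sum.inr (e' (Sum.inl 0))) = f (Sum.inl (Sum.inr 0)) := rfl
  rw [h1, h2, pairTerm_map (moment_cyclicInv S) f hf, annSum_map hF f hf, pairSum_map hF hF₂ f hf,
    pairTerm_sumCongr_inl_inl (moment_cyclicInv S), annSum_sumCongr hF _ not_sameCycle_sumCongr,
    pairSum_sumCongr_inl_inl hF hF₂, cprod_moment, ← add_mul]
  congr 1
  rw [pairTerm_sumCongr_inl_inr (moment_cyclicInv S), pairSum_sumCongr_inl_inr hF hF₂
    finRotate_sameCycle finRotate_sameCycle, markTerm, ev₂_finRotate,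
    moment₂_eq_annSum_add_markSum, off_of_forall_sameCycle finRotate_sameCycle,
    off_of_forall_sameCycle finRotate_sameCycle, cprod_one, cprod_one, mul_one, mul_one]
  congr 2
  funext w
  rcases w with w | w <;> rfl

end SecondOrderFormula

/-! ### Permutations of two alternating families of letters -/

section Doubling

variable {X : Type}

theorem sameCycle_dbl_one_inl {γ : Perm X} {x z : X} :
    (dbl 1 γ).SameCycle (Sum.inl x) (Sum.inl z) ↔ γ.SameCycle x z := by
  rw [sameCycle_dbl_inl, mul_one]

theorem sameCycle_dbl_one_inr {γ : Perm X} {x z : X} :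
    (dbl 1 γ).SameCycle (Sum.inl x) (Sum.inr z) ↔ γ.SameCycle x z := by
  have : (Sum.inr z : X ⊕ X) = dbl 1 γ (Sum.inl z) := rfl
  rw [this, Perm.sameCycle_apply_right, sameCycle_dbl_one_inl]

theorem sumCongr_inv_mul_dbl (π σ γ : Perm X) :
    (Perm.sumCongr π σ)⁻¹ * dbl 1 γ = dbl σ⁻¹ (π⁻¹ * γ) := by
  ext x
  rcases x with x | x <;> rfl

/-- The complement of `π ⊕ σ` in the doubled permutation again exchanges the two copies, so its
cycles are those of its square on one copy, up to conjugation. -/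
theorem ncyc_sumCongr_inv_mul_dbl (π σ γ : Perm X) :
    ncyc ((Perm.sumCongr π σ)⁻¹ * dbl 1 γ) = ncyc (σ⁻¹ * (π⁻¹ * γ)) := by
  rw [sumCongr_inv_mul_dbl, ncyc_dbl]
  exact (ncyc_map (π := π⁻¹ * γ * σ⁻¹) (ρ := σ⁻¹ * (π⁻¹ * γ)) σ⁻¹ fun x => rfl).symm

/-- An invariant function of `dbl 1 γ` takes the same value on both copies of a point, so it amounts
to a single function on `X`. -/
theorem joined_dbl {π σ γ : Perm X} {x y : X} :
    Joined (Perm.sumCongr π σ) (dbl 1 γ) (Sum.inl x) (Sum.inl y) ↔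
      ∀ h : X → ℚ, Invar π h → Invar σ h → Invar γ h → h x = h y := by
  constructor
  · intro hj h h1 h2 h3
    refine hj (Sum.elim h h) ?_ ?_
    · rintro (z | z)
      · exact h1 z
      · exact h2 z
    · rintro (z | z)
      · rfl
      · exact h3 z
  · intro hj f hf1 hf2
    have h0 : ∀ z, f (Sum.inr z) = f (Sum.inl z) := fun z => hf2 (Sum.inl z)
    refine hj (fun z => f (Sum.inl z)) (fun z => hf1 (Sum.inl z)) (fun z => ?_) (fun z => ?_)
    · show f (Sum.inl (σ z)) = f (Sum.inl z)
      rw [← h0, ← h0]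
      exact hf1 (Sum.inr z)
    · show f (Sum.inl (γ z)) = f (Sum.inl z)
      rw [← h0 z]
      exact hf2 (Sum.inr z)

/-- If `π` does not connect the two cycles of `γ`, then the cycles of `γ` are invariant. -/
theorem invar_of_not_joined {π γ : Perm X} {x y : X} (hcov : ∀ z, γ.SameCycle x z ∨ γ.SameCycle y z)
    (hj : ¬ Joined π γ x y) : Invar π fun z => γ.SameCycle x z := by
  simp only [Joined, not_forall] at hj
  obtain ⟨f, hf1, hf2, hne⟩ := hj
  have h : ∀ z, γ.SameCycle x z ↔ f z = f x := by
    intro z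
    constructor
    · exact fun h => (hf2.sameCycle h).symm
    · intro h
      rcases hcov z with h1 | h1
      · exact h1
      · exact absurd ((hf2.sameCycle h1).trans h).symm hne
  intro z
  simp only [h, hf1 z]

variable [Finite X]

/-- The triangle inequalities for `π` in `γ` and for `σ` in `π⁻¹ γ` add up to the one for `π ⊕ σ`,
the terms `ncyc (π⁻¹ * γ)` cancelling. Equality in the sum means equality in both. -/
theorem isNC_dbl {π σ γ : Perm X} :
    IsNC (dbl 1 γ) (Perm.sumCongr π σ) ↔ IsNC γ π ∧ IsNC (π⁻¹ * γ) σ := by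
  have h1 := ncyc_add_le_card π γ
  have h2 := ncyc_add_le_card σ (π⁻¹ * γ)
  rw [IsNC, IsNC, IsNC, ncyc_sumCongr_inv_mul_dbl, ncyc_sumCongr, ncyc_dbl, mul_one, Nat.card_sum]
  omega

theorem isAnn_dbl_iff {π σ γ : Perm X} {x y : X} :
    IsAnn (dbl 1 γ) (Perm.sumCongr π σ) (Sum.inl x) (Sum.inl y) ↔
      ncyc π + ncyc σ + ncyc (σ⁻¹ * (π⁻¹ * γ)) + 2 = Nat.card X + Nat.card X + ncyc γ ∧
      ∀ h : X → ℚ, Invar π h → Invar σ h → Invar γ h → h x = h y := by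
  rw [IsAnn, ncyc_sumCongr_inv_mul_dbl, ncyc_sumCongr, ncyc_dbl, mul_one, Nat.card_sum, joined_dbl]

/-- If `π` itself joins the circles, it uses up the whole defect of two and `σ` must be
non-crossing. -/
theorem isAnn_dbl_of_joined {π σ γ : Perm X} {x y : X} (hxy : ¬ γ.SameCycle x y)
    (hj : Joined π γ x y) :
    IsAnn (dbl 1 γ) (Perm.sumCongr π σ) (Sum.inl x) (Sum.inl y) ↔
      IsAnn γ π x y ∧ IsNC (π⁻¹ * γ) σ := by
  have h1 := ncyc_add_two_le_of_joined hxy hj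
  have h2 := ncyc_add_le_card σ (π⁻¹ * γ)
  have h3 : ∀ h : X → ℚ, Invar π h → Invar σ h → Invar γ h → h x = h y :=
    fun h h1 _ h3 => hj h h1 h3
  rw [isAnn_dbl_iff, IsAnn, IsNC]
  constructor
  · rintro ⟨h4, -⟩
    refine ⟨⟨?_, hj⟩, ?_⟩ <;> omega
  · rintro ⟨⟨h4, -⟩, h5⟩
    refine ⟨?_, h3⟩
    omega

theorem isAnn_dbl_of_isNC {π σ γ : Perm X} {x y c d : X} (hπ : IsNC γ π)
    (hc : γ.SameCycle x c) (hd : γ.SameCycle y d) (hσ : IsAnn (π⁻¹ * γ) σ c d) :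
    IsAnn (dbl 1 γ) (Perm.sumCongr π σ) (Sum.inl x) (Sum.inl y) := by
  rw [isAnn_dbl_iff]
  obtain ⟨h1, h2⟩ := hσ
  rw [IsNC] at hπ
  refine ⟨by omega, fun h h3 h4 h5 => ?_⟩
  rw [h5.sameCycle hc, h5.sameCycle hd]
  exact h2 h h4 (h3.inv.mul h5)

/-- If `π` does not join the circles, then `σ` must do so. It uses up the defect of two by joining
two cycles of the complement `π⁻¹ γ`, and `π` is left non-crossing. -/
theorem exists_of_isAnn_dbl {π σ γ : Perm X} {x y : X} (hxy : ¬ γ.SameCycle x y)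
    (hcov : ∀ z, γ.SameCycle x z ∨ γ.SameCycle y z) (hj : ¬ Joined π γ x y)
    (h : IsAnn (dbl 1 γ) (Perm.sumCongr π σ) (Sum.inl x) (Sum.inl y)) :
    IsNC γ π ∧ ∃ c d, γ.SameCycle x c ∧ γ.SameCycle y d ∧ IsAnn (π⁻¹ * γ) σ c d := by
  classical
  have hχπ := invar_of_not_joined hcov hj
  have hχγ := invar_sameCycle γ x
  have hχ := hχπ.inv.mul hχγ
  rw [isAnn_dbl_iff] at h
  obtain ⟨h1, h2⟩ := h
  -- Otherwise the indicator of the cycle of `γ` through `x` would be invariant under `π`, `σ` and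
  -- `γ`, yet separate `x` from `y`.
  have h3 : ∃ p, ¬ (γ.SameCycle x (σ p) ↔ γ.SameCycle x p) := by
    by_contra! hall
    have := h2 (fun z => if γ.SameCycle x z then 1 else 0)
      (fun z => by simp only [hχπ z]) (fun z => by simp only [hall z])
      (fun z => by simp only [hχγ z])
    simp [Perm.SameCycle.refl, hxy] at this
  obtain ⟨c, d, hc, hd, hcd⟩ : ∃ c d, γ.SameCycle x c ∧ ¬ γ.SameCycle x d ∧ σ.SameCycle c d := by
    obtain ⟨p, hp⟩ := h3
    by_cases hpx : γ.SameCycle x p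
    · exact ⟨p, σ p, hpx, fun h => hp (by simp [h, hpx]),
        Perm.sameCycle_apply_right.mpr (Perm.SameCycle.refl _ _)⟩
    · refine ⟨σ p, p, by tauto, hpx, Perm.sameCycle_apply_left.mpr (Perm.SameCycle.refl _ _)⟩
  have hjo : Joined σ (π⁻¹ * γ) c d := fun f hf1 _ => hf1.sameCycle hcd
  have hncd : ¬ (π⁻¹ * γ).SameCycle c d := fun h => hd ((hχ.sameCycle h).mp hc)
  have h4 := ncyc_add_two_le_of_joined hncd hjo
  have h5 := ncyc_add_le_card π γ
  refine ⟨?_, c, d, hc, (hcov d).resolve_left hd, ?_, hjo⟩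
  · rw [IsNC]; omega
  · omega

/-- The cycles that are connected by an annular non-crossing permutation are unique. -/
theorem IsAnn.sameCycle_unique {κ σ : Perm X} {c d c' d' : X} {χ : X → Prop} (hχ : Invar κ χ)
    (hc : χ c) (hd : ¬ χ d) (hc' : χ c') (hd' : ¬ χ d') (h : IsAnn κ σ c d)
    (h' : IsAnn κ σ c' d') : κ.SameCycle c c' ∧ κ.SameCycle d d' := by
  classical
  have hcd : ¬ κ.SameCycle c d := fun h => hd ((hχ.sameCycle h).mp hc)
  have hcd' : ¬ κ.SameCycle c' d' := fun h => hd' ((hχ.sameCycle h).mp hc')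
  have hdc' : ¬ κ.SameCycle d' c := fun h => hd' ((hχ.sameCycle h).mpr hc)
  have hcd'' : ¬ κ.SameCycle c' d := fun h => hd ((hχ.sameCycle h).mp hc')
  have h1 : ∀ z, Invar κ (fun w => if κ.SameCycle z w then (1 : ℚ) else 0) := fun z w => by simp
  constructor
  · by_contra hne
    have h2 : Invar σ (fun w => if κ.SameCycle c' w then (1 : ℚ) else 0) :=
      h.invar hcd (h1 c') (by
      rw [if_neg fun h => hne (Perm.SameCycle.symm h), if_neg hcd''])
    have := h'.2 _ h2 (h1 c')
    simp [hcd', Perm.SameCycle.refl] at this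
  · by_contra hne
    have h2 : Invar σ (fun w => if κ.SameCycle d' w then (1 : ℚ) else 0) :=
      h.invar hcd (h1 d') (by
      rw [if_neg hdc', if_neg fun h => hne (Perm.SameCycle.symm h)])
    have := h'.2 _ h2 (h1 d')
    rw [if_neg fun h => hcd' (Perm.SameCycle.symm h), if_pos (Perm.SameCycle.refl _ _)] at this
    exact zero_ne_one this

/-- The alternatives "`π` joins the circles" and "`σ` joins the circles" exclude each other. In the
second the joined cycles of the complement are unique, so the double sum has a single nonzero term
and nothing is counted twice. -/
theorem ind_isAnn_dbl {π σ γ : Perm X} {x y : X} (hxy : ¬ γ.SameCycle x y)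
    (hcov : ∀ z, γ.SameCycle x z ∨ γ.SameCycle y z) :
    ind (IsAnn (dbl 1 γ) (Perm.sumCongr π σ) (Sum.inl x) (Sum.inl y)) =
      ind (IsAnn γ π x y) * ind (IsNC (π⁻¹ * γ) σ) +
      ind (IsNC γ π) * ∑ c : Cyc (π⁻¹ * γ), ∑ d : Cyc (π⁻¹ * γ),
        ind (γ.SameCycle x c.rep) * ind (γ.SameCycle y d.rep) *
          ind (IsAnn (π⁻¹ * γ) σ c.rep d.rep) := by
  have hdis : ∀ z, γ.SameCycle y z → ¬ γ.SameCycle x z := fun z h h' => hxy (h'.trans h.symm)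
  by_cases hj : Joined π γ x y
  · have h1 : ¬ IsNC γ π := fun h => by
      have h1 := ncyc_add_two_le_of_joined hxy hj
      rw [IsNC] at h
      omega
    rw [ind_congr (isAnn_dbl_of_joined hxy hj), ind_and, ind_of_not h1, zero_mul, add_zero]
  · rw [ind_of_not (fun h : IsAnn γ π x y => hj h.2), zero_mul, zero_add]
    by_cases h : IsAnn (dbl 1 γ) (Perm.sumCongr π σ) (Sum.inl x) (Sum.inl y)
    · obtain ⟨hπ, c, d, hc, hd, hcd⟩ := exists_of_isAnn_dbl hxy hcov hj h
      have hχ := (invar_of_not_joined hcov hj).inv.mul (invar_sameCycle γ x)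
      rw [ind_of h, ind_of hπ, one_mul]
      have hc1 : γ.SameCycle x (Cyc.mk (π⁻¹ * γ) c).rep := (hχ.rep c).mpr hc
      have hd1 : ¬ γ.SameCycle x (Cyc.mk (π⁻¹ * γ) d).rep := fun h =>
        hdis d hd ((hχ.rep d).mp h)
      have hd2 := (hcov (Cyc.mk (π⁻¹ * γ) d).rep).resolve_left hd1
      have hcd1 := (isAnn_congr (Cyc.rep_sameCycle (π⁻¹ * γ) c).symm
        (Cyc.rep_sameCycle (π⁻¹ * γ) d).symm).mp hcd
      rw [Finset.sum_eq_single (Cyc.mk (π⁻¹ * γ) c), Finset.sum_eq_single (Cyc.mk (π⁻¹ * γ) d),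
        ind_of hc1, ind_of hd2, ind_of hcd1]
      · norm_num
      · intro e _ he
        rw [ind_of hc1, one_mul, ← ind_and, ind_of_not]
        rintro ⟨h3, h4⟩
        have := (IsAnn.sameCycle_unique hχ hc1 (hdis _ h3) hc1 hd1 h4 hcd1).2
        rw [← Cyc.mk_eq_mk, Cyc.mk_rep, Cyc.mk_rep] at this
        exact he this
      · simp
      · intro e _ he
        refine Finset.sum_eq_zero fun e' _ => ?_
        rw [← ind_and, ← ind_and, ind_of_not]
        rintro ⟨⟨h2, h3⟩, h4⟩
        have := (IsAnn.sameCycle_unique hχ h2 (hdis _ h3) hc1 hd1 h4 hcd1).1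
        rw [← Cyc.mk_eq_mk, Cyc.mk_rep, Cyc.mk_rep] at this
        exact he this
      · simp
    · rw [ind_of_not h]
      symm
      by_cases hπ : IsNC γ π
      · rw [Finset.sum_eq_zero, mul_zero]
        intro c _
        refine Finset.sum_eq_zero fun d _ => ?_
        rw [← ind_and, ← ind_and, ind_of_not]
        rintro ⟨⟨h2, h3⟩, h4⟩
        exact h (isAnn_dbl_of_isNC hπ h2 h3 h4)
      · rw [ind_of_not hπ, zero_mul]

end Doubling

/-! ### Vanishing of mixed cumulants -/

section Mixed

variable {A : Type*} [Ring A] [StarRing A] [Algebra ℂ A] [StarModule ℂ A] {X : Type}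
  {ι : Type*} {B : ι → Subalgebra ℂ A} {a : X → A} {j : X → ι}

theorem exists_pow_lt_minimalPeriod [Finite X] {ρ : Perm X} {x z : X} (h : ρ.SameCycle x z) :
    ∃ k < Function.minimalPeriod ρ x, (ρ ^ k) x = z := by
  have hpos : 0 < Function.minimalPeriod ρ x := Function.minimalPeriod_pos_of_mem_periodicPts
    (Function.Injective.mem_periodicPts ρ.injective x)
  obtain ⟨i, rfl⟩ := h.exists_nat_pow_eq
  refine ⟨i % Function.minimalPeriod ρ x, Nat.mod_lt _ hpos, ?_⟩
  simp only [Perm.coe_pow]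
  exact Function.iterate_mod_minimalPeriod_eq

theorem ev_cumulant_eq_zero [Finite X] {S : SecondOrderSpace A} (hfree : SecondOrderFree S B)
    (ha : ∀ x, a x ∈ B (j x)) {ρ : Perm X} {x z w : X} (hz : ρ.SameCycle x z)
    (hw : ρ.SameCycle x w) (hne : j z ≠ j w) : ev (cumulant S) ρ a x = 0 := by
  obtain ⟨k, hk, rfl⟩ := exists_pow_lt_minimalPeriod hz
  obtain ⟨l, hl, rfl⟩ := exists_pow_lt_minimalPeriod hw
  exact hfree.1 _ (fun k => j ((ρ ^ (k : ℕ)) x)) _ (fun k => ha _) ⟨⟨k, hk⟩, ⟨l, hl⟩, hne⟩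

theorem ev₂_cumulant₂_eq_zero [Finite X] {S : SecondOrderSpace A} (hfree : SecondOrderFree S B)
    (ha : ∀ x, a x ∈ B (j x)) {ρ : Perm X} {x y z w : X}
    (hz : ρ.SameCycle x z ∨ ρ.SameCycle y z) (hw : ρ.SameCycle x w ∨ ρ.SameCycle y w)
    (hne : j z ≠ j w) : ev₂ (cumulant₂ S) ρ a x ρ a y = 0 := by
  have hpos : ∀ x, 0 < Function.minimalPeriod ρ x := fun x =>
    Function.minimalPeriod_pos_of_mem_periodicPts
      (Function.Injective.mem_periodicPts ρ.injective x)
  have key : ∀ z, ρ.SameCycle x z ∨ ρ.SameCycle y z →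
      ∃ i : Fin (Function.minimalPeriod ρ x) ⊕ Fin (Function.minimalPeriod ρ y),
        Sum.elim (fun k : Fin _ => j ((ρ ^ (k : ℕ)) x)) (fun k : Fin _ => j ((ρ ^ (k : ℕ)) y)) i =
          j z := by
    rintro z (h | h)
    · obtain ⟨k, hk, rfl⟩ := exists_pow_lt_minimalPeriod h
      exact ⟨Sum.inl ⟨k, hk⟩, rfl⟩
    · obtain ⟨k, hk, rfl⟩ := exists_pow_lt_minimalPeriod h
      exact ⟨Sum.inr ⟨k, hk⟩, rfl⟩
  obtain ⟨i₁, h1⟩ := key z hz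
  obtain ⟨i₂, h2⟩ := key w hw
  exact hfree.2 _ _ (hpos x) (hpos y)
    (Sum.elim (fun k : Fin _ => j ((ρ ^ (k : ℕ)) x)) fun k : Fin _ => j ((ρ ^ (k : ℕ)) y)) _ _
    (fun k => ha _) (fun k => ha _)
    ⟨i₁, i₂, by rwa [h1, h2]⟩

theorem cprod_cumulant_eq_zero [Finite X] {S : SecondOrderSpace A} (hfree : SecondOrderFree S B)
    (ha : ∀ x, a x ∈ B (j x)) {ρ : Perm X} {z : X} (hne : j (ρ z) ≠ j z) :
    cprod ρ (ev (cumulant S) ρ a) = 0 :=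
  cprod_eq_zero ((cumulant_cyclicInv S).ev_invar _ _) (x := z)
    (ev_cumulant_eq_zero hfree ha (Perm.sameCycle_apply_right.mpr (Perm.SameCycle.refl _ _))
      (Perm.SameCycle.refl _ _) hne)

/-- The cycle on which the colour changes is either marked, and the second order cumulant is mixed,
or unmarked, and a first order factor is mixed. -/
theorem pairTerm_cumulant_eq_zero [Finite X] {S : SecondOrderSpace A} (hfree : SecondOrderFree S B)
    (ha : ∀ x, a x ∈ B (j x)) {ρ : Perm X} {z : X} (hne : j (ρ z) ≠ j z) (x y : X) :
    pairTerm (cumulant S) (cumulant₂ S) ρ a x y = 0 := by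
  have hz : ∀ x, ρ.SameCycle x z → ρ.SameCycle x (ρ z) := fun x h =>
    Perm.sameCycle_apply_right.mpr h
  rw [pairTerm]
  by_cases h1 : ρ.SameCycle x z
  · rw [ev₂_cumulant₂_eq_zero hfree ha (Or.inl (hz x h1)) (Or.inl h1) hne, zero_mul]
  by_cases h2 : ρ.SameCycle y z
  · rw [ev₂_cumulant₂_eq_zero hfree ha (Or.inr (hz y h2)) (Or.inr h2) hne, zero_mul]
  rw [cprod_eq_zero ((((cumulant_cyclicInv S).ev_invar _ _).off _).off _) (x := z), mul_zero]
  rw [off, if_neg h1, off, if_neg h2]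
  exact ev_cumulant_eq_zero hfree ha (Perm.sameCycle_apply_right.mpr (Perm.SameCycle.refl _ _))
      (Perm.SameCycle.refl _ _) hne

end Mixed

/-! ### Moments of products of free elements -/

section Products

variable {A : Type*} [Ring A] [StarRing A] [Algebra ℂ A] [StarModule ℂ A] {X : Type}
  {B : Fin 2 → Subalgebra ℂ A} {r v : X → A}

theorem elim_mem {A : Type*} [Ring A] [Algebra ℂ A] {B : Fin 2 → Subalgebra ℂ A} {r v : X → A}
    (hr : ∀ x, r x ∈ B 0) (hv : ∀ x, v x ∈ B 1) (x : X ⊕ X) :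
    Sum.elim r v x ∈ B (Sum.elim (fun _ => 0) (fun _ => 1) x) := by
  rcases x with x | x
  · exact hr x
  · exact hv x

theorem exists_ne_of_not_invar {ρ : Perm (X ⊕ X)}
    (h : ¬ Invar ρ (Sum.elim (fun _ => True) fun _ => False : X ⊕ X → Prop)) :
    ∃ z, (Sum.elim (fun _ => 0) (fun _ => 1) (ρ z) : Fin 2) ≠
      Sum.elim (fun _ => 0) (fun _ => 1) z := by
  by_contra! hall
  refine h fun z => ?_
  have := hall z
  rcases z with z | z <;> rcases hz : ρ _ with w | w <;> simp_all

theorem ind_invar {κ : Perm X} {χ : X → Prop} (h : Invar κ χ) : Invar κ fun z => ind (χ z) :=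
  fun z => congrArg ind (h z)

variable [Finite X]

/-- The first order moments of a product of elements of free subalgebras. -/
theorem cprod_moment_dbl {S : SecondOrderSpace A} (hfree : SecondOrderFree S B)
    (hr : ∀ x, r x ∈ B 0) (hv : ∀ x, v x ∈ B 1) (γ : Perm X) :
    cprod (dbl 1 γ) (ev (moment S) (dbl 1 γ) (Sum.elim r v)) =
      ∑ π : Perm X, ind (IsNC γ π) * cprod π (ev (cumulant S) π r) *
        cprod (π⁻¹ * γ) (ev (moment S) (π⁻¹ * γ) v) := by
  rw [cprod_moment, ncSum, sum_perm_sum]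
  · refine Finset.sum_congr rfl fun π _ => ?_
    rw [cprod_moment, ncSum, Finset.mul_sum]
    refine Finset.sum_congr rfl fun σ _ => ?_
    rw [isNC_dbl, ind_and, cprod_ev_sumCongr (cumulant_cyclicInv S)]
    simp only [Sum.elim_inl, Sum.elim_inr]
    ring
  · intro ρ hρ
    obtain ⟨z, hz⟩ := exists_ne_of_not_invar hρ
    rw [cprod_cumulant_eq_zero hfree (elim_mem hr hv) hz, mul_zero]

theorem annSum_dbl {S : SecondOrderSpace A} (hfree : SecondOrderFree S B)
    (hr : ∀ x, r x ∈ B 0) (hv : ∀ x, v x ∈ B 1) {γ : Perm X} {x y : X}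
    (hxy : ¬ γ.SameCycle x y) (hcov : ∀ z, γ.SameCycle x z ∨ γ.SameCycle y z) :
    annSum (dbl 1 γ) (Sum.inl x) (Sum.inl y) (cumulant S) (Sum.elim r v) =
      ∑ π : Perm X, ind (IsAnn γ π x y) * cprod π (ev (cumulant S) π r) *
        ncSum (π⁻¹ * γ) (cumulant S) v +
      ∑ π : Perm X, ind (IsNC γ π) * cprod π (ev (cumulant S) π r) *
        ∑ c : Cyc (π⁻¹ * γ), ∑ d : Cyc (π⁻¹ * γ),
          ind (γ.SameCycle x c.rep) * ind (γ.SameCycle y d.rep) *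
            annSum (π⁻¹ * γ) c.rep d.rep (cumulant S) v := by
  rw [annSum, sum_perm_sum]
  · rw [← Finset.sum_add_distrib]
    refine Finset.sum_congr rfl fun π _ => ?_
    simp only [annSum, ncSum, Finset.mul_sum]
    rw [Finset.sum_congr rfl fun c _ => Finset.sum_comm, Finset.sum_comm,
      ← Finset.sum_add_distrib]
    refine Finset.sum_congr rfl fun σ _ => ?_
    rw [ind_isAnn_dbl hxy hcov, cprod_ev_sumCongr (cumulant_cyclicInv S), add_mul]
    simp only [Sum.elim_inl, Sum.elim_inr, Finset.mul_sum, Finset.sum_mul]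
    congr 1
    · ring
    · refine Finset.sum_congr rfl fun c _ => Finset.sum_congr rfl fun d _ => ?_
      ring
  · intro ρ hρ
    obtain ⟨z, hz⟩ := exists_ne_of_not_invar hρ
    rw [cprod_cumulant_eq_zero hfree (elim_mem hr hv) hz, mul_zero]

theorem sum_cyc_ind (κ : Perm X) {f : X → ℂ} (hf : Invar κ f) (z : X) :
    ∑ c : Cyc κ, f c.rep * ind (κ.SameCycle c.rep z) = f z := by
  rw [Finset.sum_eq_single (Cyc.mk κ z), hf.rep, ind_of (Cyc.rep_sameCycle κ z), mul_one]
  · intro c _ hc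
    rw [ind_of_not, mul_zero]
    intro h
    rw [← Cyc.mk_eq_mk, Cyc.mk_rep] at h
    exact hc h
  · simp

theorem sum_sum_sum_sum_comm {ι κ : Type*} [Fintype ι] [Fintype κ] (f : ι → ι → κ → κ → ℂ) :
    ∑ a, ∑ b, ∑ c, ∑ d, f a b c d = ∑ c, ∑ d, ∑ a, ∑ b, f a b c d := by
  have h : ∀ g : ι → κ → κ → ℂ, ∑ b, ∑ c, ∑ d, g b c d = ∑ c, ∑ d, ∑ b, g b c d := fun g => by
    rw [Finset.sum_comm]
    exact Finset.sum_congr rfl fun c _ => Finset.sum_comm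
  simp only [h]

/-- Sorts the marked points by the cycles of `κ` that contain them. Below, `κ` is the complement and
the points represent the cycles of `σ`. -/
theorem sum_sum_cyc_ind (κ : Perm X) {ι : Type*} [Fintype ι] (z : ι → X) {f g : X → ℂ}
    (hf : Invar κ f) (hg : Invar κ g) (T : ι → ι → ℂ) :
    ∑ c, ∑ d, f (z c) * g (z d) * T c d =
      ∑ C : Cyc κ, ∑ D : Cyc κ, f C.rep * g D.rep *
        ∑ c, ∑ d, ind (κ.SameCycle C.rep (z c)) * ind (κ.SameCycle D.rep (z d)) * T c d := by
  simp only [Finset.mul_sum]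
  rw [sum_sum_sum_sum_comm]
  refine Finset.sum_congr rfl fun c _ => Finset.sum_congr rfl fun d _ => ?_
  rw [← sum_cyc_ind κ hf (z c), ← sum_cyc_ind κ hg (z d), Finset.sum_mul_sum, Finset.sum_mul]
  refine Finset.sum_congr rfl fun C _ => ?_
  rw [Finset.sum_mul]
  refine Finset.sum_congr rfl fun D _ => ?_
  ring

/-- A second order cumulant with marked cycles of different colours is mixed and vanishes. Both
marked cycles therefore belong to `π`, which gives the first sum, or both to `σ`, which gives the
second. -/
theorem pairSum_dbl {S : SecondOrderSpace A} (hfree : SecondOrderFree S B)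
    (hr : ∀ x, r x ∈ B 0) (hv : ∀ x, v x ∈ B 1) {γ : Perm X} {x y : X} :
    pairSum (dbl 1 γ) (Sum.inl x) (Sum.inl y) (cumulant S) (cumulant₂ S) (Sum.elim r v) =
      ∑ π : Perm X, ind (IsNC γ π) * (∑ c : Cyc π, ∑ d : Cyc π, ind (γ.SameCycle x c.rep) *
        ind (γ.SameCycle y d.rep) * pairTerm (cumulant S) (cumulant₂ S) π r c.rep d.rep) *
        ncSum (π⁻¹ * γ) (cumulant S) v +
      ∑ π : Perm X, ind (IsNC γ π) * cprod π (ev (cumulant S) π r) *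
        ∑ c : Cyc (π⁻¹ * γ), ∑ d : Cyc (π⁻¹ * γ),
          ind (γ.SameCycle x c.rep) * ind (γ.SameCycle y d.rep) *
            pairSum (π⁻¹ * γ) c.rep d.rep (cumulant S) (cumulant₂ S) v := by
  have hF := cumulant_cyclicInv S
  have hF₂ := cumulant₂_cyclicInv S
  rw [pairSum, sum_perm_sum]
  · rw [← Finset.sum_add_distrib]
    refine Finset.sum_congr rfl fun π _ => ?_
    by_cases hπ : IsNC γ π
    swap
    · simp only [isNC_dbl, ind_and, ind_of_not hπ, zero_mul, Finset.sum_const_zero, add_zero]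
    have hκx := (hπ.invar (invar_sameCycle γ x)).inv.mul (invar_sameCycle γ x)
    have hκy := (hπ.invar (invar_sameCycle γ y)).inv.mul (invar_sameCycle γ y)
    have h1 : ∑ c : Cyc (π⁻¹ * γ), ∑ d : Cyc (π⁻¹ * γ),
          ind (γ.SameCycle x c.rep) * ind (γ.SameCycle y d.rep) *
            pairSum (π⁻¹ * γ) c.rep d.rep (cumulant S) (cumulant₂ S) v =
        ∑ σ : Perm X, ind (IsNC (π⁻¹ * γ) σ) * ∑ c : Cyc σ, ∑ d : Cyc σ,
          ind (γ.SameCycle x c.rep) * ind (γ.SameCycle y d.rep) *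
            pairTerm (cumulant S) (cumulant₂ S) σ v c.rep d.rep := by
      simp only [pairSum, Finset.mul_sum]
      rw [Finset.sum_congr rfl fun c _ => Finset.sum_comm, Finset.sum_comm]
      refine Finset.sum_congr rfl fun σ _ => ?_
      simp only [← Finset.mul_sum]
      rw [sum_sum_cyc_ind (π⁻¹ * γ) (fun c : Cyc σ => c.rep) (ind_invar hκx) (ind_invar hκy)
        (fun c d => pairTerm (cumulant S) (cumulant₂ S) σ v c.rep d.rep)]
      simp only [Finset.mul_sum]
      refine Finset.sum_congr rfl fun c _ => Finset.sum_congr rfl fun d _ =>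
        Finset.sum_congr rfl fun c _ => Finset.sum_congr rfl fun d _ => ?_
      ring
    rw [h1, ind_of hπ, one_mul, one_mul, ncSum, Finset.mul_sum, Finset.mul_sum,
      ← Finset.sum_add_distrib]
    refine Finset.sum_congr rfl fun σ _ => ?_
    by_cases hσ : IsNC (π⁻¹ * γ) σ
    · have h := isNC_dbl.mpr ⟨hπ, hσ⟩
      rw [csum_csum_sumCongr π σ (f := fun z w =>
        ind ((dbl 1 γ).SameCycle (Sum.inl x) z) *
          ind ((dbl 1 γ).SameCycle (Sum.inl y) w) *
          pairTerm (cumulant S) (cumulant₂ S) (Perm.sumCongr π σ) (Sum.elim r v) z w)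
        (fun w => h.pairTerm_invar_left hF₂ _ _ _ w)
        (fun z => h.pairTerm_invar_right hF₂ _ _ _ _)]
      have hm1 : ∀ z w, pairTerm (cumulant S) (cumulant₂ S) (Perm.sumCongr π σ) (Sum.elim r v)
          (Sum.inl z) (Sum.inr w) = 0 := fun z w => by
        rw [pairTerm, ev₂_cumulant₂_eq_zero hfree (elim_mem hr hv) (Or.inl (Perm.SameCycle.refl _ _))
          (Or.inr (Perm.SameCycle.refl _ _)) (by simp), zero_mul]
      have hm2 : ∀ z w, pairTerm (cumulant S) (cumulant₂ S) (Perm.sumCongr π σ) (Sum.elim r v)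
          (Sum.inr w) (Sum.inl z) = 0 := fun z w => by
        rw [pairTerm, ev₂_cumulant₂_eq_zero hfree (elim_mem hr hv) (Or.inl (Perm.SameCycle.refl _ _))
          (Or.inr (Perm.SameCycle.refl _ _)) (by simp), zero_mul]
      simp only [hm1, hm2, mul_zero, Finset.sum_const_zero, add_zero, sameCycle_dbl_one_inl,
        sameCycle_dbl_one_inr, pairTerm_sumCongr_inl_inl hF, pairTerm_sumCongr_inr_inr hF,
        Sum.elim_inl, Sum.elim_inr, ind_of h, ind_of hσ, one_mul]
      rw [Finset.sum_mul, Finset.mul_sum]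
      congr 1
      · refine Finset.sum_congr rfl fun c _ => ?_
        rw [Finset.sum_mul]
        refine Finset.sum_congr rfl fun d _ => ?_
        ring
      · refine Finset.sum_congr rfl fun c _ => ?_
        rw [Finset.mul_sum]
        refine Finset.sum_congr rfl fun d _ => ?_
        ring
    · rw [ind_of_not fun h => hσ (isNC_dbl.mp h).2, ind_of_not hσ]
      ring
  · intro ρ hρ
    obtain ⟨z, hz⟩ := exists_ne_of_not_invar hρ
    simp only [pairTerm_cumulant_eq_zero hfree (elim_mem hr hv) hz, mul_zero,
      Finset.sum_const_zero]

/-- The fluctuation moments of products of elements of second order free subalgebras. -/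
theorem pairTerm_moment_dbl {S : SecondOrderSpace A} (hfree : SecondOrderFree S B)
    (hr : ∀ x, r x ∈ B 0) (hv : ∀ x, v x ∈ B 1) {γ : Perm X} {x y : X}
    (hxy : ¬ γ.SameCycle x y) (hcov : ∀ z, γ.SameCycle x z ∨ γ.SameCycle y z) :
    pairTerm (moment S) (moment₂ S) (dbl 1 γ) (Sum.elim r v) (Sum.inl x) (Sum.inl y) =
      ∑ π : Perm X, ind (IsAnn γ π x y) * cprod π (ev (cumulant S) π r) *
        cprod (π⁻¹ * γ) (ev (moment S) (π⁻¹ * γ) v) +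
      ∑ π : Perm X, ind (IsNC γ π) * (∑ c : Cyc π, ∑ d : Cyc π, ind (γ.SameCycle x c.rep) *
        ind (γ.SameCycle y d.rep) * pairTerm (cumulant S) (cumulant₂ S) π r c.rep d.rep) *
        cprod (π⁻¹ * γ) (ev (moment S) (π⁻¹ * γ) v) +
      ∑ π : Perm X, ind (IsNC γ π) * cprod π (ev (cumulant S) π r) *
        ∑ c : Cyc (π⁻¹ * γ), ∑ d : Cyc (π⁻¹ * γ),
          ind (γ.SameCycle x c.rep) * ind (γ.SameCycle y d.rep) *
            pairTerm (moment S) (moment₂ S) (π⁻¹ * γ) v c.rep d.rep := by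
  have hxy' : ¬ (dbl 1 γ).SameCycle (Sum.inl x) (Sum.inl y) := by rwa [sameCycle_dbl_one_inl]
  rw [pairTerm_moment S _ hxy', annSum_dbl hfree hr hv hxy hcov, pairSum_dbl hfree hr hv]
  -- For fixed `π`, the annular and the marked contributions of the letters `v` recombine to a
  -- fluctuation moment.
  have h : ∑ π : Perm X, ind (IsNC γ π) * cprod π (ev (cumulant S) π r) *
        ∑ c : Cyc (π⁻¹ * γ), ∑ d : Cyc (π⁻¹ * γ),
          ind (γ.SameCycle x c.rep) * ind (γ.SameCycle y d.rep) *
            pairTerm (moment S) (moment₂ S) (π⁻¹ * γ) v c.rep d.rep =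
      ∑ π : Perm X, ind (IsNC γ π) * cprod π (ev (cumulant S) π r) *
        ∑ c : Cyc (π⁻¹ * γ), ∑ d : Cyc (π⁻¹ * γ),
          ind (γ.SameCycle x c.rep) * ind (γ.SameCycle y d.rep) *
            annSum (π⁻¹ * γ) c.rep d.rep (cumulant S) v +
      ∑ π : Perm X, ind (IsNC γ π) * cprod π (ev (cumulant S) π r) *
        ∑ c : Cyc (π⁻¹ * γ), ∑ d : Cyc (π⁻¹ * γ),
          ind (γ.SameCycle x c.rep) * ind (γ.SameCycle y d.rep) *
            pairSum (π⁻¹ * γ) c.rep d.rep (cumulant S) (cumulant₂ S) v := by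
    rw [← Finset.sum_add_distrib]
    refine Finset.sum_congr rfl fun π _ => ?_
    by_cases hπ : IsNC γ π
    swap
    · rw [ind_of_not hπ]; ring
    rw [← mul_add]
    congr 1
    rw [← Finset.sum_add_distrib]
    refine Finset.sum_congr rfl fun c _ => ?_
    rw [← Finset.sum_add_distrib]
    refine Finset.sum_congr rfl fun d _ => ?_
    rw [← mul_add]
    -- The formula for two marked cycles requires them to be distinct. Here they are, because the
    -- complement of a non-crossing `π` preserves the cycles of `γ`.
    by_cases hcd : γ.SameCycle x c.rep ∧ γ.SameCycle y d.rep
    · rw [pairTerm_moment]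
      intro hs
      have hκx := (hπ.invar (invar_sameCycle γ x)).inv.mul (invar_sameCycle γ x)
      exact hxy (((hκx.sameCycle hs).mp hcd.1).trans hcd.2.symm)
    · rw [← ind_and, ind_of_not hcd, zero_mul, zero_mul]
  rw [h]
  simp only [cprod_moment]
  ring

end Products

/-! ### Products along cycles -/

section PathProducts

variable {M : Type*} [Monoid M] {X : Type}

/-- The product of the letters along the cycle of `π` through `x`. -/
noncomputable def pathProd (π : Perm X) (a : X → M) (x : X) : M :=
  (List.ofFn fun k : Fin (Function.minimalPeriod π x) => a ((π ^ (k : ℕ)) x)).prod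

theorem prod_ofFn_succ (w : ℕ → M) (n : ℕ) :
    (List.ofFn fun k : Fin (n + 1) => w k).prod = (List.ofFn fun k : Fin n => w k).prod * w n := by
  rw [List.ofFn_succ', List.concat_eq_append, List.prod_append, List.prod_singleton]
  rfl

theorem prod_ofFn_congr {m n : ℕ} (h : m = n) (w : ℕ → M) :
    (List.ofFn fun k : Fin m => w k).prod = (List.ofFn fun k : Fin n => w k).prod := by
  subst h; rfl

theorem prod_ofFn_two_mul (w : ℕ → M) (n : ℕ) :
    (List.ofFn fun k : Fin (2 * n) => w k).prod =
      (List.ofFn fun k : Fin n => w (2 * k) * w (2 * k + 1)).prod := by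
  induction n with
  | zero => simp
  | succ n ih =>
    rw [prod_ofFn_succ (fun k => w (2 * k) * w (2 * k + 1)), ← ih,
      prod_ofFn_congr (show 2 * (n + 1) = 2 * n + 1 + 1 by ring), prod_ofFn_succ, prod_ofFn_succ,
      mul_assoc]

theorem mul_prod_ofFn_telescope (g r h : ℕ → M) (n : ℕ) :
    g 0 * (List.ofFn fun k : Fin n => r k * (h k * g (k + 1))).prod =
      (List.ofFn fun k : Fin n => g k * r k * h k).prod * g n := by
  induction n with
  | zero => simp
  | succ n ih =>
    rw [prod_ofFn_succ (fun k => r k * (h k * g (k + 1))),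
      prod_ofFn_succ (fun k => g k * r k * h k), ← mul_assoc, ih]
    simp only [mul_assoc]

theorem mul_prod_ofFn_cancel (g h : ℕ → M) (hgh : ∀ k, g k * h k = 1) (n : ℕ) :
    g 0 * (List.ofFn fun k : Fin n => h k * g (k + 1)).prod = g n := by
  induction n with
  | zero => simp
  | succ n ih =>
    rw [prod_ofFn_succ (fun k => h k * g (k + 1)), ← mul_assoc, ih, ← mul_assoc, hgh, one_mul]

theorem dbl_one_pow_two_mul (γ : Perm X) (x : X) (k : ℕ) :
    (dbl 1 γ ^ (2 * k)) (Sum.inl x) = Sum.inl ((γ ^ k) x) := by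
  rw [pow_mul]
  exact (map_pow (π := γ) (ρ := dbl 1 γ ^ 2) (e := Sum.inl) (fun _ => rfl) k x).symm

theorem dbl_one_pow_two_mul_add_one (γ : Perm X) (x : X) (k : ℕ) :
    (dbl 1 γ ^ (2 * k + 1)) (Sum.inl x) = Sum.inr ((γ ^ k) x) := by
  rw [pow_succ', Perm.mul_apply, dbl_one_pow_two_mul]
  rfl

/-- Odd powers exchange the copies, so only even powers can fix a point. -/
theorem minimalPeriod_dbl_one (γ : Perm X) (x : X) :
    Function.minimalPeriod (dbl 1 γ) (Sum.inl x) = 2 * Function.minimalPeriod γ x := by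
  apply Nat.dvd_antisymm
  · rw [← Function.isPeriodicPt_iff_minimalPeriod_dvd, Function.IsPeriodicPt, Function.IsFixedPt,
      ← Perm.coe_pow, dbl_one_pow_two_mul, pow_minimalPeriod_apply]
  · have h := pow_minimalPeriod_apply (dbl 1 γ) (Sum.inl x)
    rcases Nat.even_or_odd' (Function.minimalPeriod (dbl 1 γ) (Sum.inl x)) with ⟨k, hk | hk⟩
    · rw [hk, dbl_one_pow_two_mul, Sum.inl.injEq] at h
      rw [hk]
      refine Nat.mul_dvd_mul_left 2 ?_
      rw [← Function.isPeriodicPt_iff_minimalPeriod_dvd, Function.IsPeriodicPt,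
        Function.IsFixedPt, ← Perm.coe_pow, h]
    · rw [hk, dbl_one_pow_two_mul_add_one] at h
      simp at h

theorem pathProd_dbl (γ : Perm X) (r v : X → M) (x : X) :
    pathProd (dbl 1 γ) (Sum.elim r v) (Sum.inl x) = pathProd γ (fun z => r z * v z) x := by
  rw [pathProd, prod_ofFn_congr (minimalPeriod_dbl_one γ x)
    (fun k => Sum.elim r v ((dbl 1 γ ^ k) (Sum.inl x))),
    prod_ofFn_two_mul (fun k => Sum.elim r v ((dbl 1 γ ^ k) (Sum.inl x)))]
  simp only [dbl_one_pow_two_mul, dbl_one_pow_two_mul_add_one, Sum.elim_inl, Sum.elim_inr]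
  rfl

/-- Regroups the letters `g r h` of a cyclic word as `r (h g)`. The surplus factor is `g x` at both
ends because the cycle closes up. -/
theorem mul_pathProd_telescope (γ : Perm X) (g r h : X → M) (x : X) :
    g x * pathProd γ (fun z => r z * (h z * g (γ z))) x =
      pathProd γ (fun z => g z * r z * h z) x * g x := by
  have := mul_prod_ofFn_telescope (fun k => g ((γ ^ k) x)) (fun k => r ((γ ^ k) x))
    (fun k => h ((γ ^ k) x)) (Function.minimalPeriod γ x)
  simp only [pow_minimalPeriod_apply, pow_succ', Perm.mul_apply] at this
  exact this

theorem pathProd_cancel (κ : Perm X) (g h : X → M) (hgh : ∀ z, g z * h z = 1)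
    (hhg : ∀ z, h z * g z = 1) (x : X) : pathProd κ (fun z => h z * g (κ z)) x = 1 := by
  have := mul_prod_ofFn_cancel (fun k => g ((κ ^ k) x)) (fun k => h ((κ ^ k) x))
    (fun k => hgh _) (Function.minimalPeriod κ x)
  simp only [pow_minimalPeriod_apply, pow_succ', Perm.mul_apply] at this
  have h2 : g x * pathProd κ (fun z => h z * g (κ z)) x = g x := this
  rw [← one_mul (pathProd _ _ _), ← hhg x, mul_assoc, h2]

end PathProducts

/-! ### Words in the product of an element with a unitary -/

section Words

variable {A : Type*} [Ring A] [StarRing A]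

/-- The factor to the left of `r` or `r*` in `u r` or `(u r)*`. -/
def leftFactor (u : A) (b : Bool) : A := if b then u else 1

/-- The factor to the right of `r` or `r*` in `u r` or `(u r)*`. -/
def rightFactor (u : A) (b : Bool) : A := if b then 1 else star u

theorem starPow_mul (u r : A) (b : Bool) :
    starPow (u * r) b = leftFactor u b * starPow r b * rightFactor u b := by
  cases b <;> simp [starPow, leftFactor, rightFactor]

theorem leftFactor_not_mul_rightFactor {u : A} (hu : u ∈ unitary A) (b : Bool) :
    leftFactor u (!b) * rightFactor u b = 1 := by
  cases b
  · simpa [leftFactor, rightFactor] using (Unitary.mem_iff.mp hu).2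
  · simp [leftFactor, rightFactor]

theorem rightFactor_mul_leftFactor_not {u : A} (hu : u ∈ unitary A) (b : Bool) :
    rightFactor u b * leftFactor u (!b) = 1 := by
  cases b
  · simpa [leftFactor, rightFactor] using (Unitary.mem_iff.mp hu).1
  · simp [leftFactor, rightFactor]

theorem leftFactor_mul_star {u : A} (hu : u ∈ unitary A) (b : Bool) :
    leftFactor u b * star (leftFactor u b) = 1 := by
  cases b
  · simp [leftFactor]
  · simpa [leftFactor] using (Unitary.mem_iff.mp hu).2

theorem star_mul_leftFactor {u : A} (hu : u ∈ unitary A) (b : Bool) :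
    star (leftFactor u b) * leftFactor u b = 1 := by
  cases b
  · simp [leftFactor]
  · simpa [leftFactor] using (Unitary.mem_iff.mp hu).1

variable {X : Type}

/-- The letters between two consecutive letters `r` or `r*` in a cyclic word in `u r` and
`(u r)*`. -/
def between (u : A) (γ : Perm X) (ε : X → Bool) (x : X) : A :=
  rightFactor u (ε x) * leftFactor u (ε (γ x))

theorem pathProd_starPow_mul {u : A} (hu : u ∈ unitary A) (r : A) (γ : Perm X) (ε : X → Bool)
    (x : X) : pathProd γ (fun z => starPow (u * r) (ε z)) x =
      leftFactor u (ε x) * pathProd γ (fun z => starPow r (ε z) * between u γ ε z) x *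
        star (leftFactor u (ε x)) := by
  have := mul_pathProd_telescope γ (fun z => leftFactor u (ε z)) (fun z => starPow r (ε z))
    (fun z => rightFactor u (ε z)) x
  simp only [between]
  rw [this, mul_assoc, leftFactor_mul_star hu, mul_one]
  simp only [starPow_mul]

/-- If `ε` changes along the cycles of `π`, then the words along the cycles of the Kreweras
complement `π⁻¹ γ` are trivial. -/
theorem pathProd_between {u : A} (hu : u ∈ unitary A) {π γ : Perm X} {ε : X → Bool}
    (hε : ∀ x, ε (π x) ≠ ε x) (x : X) : pathProd (π⁻¹ * γ) (between u γ ε) x = 1 := by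
  have h : between u γ ε = fun z =>
      rightFactor u (ε z) * leftFactor u (!(ε ((π⁻¹ * γ) z))) := by
    funext z
    -- The step of `π` from `(π⁻¹ γ) z` leads to `γ z`, so the left factor at `γ z` is determined by
    -- the sign at the next point of the complement's cycle.
    have h1 := hε ((π⁻¹ * γ) z)
    have h2 : π ((π⁻¹ * γ) z) = γ z := π.apply_symm_apply _
    rw [h2] at h1
    rw [between]
    congr 2
    exact Bool.eq_not_of_ne h1
  rw [h]
  exact pathProd_cancel _ (fun z => leftFactor u (!(ε z))) (fun z => rightFactor u (ε z))
    (fun z => leftFactor_not_mul_rightFactor hu _) (fun z => rightFactor_mul_leftFactor_not hu _) x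

end Words

/-! ### Alternating signs -/

section Signs

/-- Linear alternation fixes each sign by the parity of its position; even length then yields a sign
change at the closing step as well. -/
theorem ne_succ_of_alternating {n : ℕ} {e : ℕ → Bool} (h0 : e n = e 0) (hn : Even n)
    (h : ∀ k, k + 1 < n → e k ≠ e (k + 1)) (k : ℕ) (hk : k < n) : e k ≠ e (k + 1) := by
  have h1 : ∀ k, k < n → e k = (e 0 ^^ decide (Odd k)) := by
    intro k
    induction k with
    | zero => simp
    | succ k ih =>
      intro hk
      have h2 := h k hk
      rw [ih (by omega)] at h2
      rw [Bool.eq_not_of_ne h2.symm]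
      by_cases hk' : Odd k <;> simp [hk', Nat.odd_add_one]
  rcases Nat.lt_or_ge (k + 1) n with h2 | h2
  · exact h k h2
  · have h3 : n = k + 1 := by omega
    rw [← h3, h0, h1 k hk]
    have h4 : Odd k := by
      rw [h3, Nat.even_add_one, Nat.not_even_iff_odd] at hn
      exact hn
    simp [h4]

theorem even_of_ne_succ {n : ℕ} {e : ℕ → Bool} (h0 : e n = e 0)
    (h : ∀ k, k < n → e k ≠ e (k + 1)) : Even n := by
  have h1 : ∀ k, k ≤ n → e k = (e 0 ^^ decide (Odd k)) := by
    intro k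
    induction k with
    | zero => simp
    | succ k ih =>
      intro hk
      have h2 := h k hk
      rw [ih (by omega)] at h2
      rw [Bool.eq_not_of_ne h2.symm]
      by_cases hk' : Odd k <;> simp [hk', Nat.odd_add_one]
  have h2 := h1 n le_rfl
  rw [h0] at h2
  by_contra hn
  rw [Nat.not_even_iff_odd] at hn
  simp [hn] at h2

/-- A word of even length with alternating signs alternates cyclically. -/
theorem alternating_of_finRotate {n : ℕ} {ε : Fin (n + 1) → Bool}
    (h : ∀ i, ε (finRotate (n + 1) i) ≠ ε i) : Even (n + 1) ∧ Alternating ε := by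
  have h1 : ((finRotate (n + 1)) ^ (n + 1)) 0 = 0 := by
    have := pow_minimalPeriod_apply (finRotate (n + 1)) 0
    rwa [minimalPeriod_finRotate] at this
  constructor
  · refine even_of_ne_succ (e := fun k => ε ((finRotate (n + 1) ^ k) 0)) (by simp [h1]) ?_
    intro k _
    simp only [pow_succ', Perm.mul_apply]
    exact (h _).symm
  · intro i j hij
    have := h i
    have hi : (i : ℕ) < n := by have := j.2; omega
    rw [finRotate_of_lt hi] at this
    rw [show j = ⟨i + 1, by omega⟩ from Fin.ext hij.symm]
    exact this.symm

theorem sign_ne_of_alternating {X : Type} [Finite X] {π : Perm X} {ε : X → Bool} {x z : X}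
    (hn : Even (Function.minimalPeriod π x))
    (h : Alternating fun k : Fin (Function.minimalPeriod π x) => ε ((π ^ (k : ℕ)) x))
    (hz : π.SameCycle x z) : ε (π z) ≠ ε z := by
  obtain ⟨k, hk, rfl⟩ := exists_pow_lt_minimalPeriod hz
  have := ne_succ_of_alternating (e := fun k => ε ((π ^ k) x))
    (by simp [pow_minimalPeriod_apply]) hn
    (fun k hk => h ⟨k, by omega⟩ ⟨k + 1, hk⟩ rfl) k hk
  simp only [pow_succ', Perm.mul_apply] at this
  exact this.symm

end Signs

/-! ### Marked terms on two circles -/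

section PairTerm

variable {A : Type*} {X : Type} [Finite X] {m n : ℕ}

theorem twoCircles_cover (z : Fin (m + 1) ⊕ Fin (n + 1)) :
    (twoCircles (m + 1) (n + 1)).SameCycle (Sum.inl 0) z ∨
      (twoCircles (m + 1) (n + 1)).SameCycle (Sum.inr 0) z := by
  rcases z with z | z
  · exact Or.inl (sameCycle_sumCongr_inl.mpr (finRotate_sameCycle _ _))
  · exact Or.inr (sameCycle_sumCongr_inr.mpr (finRotate_sameCycle _ _))

theorem pairTerm_of_cover (F : ∀ n, (Fin n → A) → ℂ)
    (F₂ : ∀ m n, (Fin m → A) → (Fin n → A) → ℂ) {π : Perm X} {x y : X}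
    (h : ∀ z, π.SameCycle x z ∨ π.SameCycle y z) (a : X → A) :
    pairTerm F F₂ π a x y = ev₂ F₂ π a x π a y := by
  have : off π x (off π y (ev F π a)) = fun _ => 1 := by
    funext z
    by_cases h1 : π.SameCycle x z
    · rw [off, if_pos h1]
    · rw [off, if_neg h1, off, if_pos ((h z).resolve_left h1)]
  rw [pairTerm, this, cprod_one, mul_one]

theorem pairTerm_twoCircles (F : ∀ n, (Fin n → A) → ℂ)
    (F₂ : ∀ m n, (Fin m → A) → (Fin n → A) → ℂ) (a : Fin (m + 1) → A) (b : Fin (n + 1) → A) :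
    pairTerm F F₂ (twoCircles (m + 1) (n + 1)) (Sum.elim a b) (Sum.inl 0) (Sum.inr 0) =
      F₂ (m + 1) (n + 1) a b := by
  rw [pairTerm_of_cover F F₂ twoCircles_cover, ev₂_map F₂ (π := finRotate (m + 1)) (e := Sum.inl)
    Sum.inl_injective (fun _ => rfl) _ 0 (π' := finRotate (n + 1)) (e' := Sum.inr)
    Sum.inr_injective (fun _ => rfl) _ 0]
  exact ev₂_finRotate F₂ a b

theorem sum_cyc_ind_right (κ : Perm X) {f : X → ℂ} (hf : Invar κ f) (z : X) :
    ∑ c : Cyc κ, ind (κ.SameCycle z c.rep) * f c.rep = f z := by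
  rw [← sum_cyc_ind κ hf z]
  refine Finset.sum_congr rfl fun c _ => ?_
  rw [mul_comm, Perm.sameCycle_comm]

theorem sum_pairTerm_self {F : ∀ n, (Fin n → A) → ℂ}
    {F₂ : ∀ m n, (Fin m → A) → (Fin n → A) → ℂ} (hF₂ : CyclicInv₂ F₂) (γ : Perm X) (a : X → A)
    (x y : X) (k : ℂ) :
    ∑ c : Cyc γ, ∑ d : Cyc γ, ind (γ.SameCycle x c.rep) * ind (γ.SameCycle y d.rep) *
      (pairTerm F F₂ γ a c.rep d.rep * k) = pairTerm F F₂ γ a x y * k := by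
  have h1 : ∀ c : Cyc γ, ∑ d : Cyc γ, ind (γ.SameCycle x c.rep) * ind (γ.SameCycle y d.rep) *
      (pairTerm F F₂ γ a c.rep d.rep * k) =
      ind (γ.SameCycle x c.rep) * (pairTerm F F₂ γ a c.rep y * k) := fun c => by
    simp only [mul_assoc, ← Finset.mul_sum]
    congr 1
    exact sum_cyc_ind_right γ (f := fun d => pairTerm F F₂ γ a c.rep d * k)
      (fun d => congrArg (· * k) (pairTerm_invar_right hF₂ γ a c.rep d)) y
  simp only [h1]
  exact sum_cyc_ind_right γ (f := fun c => pairTerm F F₂ γ a c y * k)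
    (fun c => congrArg (· * k) (pairTerm_invar_left hF₂ γ a y c)) x

theorem minimalPeriod_perm_pos (π : Perm X) (x : X) : 0 < Function.minimalPeriod π x :=
  Function.minimalPeriod_pos_of_mem_periodicPts
    (Function.Injective.mem_periodicPts π.injective x)

theorem minimalPeriod_sumCongr_inl {Y Z : Type} (σ : Perm Y) (τ : Perm Z) (y : Y) :
    Function.minimalPeriod (Perm.sumCongr σ τ) (Sum.inl y) = Function.minimalPeriod σ y :=
  minimalPeriod_map (e := Sum.inl) Sum.inl_injective (fun _ => rfl) y

theorem minimalPeriod_sumCongr_inr {Y Z : Type} (σ : Perm Y) (τ : Perm Z) (z : Z) :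
    Function.minimalPeriod (Perm.sumCongr σ τ) (Sum.inr z) = Function.minimalPeriod τ z :=
  minimalPeriod_map (e := Sum.inr) Sum.inr_injective (fun _ => rfl) z

/-- Makes the induction on the total length of second order cumulants work: every term other than
the top one has shorter marked cycles. -/
theorem minimalPeriod_add_lt {m n : ℕ} {π : Perm (Fin m ⊕ Fin n)} (hπ : IsNC (twoCircles m n) π)
    (hne : π ≠ twoCircles m n) (i : Fin m) (j : Fin n) :
    Function.minimalPeriod π (Sum.inl i) + Function.minimalPeriod π (Sum.inr j) < m + n := by
  obtain ⟨σ, τ, rfl⟩ := exists_eq_sumCongr (hπ.invar (invar_sumCongr_isLeft _ _))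
  rw [isNC_sumCongr, ← mem_discNC, ← mem_discNC] at hπ
  rw [minimalPeriod_sumCongr_inl, minimalPeriod_sumCongr_inr]
  have h1 := cycleLen_le σ i
  have h2 := cycleLen_le τ j
  rw [cycleLen] at h1 h2
  by_cases hσ : σ = finRotate m
  · have hτ : τ ≠ finRotate n := fun h => hne (by rw [hσ, h])
    have := cycleLen_lt hπ.2 hτ j
    rw [cycleLen] at this
    omega
  · have := cycleLen_lt hπ.1 hσ i
    rw [cycleLen] at this
    omega

end PairTerm

/-! ### Words in an element and its adjoint -/

section StarPow

variable {A : Type*} [Ring A] [StarRing A] {m n : ℕ}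

theorem elim_starPow (a : A) (ε : Fin (m + 1) → Bool) (δ : Fin (n + 1) → Bool) :
    Sum.elim (fun i => starPow a (ε i)) (fun i => starPow a (δ i)) =
      fun z => starPow a (Sum.elim ε δ z) := by
  funext z
  rcases z with z | z <;> rfl

theorem altWord_star (a : A) (p : ℕ) :
    altWord (star a) (2 * p) = fun i => altWord a (2 * p) (finRotate (2 * p) i) := by
  funext i
  -- The length `2 * p` is even, so the alternating sequence closes up and replacing `a` by `a*` is
  -- a rotation by one place.
  have h := apply_finRotate (fun k => starPow a (decide (Even k))) (by simp) i
  refine Eq.trans ?_ h.symm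
  by_cases hi : Even (i : ℕ) <;> simp [altWord, starPow, hi, Nat.even_add_one]

theorem starMonomial_ofFn (a : A) {n : ℕ} (ε : Fin n → Bool) :
    starMonomial a (List.ofFn ε) = (List.ofFn fun i => starPow a (ε i)).prod := by
  rw [starMonomial, List.map_ofFn]
  rfl

end StarPow

/-! ### Membership in the generated subalgebras and moments along cycles -/

section PathProd

variable {A : Type*} [Ring A] [StarRing A] [Algebra ℂ A] [StarModule ℂ A] {X : Type}

theorem starPow_mem_adjoin (a : A) (b : Bool) :
    starPow a b ∈ (StarAlgebra.adjoin ℂ {a}).toSubalgebra := by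
  have h : a ∈ StarAlgebra.adjoin ℂ {a} := StarAlgebra.self_mem_adjoin_singleton ℂ a
  cases b
  · exact (StarAlgebra.adjoin ℂ {a}).star_mem' h
  · exact h

theorem between_mem_adjoin (u : A) (γ : Perm X) (ε : X → Bool) (x : X) :
    between u γ ε x ∈ (StarAlgebra.adjoin ℂ {u}).toSubalgebra := by
  have h : u ∈ StarAlgebra.adjoin ℂ {u} := StarAlgebra.self_mem_adjoin_singleton ℂ u
  refine mul_mem ?_ ?_
  · cases ε x
    · exact (StarAlgebra.adjoin ℂ {u}).star_mem' h
    · exact one_mem _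
  · cases ε (γ x)
    · exact one_mem _
    · exact h

theorem ev_moment (S : SecondOrderSpace A) (π : Perm X) (a : X → A) (x : X) :
    ev (moment S) π a x = S.φ (pathProd π a x) := rfl

theorem ev₂_moment₂ (S : SecondOrderSpace A) (π : Perm X) (a : X → A) (x y : X) :
    ev₂ (moment₂ S) π a x π a y = S.φ₂ (pathProd π a x) (pathProd π a y) := rfl

end PathProd

/-! ### Moments of `u r` in terms of cumulants of `r` -/

section Main

variable {A : Type*} [Ring A] [StarRing A] [Algebra ℂ A] [StarModule ℂ A] {X : Type} [Finite X]
  {S : SecondOrderSpace A} {r u : A}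

/-- The product of the moments of `u` along the cycles of the Kreweras complement of `π`. -/
noncomputable def complementMoment (S : SecondOrderSpace A) (u : A) (γ : Perm X) (ε : X → Bool)
    (π : Perm X) : ℂ :=
  cprod (π⁻¹ * γ) (ev (moment S) (π⁻¹ * γ) (between u γ ε))

theorem complementMoment_eq_one (hu : u ∈ unitary A) {π γ : Perm X} {ε : X → Bool}
    (hε : ∀ x, ε (π x) ≠ ε x) : complementMoment S u γ ε π = 1 := by
  rw [complementMoment, cprod_congr (g := fun _ => 1), cprod_one]
  intro x
  rw [ev_moment, pathProd_between hu hε, S.φ_one]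

/-- The complement of `γ` in itself is the identity, so each separating letter forms a cycle of its
own. Between two equal signs this letter is `u` or `u*`. -/
theorem complementMoment_self_eq_zero (hu : S.φ u = 0) (hu' : S.φ (star u) = 0) {γ : Perm X}
    {ε : X → Bool} {x : X} (hx : ε (γ x) = ε x) : complementMoment S u γ ε γ = 0 := by
  rw [complementMoment, inv_mul_cancel]
  refine cprod_eq_zero ((moment_cyclicInv S).ev_invar _ _) (x := x) ?_
  have h : pathProd 1 (between u γ ε) x = between u γ ε x := by
    have h1 : Function.minimalPeriod (1 : Perm X) x = 1 :=
      Function.minimalPeriod_eq_one_iff_isFixedPt.mpr rfl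
    rw [pathProd, prod_ofFn_congr h1 fun k => between u γ ε (((1 : Perm X) ^ k) x)]
    simp
  rw [ev_moment, h, between, hx]
  cases ε x <;> simp [leftFactor, rightFactor, hu, hu']

theorem φ_conj (S : SecondOrderSpace A) {g g' : A} (h : g' * g = 1) (a : A) :
    S.φ (g * a * g') = S.φ a := by
  rw [S.φ_tracial, ← mul_assoc, h, one_mul]

theorem φ₂_conj (S : SecondOrderSpace A) {g g' k k' : A} (h : g' * g = 1) (h' : k' * k = 1)
    (a b : A) : S.φ₂ (g * a * g') (k * b * k') = S.φ₂ a b := by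
  rw [S.φ₂_tracial_left, S.φ₂_tracial_right, ← mul_assoc, h, one_mul, ← mul_assoc, h', one_mul]

/-- The first order moments of `u r`. -/
theorem moment_starPow_mul (hu : u ∈ unitary A) (hfree : SecondOrderStarFree S r u) {n : ℕ}
    (ε : Fin (n + 1) → Bool) :
    moment S (n + 1) (fun i => starPow (u * r) (ε i)) =
      ∑ π : Perm (Fin (n + 1)), ind (IsNC (finRotate (n + 1)) π) *
        cprod π (ev (cumulant S) π fun i => starPow r (ε i)) *
        complementMoment S u (finRotate (n + 1)) ε π := by
  have hΓ : ∀ x y, (dbl 1 (finRotate (n + 1))).SameCycle x y := by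
    have h : ∀ y, (dbl 1 (finRotate (n + 1))).SameCycle (Sum.inl 0) y := by
      rintro (y | y)
      · exact sameCycle_dbl_one_inl.mpr (finRotate_sameCycle _ _)
      · exact sameCycle_dbl_one_inr.mpr (finRotate_sameCycle _ _)
    exact fun x y => (h x).symm.trans (h y)
  have h := cprod_moment_dbl hfree (r := fun i => starPow r (ε i))
    (fun i => starPow_mem_adjoin r (ε i)) (between_mem_adjoin u (finRotate (n + 1)) ε)
    (finRotate (n + 1))
  rw [cprod_of_sameCycle hΓ ((moment_cyclicInv S).ev_invar _ _) (Sum.inl 0), ev_moment,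
    pathProd_dbl] at h
  rw [← ev_finRotate (moment S), ev_moment, pathProd_starPow_mul hu, φ_conj S (star_mul_leftFactor hu _), h]
  rfl

/-! ### Fluctuation moments of `r` and `u r` on two circles -/

section TwoCircles

variable {m n : ℕ}

/-- The fluctuation moments of `r`. -/
theorem moment₂_starPow (S : SecondOrderSpace A) (r : A) (ε : Fin (m + 1) → Bool)
    (δ : Fin (n + 1) → Bool) :
    moment₂ S (m + 1) (n + 1) (fun i => starPow r (ε i)) (fun i => starPow r (δ i)) =
      annSum (twoCircles (m + 1) (n + 1)) (Sum.inl 0) (Sum.inr 0) (cumulant S)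
        (fun z => starPow r (Sum.elim ε δ z)) +
      pairSum (twoCircles (m + 1) (n + 1)) (Sum.inl 0) (Sum.inr 0) (cumulant S) (cumulant₂ S)
        (fun z => starPow r (Sum.elim ε δ z)) := by
  rw [← pairTerm_twoCircles (moment S) (moment₂ S), pairTerm_moment S _ not_sameCycle_sumCongr, elim_starPow]

/-- The fluctuation moments of `u r`. -/
theorem moment₂_starPow_mul (hu : u ∈ unitary A) (hfree : SecondOrderStarFree S r u)
    (ε : Fin (m + 1) → Bool) (δ : Fin (n + 1) → Bool) {γ : Perm (Fin (m + 1) ⊕ Fin (n + 1))}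
    (hγ : γ = twoCircles (m + 1) (n + 1)) {a : Fin (m + 1) ⊕ Fin (n + 1) → A}
    (ha : a = fun z => starPow r (Sum.elim ε δ z)) :
    moment₂ S (m + 1) (n + 1) (fun i => starPow (u * r) (ε i)) (fun i => starPow (u * r) (δ i)) =
      ∑ π, ind (IsAnn γ π (Sum.inl 0) (Sum.inr 0)) * cprod π (ev (cumulant S) π a) *
        complementMoment S u γ (Sum.elim ε δ) π +
      ∑ π, ind (IsNC γ π) * (∑ c : Cyc π, ∑ d : Cyc π, ind (γ.SameCycle (Sum.inl 0) c.rep) *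
        ind (γ.SameCycle (Sum.inr 0) d.rep) *
          pairTerm (cumulant S) (cumulant₂ S) π a c.rep d.rep) *
        complementMoment S u γ (Sum.elim ε δ) π +
      ∑ π, ind (IsNC γ π) * cprod π (ev (cumulant S) π a) *
        ∑ c : Cyc (π⁻¹ * γ), ∑ d : Cyc (π⁻¹ * γ),
          ind (γ.SameCycle (Sum.inl 0) c.rep) * ind (γ.SameCycle (Sum.inr 0) d.rep) *
            pairTerm (moment S) (moment₂ S) (π⁻¹ * γ) (between u γ (Sum.elim ε δ))
              c.rep d.rep := by
  have hxy : ¬ γ.SameCycle (Sum.inl 0) (Sum.inr 0) := by rw [hγ]; exact not_sameCycle_sumCongr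
  have hcov : ∀ z, γ.SameCycle (Sum.inl 0) z ∨ γ.SameCycle (Sum.inr 0) z := by
    rw [hγ]; exact twoCircles_cover
  have hcov' : ∀ z, (dbl 1 γ).SameCycle (Sum.inl (Sum.inl 0)) z ∨
      (dbl 1 γ).SameCycle (Sum.inl (Sum.inr 0)) z := by
    rintro (z | z)
    · simpa only [sameCycle_dbl_one_inl] using hcov z
    · simpa only [sameCycle_dbl_one_inr] using hcov z
  have h := pairTerm_moment_dbl hfree (r := a) (v := between u γ (Sum.elim ε δ))
    (fun z => by rw [ha]; exact starPow_mem_adjoin r _) (between_mem_adjoin u γ _) hxy hcov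
  rw [pairTerm_of_cover _ _ hcov', ev₂_moment₂, pathProd_dbl, pathProd_dbl] at h
  refine Eq.trans ?_ h
  rw [← pairTerm_twoCircles (moment S) (moment₂ S), elim_starPow, pairTerm_of_cover _ _ twoCircles_cover,
    ev₂_moment₂, pathProd_starPow_mul hu, pathProd_starPow_mul hu,
    φ₂_conj S (star_mul_leftFactor hu _) (star_mul_leftFactor hu _), ha, hγ]

end TwoCircles

/-! ### Consequences of the vanishing of non-alternating cumulants -/

theorem sign_ne_of_ev_ne_zero {π : Perm X} {ε : X → Bool} {x : X}
    (hr : ∀ ε' : Fin (Function.minimalPeriod π x) → Bool,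
      ¬ (Even (Function.minimalPeriod π x) ∧ Alternating ε') →
        cumulant S _ (fun i => starPow r (ε' i)) = 0)
    (h : ev (cumulant S) π (fun z => starPow r (ε z)) x ≠ 0) {z : X} (hz : π.SameCycle x z) :
    ε (π z) ≠ ε z := by
  by_contra hne
  refine h (hr (fun k => ε ((π ^ (k : ℕ)) x)) fun h' => ?_)
  exact sign_ne_of_alternating h'.1 h'.2 hz hne

/-- The vanishing hypothesis is restricted to the lengths of cycles of `π`, so that an induction
hypothesis can be supplied for it. -/
theorem sign_ne_of_cprod_ne_zero {π : Perm X} {ε : X → Bool}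
    (hr : ∀ x, ∀ ε' : Fin (Function.minimalPeriod π x) → Bool,
      ¬ (Even (Function.minimalPeriod π x) ∧ Alternating ε') →
        cumulant S _ (fun i => starPow r (ε' i)) = 0)
    (h : cprod π (ev (cumulant S) π fun z => starPow r (ε z)) ≠ 0) (z : X) :
    ε (π z) ≠ ε z := by
  refine sign_ne_of_ev_ne_zero (hr z) (fun h0 => h ?_) (Perm.SameCycle.refl _ _)
  exact cprod_eq_zero ((cumulant_cyclicInv S).ev_invar _ _) h0

theorem sign_ne_of_pairTerm_ne_zero (hr : IsRDiagonal S r) {π : Perm X} {ε : X → Bool} {x y : X}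
    (hr₂ : ∀ (ε' : Fin (Function.minimalPeriod π x) → Bool)
      (δ' : Fin (Function.minimalPeriod π y) → Bool),
      ¬ (Even (Function.minimalPeriod π x) ∧ Even (Function.minimalPeriod π y) ∧
        Alternating ε' ∧ Alternating δ') →
        cumulant₂ S _ _ (fun i => starPow r (ε' i)) (fun i => starPow r (δ' i)) = 0)
    (h : pairTerm (cumulant S) (cumulant₂ S) π (fun z => starPow r (ε z)) x y ≠ 0) (z : X) :
    ε (π z) ≠ ε z := by
  rw [pairTerm] at h
  have h1 : Even (Function.minimalPeriod π x) ∧ Even (Function.minimalPeriod π y) ∧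
      Alternating (fun k : Fin (Function.minimalPeriod π x) => ε ((π ^ (k : ℕ)) x)) ∧
      Alternating (fun k : Fin (Function.minimalPeriod π y) => ε ((π ^ (k : ℕ)) y)) := by
    by_contra hne
    exact left_ne_zero_of_mul h (hr₂ _ _ hne)
  by_cases hx : π.SameCycle x z
  · exact sign_ne_of_alternating h1.1 h1.2.2.1 hx
  by_cases hy : π.SameCycle y z
  · exact sign_ne_of_alternating h1.2.1 h1.2.2.2 hy
  refine sign_ne_of_ev_ne_zero (x := z) (hr _ (minimalPeriod_perm_pos _ _)) (fun h0 => ?_)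
    (Perm.SameCycle.refl _ _)
  refine right_ne_zero_of_mul h (cprod_eq_zero ((((cumulant_cyclicInv S).ev_invar _ _).off _).off _)
    (x := z) ?_)
  rw [off, if_neg hx, off, if_neg hy, h0]

theorem moment_starPow_mul_of_isRDiagonal (hu : u ∈ unitary A)
    (hfree : SecondOrderStarFree S r u) (hr : IsRDiagonal S r) {n : ℕ} (ε : Fin (n + 1) → Bool) :
    moment S (n + 1) (fun i => starPow (u * r) (ε i)) =
      moment S (n + 1) (fun i => starPow r (ε i)) := by
  rw [moment_starPow_mul hu hfree, moment_eq_ncSum, ncSum]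
  refine Finset.sum_congr rfl fun π _ => ?_
  by_cases h : cprod π (ev (cumulant S) π fun z => starPow r (ε z)) = 0
  · rw [h, mul_zero, zero_mul]
  · rw [complementMoment_eq_one hu (sign_ne_of_cprod_ne_zero
      (fun x => hr _ (minimalPeriod_perm_pos π x)) h), mul_one]

/-- The expansions of the two moments are subtracted. By induction every `π ≠ γ` with nonzero
cumulants has weight `1` and cancels, while `π = γ` has weight `0` for `u r`, so the top cumulant
vanishes. -/
theorem isRDiagonal_of_moment (hu : u ∈ unitary A) (hu1 : S.φ u = 0) (hu2 : S.φ (star u) = 0)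
    (hfree : SecondOrderStarFree S r u)
    (h : ∀ (n : ℕ) (ε : Fin (n + 1) → Bool), moment S (n + 1) (fun i => starPow (u * r) (ε i)) =
      moment S (n + 1) (fun i => starPow r (ε i))) : IsRDiagonal S r := by
  intro n
  induction n using Nat.strong_induction_on with
  | _ n ih =>
    intro hn ε hε
    obtain ⟨n, rfl⟩ := Nat.exists_eq_succ_of_ne_zero hn.ne'
    obtain ⟨x, hx⟩ : ∃ x, ε (finRotate (n + 1) x) = ε x := by
      by_contra! hne
      exact hε (alternating_of_finRotate hne)
    have h1 := h n ε
    rw [moment_starPow_mul hu hfree, moment_eq_ncSum, ncSum, ← sub_eq_zero,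
      ← Finset.sum_sub_distrib, Finset.sum_eq_single (finRotate (n + 1))] at h1
    · rw [complementMoment_self_eq_zero hu1 hu2 hx, mul_zero, zero_sub, neg_eq_zero,
        ind_of (mem_discNC.mp (finRotate_mem_discNC (n + 1))), one_mul,
        cprod_of_sameCycle finRotate_sameCycle ((cumulant_cyclicInv S).ev_invar _ _) 0,
        ev_finRotate] at h1
      exact h1
    · intro π _ hπ
      by_cases hnc : IsNC (finRotate (n + 1)) π
      swap
      · rw [ind_of_not hnc]; ring
      by_cases h0 : cprod π (ev (cumulant S) π fun z => starPow r (ε z)) = 0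
      · rw [h0]; ring
      · rw [complementMoment_eq_one hu (sign_ne_of_cprod_ne_zero (fun x => ?_) h0)]
        · ring
        · exact ih _ (cycleLen_lt (mem_discNC.mpr hnc) hπ x) (minimalPeriod_perm_pos π x)
    · simp

/-- For an R-diagonal element, the terms with a fluctuation moment of `u` vanish. -/
theorem sum_pairTerm_moment_eq_zero (hu : u ∈ unitary A) (hr : IsRDiagonal S r) {γ π : Perm X}
    {ε : X → Bool} {a : X → A} (ha : a = fun z => starPow r (ε z)) (x y : X) :
    ind (IsNC γ π) * cprod π (ev (cumulant S) π a) *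
      ∑ c : Cyc (π⁻¹ * γ), ∑ d : Cyc (π⁻¹ * γ),
        ind (γ.SameCycle x c.rep) * ind (γ.SameCycle y d.rep) *
          pairTerm (moment S) (moment₂ S) (π⁻¹ * γ) (between u γ ε) c.rep d.rep = 0 := by
  subst ha
  by_cases h : cprod π (ev (cumulant S) π fun z => starPow r (ε z)) = 0
  · rw [h, mul_zero, zero_mul]
  have hε := sign_ne_of_cprod_ne_zero (fun x => hr _ (minimalPeriod_perm_pos π x)) h
  have h1 : ∀ c d, pairTerm (moment S) (moment₂ S) (π⁻¹ * γ) (between u γ ε) c d = 0 := by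
    intro c d
    rw [pairTerm, ev₂_moment₂, pathProd_between hu hε, S.φ₂_one_left, zero_mul]
  simp only [h1, mul_zero, Finset.sum_const_zero]

theorem cprod_mul_complementMoment (hu : u ∈ unitary A) (hr : IsRDiagonal S r) {γ π : Perm X}
    {ε : X → Bool} {a : X → A} (ha : a = fun z => starPow r (ε z)) :
    cprod π (ev (cumulant S) π a) * complementMoment S u γ ε π =
      cprod π (ev (cumulant S) π a) := by
  subst ha
  by_cases h : cprod π (ev (cumulant S) π fun z => starPow r (ε z)) = 0
  · rw [h, zero_mul]
  · rw [complementMoment_eq_one hu (sign_ne_of_cprod_ne_zero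
      (fun x => hr _ (minimalPeriod_perm_pos π x)) h), mul_one]

/-- First order R-diagonality suffices to make the annular terms agree and to remove the terms with
a fluctuation moment of `u`. Only marked second order cumulants survive, weighted by the failure of
the complement moment to be `1`. -/
theorem moment₂_starPow_mul_sub (hu : u ∈ unitary A)
    (hfree : SecondOrderStarFree S r u) (hr : IsRDiagonal S r) {m n : ℕ}
    (ε : Fin (m + 1) → Bool) (δ : Fin (n + 1) → Bool) {γ : Perm (Fin (m + 1) ⊕ Fin (n + 1))}
    (hγ : γ = twoCircles (m + 1) (n + 1)) {a : Fin (m + 1) ⊕ Fin (n + 1) → A}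
    (ha : a = fun z => starPow r (Sum.elim ε δ z)) :
    moment₂ S (m + 1) (n + 1) (fun i => starPow r (ε i)) (fun i => starPow r (δ i)) -
    moment₂ S (m + 1) (n + 1) (fun i => starPow (u * r) (ε i)) (fun i => starPow (u * r) (δ i)) =
      ∑ π, ind (IsNC γ π) * ∑ c : Cyc π, ∑ d : Cyc π, ind (γ.SameCycle (Sum.inl 0) c.rep) *
        ind (γ.SameCycle (Sum.inr 0) d.rep) *
          (pairTerm (cumulant S) (cumulant₂ S) π a c.rep d.rep *
        (1 - complementMoment S u γ (Sum.elim ε δ) π)) := by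
  rw [moment₂_starPow, moment₂_starPow_mul hu hfree ε δ hγ ha,
    Finset.sum_eq_zero (fun π _ => sum_pairTerm_moment_eq_zero hu hr ha _ _), add_zero, ← hγ, ← ha]
  simp only [mul_assoc (ind (IsAnn _ _ _ _)), cprod_mul_complementMoment hu hr ha]
  rw [← annSum, add_sub_add_left_eq_sub, pairSum, ← Finset.sum_sub_distrib]
  refine Finset.sum_congr rfl fun π _ => ?_
  rw [mul_assoc, ← mul_sub]
  congr 1
  simp only [Finset.sum_mul, ← Finset.sum_sub_distrib]
  refine Finset.sum_congr rfl fun c _ => Finset.sum_congr rfl fun d _ => ?_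
  ring

theorem moment₂_starPow_mul_of_isSecondOrderRDiagonal (hu : u ∈ unitary A)
    (hfree : SecondOrderStarFree S r u) (hr : IsSecondOrderRDiagonal S r) {m n : ℕ}
    (ε : Fin (m + 1) → Bool) (δ : Fin (n + 1) → Bool) :
    moment₂ S (m + 1) (n + 1) (fun i => starPow r (ε i)) (fun i => starPow r (δ i)) =
    moment₂ S (m + 1) (n + 1) (fun i => starPow (u * r) (ε i))
      (fun i => starPow (u * r) (δ i)) := by
  rw [← sub_eq_zero, moment₂_starPow_mul_sub hu hfree hr.1 ε δ rfl rfl]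
  refine Finset.sum_eq_zero fun π _ => ?_
  rw [Finset.sum_eq_zero, mul_zero]
  intro c _
  refine Finset.sum_eq_zero fun d _ => ?_
  by_cases h : pairTerm (cumulant S) (cumulant₂ S) π (fun z => starPow r (Sum.elim ε δ z))
    c.rep d.rep = 0
  · rw [h, zero_mul, mul_zero]
  · rw [complementMoment_eq_one hu (sign_ne_of_pairTerm_ne_zero hr.1 (hr.2.1 _ _
      (minimalPeriod_perm_pos π _) (minimalPeriod_perm_pos π _)) h), sub_self, mul_zero, mul_zero]

/-- Induction on the total length: shorter nonzero second order cumulants alternate and get weight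
`1 - 1 = 0`. The top term has weight `1 - 0`, because some adjacent signs agree on one of the
circles. -/
theorem cumulant₂_eq_zero_of_moment₂ (hu : u ∈ unitary A) (hu1 : S.φ u = 0)
    (hu2 : S.φ (star u) = 0) (hfree : SecondOrderStarFree S r u) (hr : IsRDiagonal S r)
    (h : ∀ (m n : ℕ) (ε : Fin (m + 1) → Bool) (δ : Fin (n + 1) → Bool),
      moment₂ S (m + 1) (n + 1) (fun i => starPow r (ε i)) (fun i => starPow r (δ i)) =
      moment₂ S (m + 1) (n + 1) (fun i => starPow (u * r) (ε i))
        (fun i => starPow (u * r) (δ i))) (N : ℕ) :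
    ∀ (m n : ℕ), m + n = N → 0 < m → 0 < n → ∀ (ε : Fin m → Bool) (δ : Fin n → Bool),
      ¬ (Even m ∧ Even n ∧ Alternating ε ∧ Alternating δ) →
        cumulant₂ S m n (fun i => starPow r (ε i)) (fun i => starPow r (δ i)) = 0 := by
  induction N using Nat.strong_induction_on with
  | _ N ih =>
    rintro m n rfl hm hn ε δ hne
    obtain ⟨m, rfl⟩ : ∃ k, m = k + 1 := ⟨m - 1, by omega⟩
    obtain ⟨n, rfl⟩ : ∃ k, n = k + 1 := ⟨n - 1, by omega⟩
    obtain ⟨x, hx⟩ : ∃ x, Sum.elim ε δ (twoCircles (m + 1) (n + 1) x) = Sum.elim ε δ x := by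
      by_contra! hall
      have h1 := alternating_of_finRotate (fun i => hall (Sum.inl i))
      have h2 := alternating_of_finRotate (fun i => hall (Sum.inr i))
      exact hne ⟨h1.1, h2.1, h1.2, h2.2⟩
    have h1 := sub_eq_zero.mpr (h m n ε δ)
    rw [moment₂_starPow_mul_sub hu hfree hr ε δ rfl rfl,
      Finset.sum_eq_single (twoCircles (m + 1) (n + 1)), sum_pairTerm_self (cumulant₂_cyclicInv S),
      complementMoment_self_eq_zero hu1 hu2 hx, sub_zero, mul_one, ← elim_starPow,
      pairTerm_twoCircles, ind_of, one_mul] at h1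
    · exact h1
    · rw [isNC_sumCongr, ← mem_discNC, ← mem_discNC]
      exact ⟨finRotate_mem_discNC _, finRotate_mem_discNC _⟩
    · intro π _ hπ
      by_cases hnc : IsNC (twoCircles (m + 1) (n + 1)) π
      swap
      · rw [ind_of_not hnc, zero_mul]
      rw [Finset.sum_eq_zero, mul_zero]
      intro c _
      refine Finset.sum_eq_zero fun d _ => ?_
      -- The indicators leave only a first marked cycle on the first circle and a second one on the
      -- second circle, as the length estimate requires.
      rcases hc : c.rep with i | i
      swap
      · rw [ind_of_not not_sameCycle_sumCongr, zero_mul, zero_mul]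
      rcases hd : d.rep with j | j
      · rw [ind_of_not not_sameCycle_sumCongr', mul_zero, zero_mul]
      by_cases h0 : pairTerm (cumulant S) (cumulant₂ S) π
        (fun z => starPow r (Sum.elim ε δ z)) (Sum.inl i) (Sum.inr j) = 0
      · rw [h0, zero_mul, mul_zero]
      · rw [complementMoment_eq_one hu (sign_ne_of_pairTerm_ne_zero hr (ih _
          (minimalPeriod_add_lt hnc hπ i j) _ _ rfl
          (minimalPeriod_perm_pos π _) (minimalPeriod_perm_pos π _)) h0), sub_self, mul_zero,
          mul_zero]
    · simp

end Main

end SecondOrder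

/-! ### The characterization of second order R-diagonality -/

theorem proposition8p4 {A : Type*} [Ring A] [StarRing A] [Algebra ℂ A] [StarModule ℂ A]
    (S : SecondOrderSpace A) (r u : A)
    (hu : SecondOrder.IsSecondOrderHaarUnitary S u)
    (hfree : SecondOrder.SecondOrderStarFree S r u) :
    SecondOrder.IsSecondOrderRDiagonal S r ↔
      SecondOrder.SameSecondOrderStarDistribution S r (u * r) := by
  have hu1 : S.φ u = 0 := by simpa using (hu.2.1 1 le_rfl).1
  have hu2 : S.φ (star u) = 0 := by simpa using (hu.2.1 1 le_rfl).2
  constructor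
  · intro hr
    constructor
    · intro w
      obtain ⟨n, ε, rfl⟩ : ∃ (n : ℕ) (ε : Fin n → Bool), w = List.ofFn ε :=
        ⟨w.length, w.get, (List.ofFn_get w).symm⟩
      rw [SecondOrder.starMonomial_ofFn, SecondOrder.starMonomial_ofFn]
      cases n with
      | zero => simp
      | succ n => exact (SecondOrder.moment_starPow_mul_of_isRDiagonal hu.1 hfree hr.1 ε).symm
    · intro w w'
      obtain ⟨m, ε, rfl⟩ : ∃ (n : ℕ) (ε : Fin n → Bool), w = List.ofFn ε :=
        ⟨w.length, w.get, (List.ofFn_get w).symm⟩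
      obtain ⟨n, δ, rfl⟩ : ∃ (n : ℕ) (ε : Fin n → Bool), w' = List.ofFn ε :=
        ⟨w'.length, w'.get, (List.ofFn_get w').symm⟩
      simp only [SecondOrder.starMonomial_ofFn]
      cases m with
      | zero => simp [S.φ₂_one_left]
      | succ m =>
        cases n with
        | zero => simp [S.φ₂_one_right]
        | succ n =>
          exact SecondOrder.moment₂_starPow_mul_of_isSecondOrderRDiagonal hu.1 hfree hr ε δ
  · rintro ⟨h1, h2⟩
    have hr : SecondOrder.IsRDiagonal S r :=
      SecondOrder.isRDiagonal_of_moment hu.1 hu1 hu2 hfree fun n ε => by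
        have := h1 (List.ofFn ε)
        rw [SecondOrder.starMonomial_ofFn, SecondOrder.starMonomial_ofFn] at this
        exact this.symm
    refine ⟨hr, fun m n hm hn ε δ hne => ?_, fun p q _ _ => ?_⟩
    · refine SecondOrder.cumulant₂_eq_zero_of_moment₂ hu.1 hu1 hu2 hfree hr
        (fun m n ε δ => ?_) _ m n rfl hm hn ε δ hne
      have := h2 (List.ofFn ε) (List.ofFn δ)
      simp only [SecondOrder.starMonomial_ofFn] at this
      exact this
    -- The words starting with `r*` are rotations by one place of those starting with `r`, so the
    -- symmetry is an instance of cyclic invariance in each slot.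
    · rw [SecondOrder.altWord_star, SecondOrder.altWord_star,
        (SecondOrder.cumulant₂_cyclicInv S).1, (SecondOrder.cumulant₂_cyclicInv S).2]
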